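/- Consider unweighted minimum set cover instances with $n\ge 1$ elements and $m$ sets (given as an indexed family whose union is the whole ground set), and let $\mathsf{OPT}$ be the minimum number of sets that cover all elements. An algorithm is given $n$ and $m$ and may access the instance only through two queries, each answered in $O(1)$ time: $\mathrm{SetOf}(e,\ell)$, which returns the $\ell$-th set containing the element $e$ (in some fixed but arbitrary order), or Null if there is none, and $\mathrm{Membership}(e,S)$, which tells whether $e\in S$. The model of computation is the word RAM with words of $O(\log(n+m))$ bits, unit-cost word operations, and unit-cost sampling of a uniformly random integer below a given bound. There is an absolute constant $d$ such that for every constant $c$ there are a randomized algorithm and constants $A,K$ (depending only on $c$) such that on every such instance, with probability at least $1-1/n^{c}$, the algorithm halts within $$K\cdot T\log^{d}T,\qquad T=\min\left(m+n\cdot\mathsf{OPT},\ \frac{mn}{\mathsf{OPT}}\right),$$ steps, that is, in time $\tilde O\left(\min\left(m+n\cdot \mathsf{OPT},\frac{mn}{\mathsf{OPT}}\right)\right)$, and outputs a set cover consisting of at most $A\log n\cdot\mathsf{OPT}$ sets. -/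

import Mathlib

/-! ### Unweighted set cover instances with query access -/

/-- A set cover instance with elements `0, …, n - 1` and sets indexed by `0, …, m - 1` (repeated sets
are allowed), together with, for every element, the (arbitrary) order in which a SetOf query lists
the sets that contain it. -/
structure SetSystem (n m : ℕ) where
  /-- the sets of the instance -/
  set : Fin m → Finset (Fin n)
  /-- the sets containing an element, each listed once, in some fixed order -/
  setsOf : Fin n → List (Fin m)
  nodup_setsOf : ∀ e, (setsOf e).Nodup
  mem_setsOf : ∀ e j, j ∈ setsOf e ↔ e ∈ set j

namespace SetSystem

variable {n m : ℕ}

/-- The sets with index in `C` cover all elements. -/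
def IsCover (I : SetSystem n m) (C : Finset (Fin m)) : Prop :=
  ∀ e : Fin n, ∃ j ∈ C, e ∈ I.set j

/-- Every element lies in some set, i.e. a set cover exists. -/
def Coverable (I : SetSystem n m) : Prop :=
  ∀ e : Fin n, ∃ j : Fin m, e ∈ I.set j

/-- The minimum size of a set cover (meaningful for coverable instances). -/
noncomputable def opt (I : SetSystem n m) : ℕ :=
  sInf {k | ∃ C : Finset (Fin m), I.IsCover C ∧ C.card = k}

/-- The query SetOf: the index of the `l`-th set (counting from `0`) containing the element `e`.
The value `m`, which is not the index of a set, stands for Null: there is no such set. -/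
def setOfQuery (I : SetSystem n m) (e l : ℕ) : ℕ :=
  if he : e < n then
    if hl : l < (I.setsOf ⟨e, he⟩).length then ((I.setsOf ⟨e, he⟩)[l] : ℕ) else m
  else m

/-- The query Membership: `1` if the element `e` belongs to the set `j`, and `0` otherwise. -/
def memberQuery (I : SetSystem n m) (e j : ℕ) : ℕ :=
  if h : e < n ∧ j < m then
    if (⟨e, h.1⟩ : Fin n) ∈ I.set ⟨j, h.2⟩ then 1 else 0
  else 0

end SetSystem

/-! ### A randomized word RAM with SetOf and Membership queries

Programs are finite structured programs over registers and arrays of machine words.  As a program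
contains finitely many expressions, each of fixed size, evaluating an expression takes `O(1)` word
operations; one step of the machine executes one command. -/

/-- Operations on words; the comparisons return `1` for true and `0` for false. -/
inductive WordOp
  | add | sub | mul | div | mod | lt | eq

/-- The operations on natural numbers (subtraction is truncated); `Expr.eval` reduces the result
to a word. -/
def WordOp.eval : WordOp → ℕ → ℕ → ℕ
  | .add, a, b => a + b
  | .sub, a, b => a - b
  | .mul, a, b => a * b
  | .div, a, b => a / b
  | .mod, a, b => a % b
  | .lt, a, b => if a < b then 1 else 0
  | .eq, a, b => if a = b then 1 else 0

/-- Expressions: constants, registers, array cells `a[e]` and operations. -/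
inductive Expr
  | lit (c : ℕ)
  | reg (x : ℕ)
  | arr (a : ℕ) (e : Expr)
  | op (o : WordOp) (e₁ e₂ : Expr)

/-- Commands.  `sample x e` draws a uniformly random element of `{0, …, e}`, independently of
everything before; `setOf x e l` and `member x e j` issue the two kinds of queries. -/
inductive Cmd
  | skip
  | assign (x : ℕ) (e : Expr)
  | store (a : ℕ) (i e : Expr)
  | sample (x : ℕ) (e : Expr)
  | setOf (x : ℕ) (e l : Expr)
  | member (x : ℕ) (e j : Expr)
  | seq (c₁ c₂ : Cmd)
  | ite (b : Expr) (c₁ c₂ : Cmd)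
  | loop (b : Expr) (c : Cmd)

/-- The memory: registers and arrays. -/
@[ext]
structure Memory where
  reg : ℕ → ℕ
  arr : ℕ → ℕ → ℕ

namespace Memory

/-- Write `v` into register `x`. -/
def setReg (s : Memory) (x v : ℕ) : Memory :=
  { s with reg := Function.update s.reg x v }

/-- Write `v` into cell `i` of array `a`. -/
def setArr (s : Memory) (a i v : ℕ) : Memory :=
  { s with arr := Function.update s.arr a (Function.update (s.arr a) i v) }

/-- The initial memory: `n` in register `0`, `m` in register `1`, and zeros elsewhere. -/
def start (n m : ℕ) : Memory where
  reg := fun x => if x = 0 then n else if x = 1 then m else 0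
  arr := fun _ _ => 0

/-- The output: the first `ℓ` cells of array `0`, where `ℓ` is the content of register `0`. -/
def output (s : Memory) : List ℕ :=
  (List.range (s.reg 0)).map (s.arr 0)

end Memory

/-- The value of an expression on a machine with words of `w` bits. -/
def Expr.eval (w : ℕ) (s : Memory) : Expr → ℕ
  | .lit c => c % 2 ^ w
  | .reg x => s.reg x
  | .arr a e => s.arr a (e.eval w s)
  | .op o e₁ e₂ => o.eval (e₁.eval w s) (e₂.eval w s) % 2 ^ w

/-- A configuration: the commands that are still to be executed, in order, and the memory. -/
abbrev Config : Type := List Cmd × Memory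

/-- One step of the machine with words of `w` bits and query access to the instance `I`. -/
noncomputable def machineStep {n m : ℕ} (I : SetSystem n m) (w : ℕ) : Config → PMF Config
  | ([], s) => PMF.pure ([], s)
  | (.skip :: k, s) => PMF.pure (k, s)
  | (.assign x e :: k, s) => PMF.pure (k, s.setReg x (e.eval w s))
  | (.store a i e :: k, s) => PMF.pure (k, s.setArr a (i.eval w s) (e.eval w s))
  | (.sample x e :: k, s) =>
      (PMF.uniformOfFintype (Fin (e.eval w s + 1))).map fun v => (k, s.setReg x v)
  | (.setOf x e l :: k, s) =>
      PMF.pure (k, s.setReg x (I.setOfQuery (e.eval w s) (l.eval w s)))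
  | (.member x e j :: k, s) =>
      PMF.pure (k, s.setReg x (I.memberQuery (e.eval w s) (j.eval w s)))
  | (.seq c₁ c₂ :: k, s) => PMF.pure (c₁ :: c₂ :: k, s)
  | (.ite b c₁ c₂ :: k, s) => PMF.pure ((if b.eval w s ≠ 0 then c₁ else c₂) :: k, s)
  | (.loop b c :: k, s) => PMF.pure (if b.eval w s ≠ 0 then c :: .loop b c :: k else k, s)

/-- The distribution of the configuration after `t` steps. -/
noncomputable def machineRun {n m : ℕ} (I : SetSystem n m) (w : ℕ) : ℕ → Config → PMF Config
  | 0, σ => PMF.pure σ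
  | t + 1, σ => (machineStep I w σ).bind (machineRun I w t)

/-- A word length of `O(log (n + m))` bits: `k` times the binary length of `n + m`. -/
def wordLength (k n m : ℕ) : ℕ := k * Nat.size (n + m)

/-- The configurations in which the machine has halted and its output lists (indices of) at most
`r` sets that form a set cover. -/
def SuccessWithin {n m : ℕ} (I : SetSystem n m) (r : ℝ) : Set Config :=
  {σ | σ.1 = [] ∧ ∃ L : List (Fin m), σ.2.output = L.map Fin.val ∧
    I.IsCover L.toFinset ∧ (L.length : ℝ) ≤ r}

/-- The probability that the program `p`, started on the instance `I`, halts within `t` steps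
having output a set cover with at most `r` sets. -/
noncomputable def successProb {n m : ℕ} (p : Cmd) (w : ℕ) (I : SetSystem n m) (t : ℕ) (r : ℝ) :
    ENNReal :=
  (machineRun I w t ([p], Memory.start n m)).toOuterMeasure (SuccessWithin I r)

/-- The quantity `min (m + n · OPT, m n / OPT)`. -/
noncomputable def coverTime (n m opt : ℕ) : ℝ :=
  min ((m : ℝ) + n * opt) ((m : ℝ) * n / opt)

/-! Fix a guess `k` for the optimum, let `ℓ` be a multiple of the binary length of `n` and `L` the
binary length of `m`. Except with probability `3 * n * exp (-ℓ/2)`, one run for the guess `k` ends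
either with a cover by at most `17kℓ` sets or with a correct report that `k` is below the optimum
(`triple_run`). It first draws `8kℓ` uniform sets; these hit every element lying in more than `m/k`
sets. The remaining elements are handled by multiplicative weights, in at most `4L` rounds.

A round starts with total weight `W₀` and draws `8kℓ` sets in proportion to their weights. It then
sweeps over the elements. An element `e` that this round's sets leave uncovered causes an event: the
weights of its sets are multiplied by a power of two `F` that lifts their sum to at least
`W₀/(16k)`, and `ℓ` of these sets are drawn. The round succeeds if the sweep reaches the end and is
cut off after `k` events. An event adds at most `W₀/(8k)` weight, so a round multiplies the total by
at most `9/8`, and no weight ever exceeds `2^(2L)`. If `e` is light, that is, `F ≥ 2`, then a set of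
an optimal cover `C` at least doubles. When `|C| ≤ k`, this accounts for at most `2Lk` events,
whereas `4L` failed rounds contain `4Lk`. So at least half of the events would have to concern heavy
elements.

Heavy events are rare because of a potential (`triple_event`, `triple_sweep`). For an uncovered `f`
whose sets weigh `w_f`, consider `exp (-ℓ/2) * exp (8kℓ w_f / W₀)`; it is `0` once `f` is covered.
The opening draw makes its expectation at most `exp (-ℓ/2)`. An event at `e` raises `w_f` only
through sets shared by `e` and `f`, and the same shared weight determines how likely the event is to
cover `f`; by `1 - p ≤ exp (-p)` the two effects cancel. When `f` is met uncovered and heavy the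
potential is at least `1`. So a round has at most `n * exp (-ℓ/2)` heavy events in expectation, and
Markov's inequality bounds the failure of a run.

Testing whether an element is covered takes about `kℓ` membership queries or a scan of at most `m/k`
listed sets, so a run costs about `m + nk` or `m + nm/k` up to logarithms. The search
(`triple_bracket`, `triple_climb`) uses the first kind for guesses `a = 1, 2, 4, …` and the second
for `m/a`. A success at `m/a` shows that the optimum is at most `17ℓm/a`, so `a` stays below both
terms of the minimum up to a factor `O(ℓ)`; a failure there permits approaching the optimum from
below by doubling. Every cover that is output comes from a guess below twice the optimum.

The probabilistic bookkeeping is done in a weakest-precondition style: `Triple` propagates upper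
bounds on the failure probability backwards through the program, so a potential argument is a triple
whose bound is the potential. -/

/-! ### A quantitative program logic for the query machine -/

namespace Cmd

/-- Sequential composition of a list of commands. -/
def block : List Cmd → Cmd
  | [] => .skip
  | c :: l => .seq c (block l)

/-- The registers a command may write. -/
def regs : Cmd → List ℕ
  | .skip => []
  | .assign x _ => [x]
  | .store _ _ _ => []
  | .sample x _ => [x]
  | .setOf x _ _ => [x]
  | .member x _ _ => [x]
  | .seq c₁ c₂ => c₁.regs ++ c₂.regs
  | .ite _ c₁ c₂ => c₁.regs ++ c₂.regs
  | .loop _ c => c.regs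

/-- The arrays a command may write. -/
def arrs : Cmd → List ℕ
  | .skip => []
  | .assign _ _ => []
  | .store a _ _ => [a]
  | .sample _ _ => []
  | .setOf _ _ _ => []
  | .member _ _ _ => []
  | .seq c₁ c₂ => c₁.arrs ++ c₂.arrs
  | .ite _ c₁ c₂ => c₁.arrs ++ c₂.arrs
  | .loop _ c => c.arrs

end Cmd

/-- The memories `s` and `s'` agree on everything the command `c` does not write. -/
structure Frame (c : Cmd) (s s' : Memory) : Prop where
  reg : ∀ x, x ∉ c.regs → s'.reg x = s.reg x
  arr : ∀ a, a ∉ c.arrs → s'.arr a = s.arr a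

namespace Frame

theorem refl (c : Cmd) (s : Memory) : Frame c s s := ⟨fun _ _ => rfl, fun _ _ => rfl⟩

theorem trans_of_subset {c c₁ c₂ : Cmd} {s s₁ s₂ : Memory} (h₁ : Frame c₁ s s₁)
    (h₂ : Frame c₂ s₁ s₂) (r₁ : c₁.regs ⊆ c.regs) (r₂ : c₂.regs ⊆ c.regs)
    (a₁ : c₁.arrs ⊆ c.arrs) (a₂ : c₂.arrs ⊆ c.arrs) : Frame c s s₂ :=
  ⟨fun x hx => (h₂.reg x fun h => hx (r₂ h)).trans (h₁.reg x fun h => hx (r₁ h)),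
    fun x hx => (h₂.arr x fun h => hx (a₂ h)).trans (h₁.arr x fun h => hx (a₁ h))⟩

theorem seq {c₁ c₂ : Cmd} {s s₁ s₂ : Memory} (h₁ : Frame c₁ s s₁) (h₂ : Frame c₂ s₁ s₂) :
    Frame (.seq c₁ c₂) s s₂ :=
  h₁.trans_of_subset h₂ (List.subset_append_left _ _) (List.subset_append_right _ _)
    (List.subset_append_left _ _) (List.subset_append_right _ _)

theorem trans {c : Cmd} {s s₁ s₂ : Memory} (h₁ : Frame c s s₁) (h₂ : Frame c s₁ s₂) :
    Frame c s s₂ :=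
  h₁.trans_of_subset h₂ (List.Subset.refl _) (List.Subset.refl _) (List.Subset.refl _)
    (List.Subset.refl _)

theorem mono {c c' : Cmd} {s s' : Memory} (h : Frame c s s') (hr : c.regs ⊆ c'.regs)
    (ha : c.arrs ⊆ c'.arrs) : Frame c' s s' :=
  ⟨fun x hx => h.reg x fun h => hx (hr h), fun x hx => h.arr x fun h => hx (ha h)⟩

theorem setReg {c : Cmd} (s : Memory) {x : ℕ} (v : ℕ) (hx : x ∈ c.regs) :
    Frame c s (s.setReg x v) := by
  refine ⟨fun y hy => ?_, fun _ _ => rfl⟩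
  have : y ≠ x := fun h => hy (h ▸ hx)
  simp [Memory.setReg, this]

theorem setArr {c : Cmd} (s : Memory) {a : ℕ} (i v : ℕ) (ha : a ∈ c.arrs) :
    Frame c s (s.setArr a i v) := by
  refine ⟨fun _ _ => rfl, fun b hb => ?_⟩
  have : b ≠ a := fun h => hb (h ▸ ha)
  simp [Memory.setArr, this]

end Frame

/-! ### Memory updates and evaluation of expressions without overflow -/

namespace Memory

@[simp] theorem reg_setReg (s : Memory) (x v y : ℕ) :
    (s.setReg x v).reg y = if y = x then v else s.reg y := by
  simp [setReg, Function.update_apply]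

@[simp] theorem arr_setReg (s : Memory) (x v : ℕ) : (s.setReg x v).arr = s.arr := rfl

@[simp] theorem reg_setArr (s : Memory) (a i v : ℕ) : (s.setArr a i v).reg = s.reg := rfl

@[simp] theorem arr_setArr (s : Memory) (a i v b j : ℕ) :
    (s.setArr a i v).arr b j = if b = a ∧ j = i then v else s.arr b j := by
  by_cases h : b = a
  · subst h; by_cases h' : j = i <;> simp [setArr, h']
  · simp [setArr, h]

end Memory

namespace Expr

variable {w : ℕ} {s : Memory}

theorem eval_lit {c : ℕ} (h : c < 2 ^ w) : (lit c).eval w s = c := Nat.mod_eq_of_lt h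

@[simp] theorem eval_reg (x : ℕ) : (reg x).eval w s = s.reg x := rfl

@[simp] theorem eval_arr (a : ℕ) (e : Expr) : (arr a e).eval w s = s.arr a (e.eval w s) := rfl

@[simp] theorem eval_lit_zero : (lit 0).eval w s = 0 := Nat.zero_mod _

theorem eval_add {e₁ e₂ : Expr} {a b : ℕ} (h₁ : e₁.eval w s = a) (h₂ : e₂.eval w s = b)
    (h : a + b < 2 ^ w) : (op .add e₁ e₂).eval w s = a + b := by
  subst h₁ h₂; exact Nat.mod_eq_of_lt h

theorem eval_mul {e₁ e₂ : Expr} {a b : ℕ} (h₁ : e₁.eval w s = a) (h₂ : e₂.eval w s = b)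
    (h : a * b < 2 ^ w) : (op .mul e₁ e₂).eval w s = a * b := by
  subst h₁ h₂; exact Nat.mod_eq_of_lt h

theorem eval_sub {e₁ e₂ : Expr} {a b : ℕ} (h₁ : e₁.eval w s = a) (h₂ : e₂.eval w s = b)
    (h : a < 2 ^ w) : (op .sub e₁ e₂).eval w s = a - b := by
  subst h₁ h₂; exact Nat.mod_eq_of_lt ((Nat.sub_le _ _).trans_lt h)

theorem eval_div {e₁ e₂ : Expr} {a b : ℕ} (h₁ : e₁.eval w s = a) (h₂ : e₂.eval w s = b)
    (h : a < 2 ^ w) : (op .div e₁ e₂).eval w s = a / b := by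
  subst h₁ h₂; exact Nat.mod_eq_of_lt ((Nat.div_le_self _ _).trans_lt h)

theorem eval_lt {e₁ e₂ : Expr} {a b : ℕ} (hw : 0 < w) (h₁ : e₁.eval w s = a)
    (h₂ : e₂.eval w s = b) : (op .lt e₁ e₂).eval w s = if a < b then 1 else 0 := by
  have : 1 < 2 ^ w := Nat.one_lt_two_pow hw.ne'
  subst h₁ h₂
  simp only [eval, WordOp.eval]
  split_ifs <;> simp [Nat.mod_eq_of_lt this]

theorem eval_and_lt {e₁ e₂ e₃ e₄ : Expr} {a b c d : ℕ} (hw : 0 < w) (h₁ : e₁.eval w s = a)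
    (h₂ : e₂.eval w s = b) (h₃ : e₃.eval w s = c) (h₄ : e₄.eval w s = d) :
    (op .mul (op .lt e₁ e₂) (op .lt e₃ e₄)).eval w s = if a < b ∧ c < d then 1 else 0 := by
  have : 1 < 2 ^ w := Nat.one_lt_two_pow hw.ne'
  rw [eval_mul (eval_lt hw h₁ h₂) (eval_lt hw h₃ h₄)]
  · split_ifs <;> simp_all
  · split_ifs <;> simp [this]

theorem lt_ne_zero {e₁ e₂ : Expr} (hw : 0 < w) :
    (op .lt e₁ e₂).eval w s ≠ 0 ↔ e₁.eval w s < e₂.eval w s := by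
  rw [eval_lt hw rfl rfl]; split_ifs with h <;> simp [h]

theorem lt_eq_zero {e₁ e₂ : Expr} (hw : 0 < w) :
    (op .lt e₁ e₂).eval w s = 0 ↔ e₂.eval w s ≤ e₁.eval w s := by
  rw [← not_lt, ← lt_ne_zero hw, not_not]

theorem and_lt_ne_zero {e₁ e₂ e₃ e₄ : Expr} (hw : 0 < w) :
    (op .mul (op .lt e₁ e₂) (op .lt e₃ e₄)).eval w s ≠ 0 ↔
      e₁.eval w s < e₂.eval w s ∧ e₃.eval w s < e₄.eval w s := by
  rw [eval_and_lt hw rfl rfl rfl rfl]; split_ifs with h <;> simp_all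

theorem and_lt_eq_zero {e₁ e₂ e₃ e₄ : Expr} (hw : 0 < w) :
    (op .mul (op .lt e₁ e₂) (op .lt e₃ e₄)).eval w s = 0 ↔
      e₂.eval w s ≤ e₁.eval w s ∨ e₄.eval w s ≤ e₃.eval w s := by
  rw [← not_lt, ← not_lt (b := e₄.eval w s), ← not_and_or, ← and_lt_ne_zero hw, not_not]

end Expr

/-! ### Failure probabilities and the rules for triples -/

/-- Axioms of the probability `F t k s` that a machine which still has to execute the commands `k`
on the memory `s` fails to reach some goal within `t` steps. -/
structure FailureFn {n m : ℕ} (I : SetSystem n m) (w : ℕ) (F : ℕ → List Cmd → Memory → ℝ) :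
    Prop where
  le_one : ∀ t k s, F t k s ≤ 1
  anti : ∀ t k s, F (t + 1) k s ≤ F t k s
  skip : ∀ t k s, F (t + 1) (.skip :: k) s = F t k s
  assign : ∀ t k s x e, F (t + 1) (.assign x e :: k) s = F t k (s.setReg x (e.eval w s))
  store : ∀ t k s a i e,
    F (t + 1) (.store a i e :: k) s = F t k (s.setArr a (i.eval w s) (e.eval w s))
  sample : ∀ t k s x e, F (t + 1) (.sample x e :: k) s =
    (∑ v ∈ Finset.range (e.eval w s + 1), F t k (s.setReg x v)) / ((e.eval w s + 1 : ℕ) : ℝ)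
  setOf : ∀ t k s x e l, F (t + 1) (.setOf x e l :: k) s =
    F t k (s.setReg x (I.setOfQuery (e.eval w s) (l.eval w s)))
  member : ∀ t k s x e j, F (t + 1) (.member x e j :: k) s =
    F t k (s.setReg x (I.memberQuery (e.eval w s) (j.eval w s)))
  seq : ∀ t k s c₁ c₂, F (t + 1) (.seq c₁ c₂ :: k) s = F t (c₁ :: c₂ :: k) s
  ite : ∀ t k s b c₁ c₂, F (t + 1) (.ite b c₁ c₂ :: k) s =
    F t ((if b.eval w s ≠ 0 then c₁ else c₂) :: k) s
  loop : ∀ t k s b c, F (t + 1) (.loop b c :: k) s =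
    F t (if b.eval w s ≠ 0 then c :: .loop b c :: k else k) s

theorem FailureFn.antitone {n m : ℕ} {I : SetSystem n m} {w : ℕ} {F : ℕ → List Cmd → Memory → ℝ}
    (hF : FailureFn I w F) (k : List Cmd) (s : Memory) : Antitone fun t => F t k s :=
  antitone_nat_of_succ_le fun t => hF.anti t k s

/-- If every outcome `s'` of `c` satisfies `P s'` and continues with failure probability at most
`ψ s'`, then running `c` from `s`, which takes at most `τ` steps, leads to failure with
probability at most `b`. -/
def Triple {n m : ℕ} (I : SetSystem n m) (w : ℕ) (c : Cmd) (s : Memory) (τ : ℕ)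
    (P : Memory → Prop) (ψ : Memory → ℝ) (b : ℝ) : Prop :=
  ∀ F, FailureFn I w F → ∀ k t,
    (∀ s', P s' → Frame c s s' → F t k s' ≤ ψ s') → F (t + τ) (c :: k) s ≤ b

/-- Started from `s`, the command `c` surely ends within `τ` steps in a memory satisfying `P`. -/
def Hoare {n m : ℕ} (I : SetSystem n m) (w : ℕ) (c : Cmd) (s : Memory) (τ : ℕ)
    (P : Memory → Prop) : Prop :=
  ∀ b, Triple I w c s τ P (fun _ => b) b

namespace Triple

variable {n m : ℕ} {I : SetSystem n m} {w : ℕ} {c c₁ c₂ : Cmd} {s : Memory} {τ τ₁ τ₂ : ℕ}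
  {P P₁ : Memory → Prop} {ψ ψ₁ : Memory → ℝ} {b b' : ℝ}

/-- A failure probability never exceeds `1`. This is how Markov's inequality enters: in a state
whose potential has reached `1` there is nothing left to prove. -/
theorem of_one_le (h : 1 ≤ b) : Triple I w c s τ P ψ b :=
  fun _ hF _ _ _ => (hF.le_one _ _ _).trans h

theorem mono_time (h : Triple I w c s τ₁ P ψ b) (hτ : τ₁ ≤ τ) : Triple I w c s τ P ψ b :=
  fun F hF k t H => (hF.antitone _ _ (Nat.add_le_add_left hτ t)).trans (h F hF k t H)

theorem mono_bound (h : Triple I w c s τ P ψ b) (hb : b ≤ b') : Triple I w c s τ P ψ b' :=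
  fun F hF k t H => (h F hF k t H).trans hb

/-- Rule of consequence for the postcondition. -/
theorem post (h : Triple I w c s τ P₁ ψ₁ b)
    (H : ∀ s', P₁ s' → Frame c s s' → (P s' ∧ ψ s' ≤ ψ₁ s') ∨ 1 ≤ ψ₁ s') :
    Triple I w c s τ P ψ b := by
  intro F hF k t H'
  refine h F hF k t fun s' h' hf => ?_
  rcases H s' h' hf with h | h
  · exact (H' s' h.1 hf).trans h.2
  · exact (hF.le_one _ _ _).trans h

theorem skip (h : P s ∧ ψ s ≤ b) : Triple I w .skip s 1 P ψ b := by
  intro F hF k t H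
  rw [hF.skip]
  exact (H s h.1 (Frame.refl _ _)).trans h.2

theorem assign {x : ℕ} {e : Expr} {v : ℕ} (hv : e.eval w s = v)
    (h : P (s.setReg x v) ∧ ψ (s.setReg x v) ≤ b) : Triple I w (.assign x e) s 1 P ψ b := by
  intro F hF k t H
  rw [hF.assign, hv]
  exact (H _ h.1 (Frame.setReg _ _ (by simp [Cmd.regs]))).trans h.2

/-- The only rule in which a bound is an average; every expectation in the analysis comes from here.
-/
theorem sample {x : ℕ} {e : Expr} {v : ℕ} (hv : e.eval w s = v)
    (h : ∀ u ≤ v, P (s.setReg x u))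
    (hb : (∑ u ∈ Finset.range (v + 1), ψ (s.setReg x u)) / ((v + 1 : ℕ) : ℝ) ≤ b) :
    Triple I w (.sample x e) s 1 P ψ b := by
  intro F hF k t H
  rw [hF.sample, hv]
  refine le_trans ?_ hb
  gcongr with u hu
  exact H _ (h u (by simpa [Nat.lt_succ_iff] using hu)) (Frame.setReg _ _ (by simp [Cmd.regs]))

theorem seq (h₁ : Triple I w c₁ s τ₁ P₁ ψ₁ b)
    (h₂ : ∀ s', P₁ s' → Frame c₁ s s' → Triple I w c₂ s' τ₂ P ψ (ψ₁ s')) :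
    Triple I w (.seq c₁ c₂) s (τ₁ + τ₂ + 1) P ψ b := by
  intro F hF k t H
  have e : t + (τ₁ + τ₂ + 1) = ((t + τ₂) + τ₁) + 1 := by ring
  rw [e, hF.seq]
  exact h₁ F hF _ _ fun s' hs' hf => h₂ s' hs' hf F hF k t fun s'' hs'' hf' =>
    H s'' hs'' (hf.seq hf')

theorem ite {g : Expr} (h₁ : g.eval w s ≠ 0 → Triple I w c₁ s τ P ψ b)
    (h₂ : g.eval w s = 0 → Triple I w c₂ s τ P ψ b) :
    Triple I w (.ite g c₁ c₂) s (τ + 1) P ψ b := by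
  intro F hF k t H
  rw [← add_assoc, hF.ite]
  by_cases hg : g.eval w s = 0
  · rw [if_neg (not_not.2 hg)]
    exact h₂ hg F hF k t fun s' hs' hf => H s' hs'
      (hf.mono (List.subset_append_right _ _) (List.subset_append_right _ _))
  · rw [if_pos hg]
    exact h₁ hg F hF k t fun s' hs' hf => H s' hs'
      (hf.mono (List.subset_append_left _ _) (List.subset_append_left _ _))

theorem loop_exit {g : Expr} (hg : g.eval w s = 0) (h : (P s ∧ ψ s ≤ b) ∨ 1 ≤ b) :
    Triple I w (.loop g c) s 1 P ψ b := by
  rcases h with h | h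
  · intro F hF k t H
    rw [hF.loop, if_neg (not_not.2 hg)]
    exact (H s h.1 (Frame.refl _ _)).trans h.2
  · exact of_one_le h

/-- Loops whose bound depends on the random state are unrolled by one iteration with this rule,
inside an induction on the iterations that remain. -/
theorem loop_step {g : Expr} (hg : g.eval w s ≠ 0) (h₁ : Triple I w c s τ₁ P₁ ψ₁ b)
    (h₂ : ∀ s', P₁ s' → Frame c s s' → Triple I w (.loop g c) s' τ₂ P ψ (ψ₁ s')) :
    Triple I w (.loop g c) s (τ₁ + τ₂ + 1) P ψ b := by
  intro F hF k t H
  have e : t + (τ₁ + τ₂ + 1) = ((t + τ₂) + τ₁) + 1 := by ring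
  rw [e, hF.loop, if_pos hg]
  exact h₁ F hF _ _ fun s' hs' hf => h₂ s' hs' hf F hF k t fun s'' hs'' hf' =>
    H s'' hs'' (Frame.trans (c := .loop g c) ⟨hf.reg, hf.arr⟩ hf')

end Triple

/-! ### Deterministic commands and counted loops -/

namespace Hoare

variable {n m : ℕ} {I : SetSystem n m} {w : ℕ} {c c₁ c₂ : Cmd} {s : Memory} {τ τ₁ τ₂ : ℕ}
  {P P₁ : Memory → Prop} {ψ : Memory → ℝ} {b : ℝ}

theorem triple (h : Hoare I w c s τ P₁)
    (H : ∀ s', P₁ s' → Frame c s s' → (P s' ∧ ψ s' ≤ b)) : Triple I w c s τ P ψ b :=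
  (h b).post fun s' h hf => .inl (H s' h hf)

theorem post (h : Hoare I w c s τ P₁) (H : ∀ s', P₁ s' → Frame c s s' → P s') :
    Hoare I w c s τ P :=
  fun _ => h.triple fun s' h hf => ⟨H s' h hf, le_rfl⟩

theorem mono_time (h : Hoare I w c s τ₁ P) (hτ : τ₁ ≤ τ) : Hoare I w c s τ P :=
  fun b => (h b).mono_time hτ

theorem skip (h : P s) : Hoare I w .skip s 1 P := fun _ => .skip ⟨h, le_rfl⟩

theorem assign {x : ℕ} {e : Expr} {v : ℕ} (hv : e.eval w s = v) (h : P (s.setReg x v)) :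
    Hoare I w (.assign x e) s 1 P := fun _ => .assign hv ⟨h, le_rfl⟩

theorem store {a : ℕ} {i e : Expr} {u v : ℕ} (hu : i.eval w s = u) (hv : e.eval w s = v)
    (h : P (s.setArr a u v)) : Hoare I w (.store a i e) s 1 P := by
  intro b F hF k t H
  rw [hF.store, hu, hv]
  exact H _ h (Frame.setArr _ _ _ (by simp [Cmd.arrs]))

theorem setOf {x : ℕ} {e l : Expr} {u v : ℕ} (hu : e.eval w s = u) (hv : l.eval w s = v)
    (h : P (s.setReg x (I.setOfQuery u v))) : Hoare I w (.setOf x e l) s 1 P := by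
  intro b F hF k t H
  rw [hF.setOf, hu, hv]
  exact H _ h (Frame.setReg _ _ (by simp [Cmd.regs]))

theorem member {x : ℕ} {e l : Expr} {u v : ℕ} (hu : e.eval w s = u) (hv : l.eval w s = v)
    (h : P (s.setReg x (I.memberQuery u v))) : Hoare I w (.member x e l) s 1 P := by
  intro b F hF k t H
  rw [hF.member, hu, hv]
  exact H _ h (Frame.setReg _ _ (by simp [Cmd.regs]))

theorem seq_triple (h₁ : Hoare I w c₁ s τ₁ P₁)
    (h₂ : ∀ s', P₁ s' → Frame c₁ s s' → Triple I w c₂ s' τ₂ P ψ b) :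
    Triple I w (.seq c₁ c₂) s (τ₁ + τ₂ + 1) P ψ b := (h₁ b).seq h₂

theorem seq (h₁ : Hoare I w c₁ s τ₁ P₁)
    (h₂ : ∀ s', P₁ s' → Frame c₁ s s' → Hoare I w c₂ s' τ₂ P) :
    Hoare I w (.seq c₁ c₂) s (τ₁ + τ₂ + 1) P :=
  fun b => h₁.seq_triple fun s' h hf => h₂ s' h hf b

theorem ite {g : Expr} (h₁ : g.eval w s ≠ 0 → Hoare I w c₁ s τ P)
    (h₂ : g.eval w s = 0 → Hoare I w c₂ s τ P) : Hoare I w (.ite g c₁ c₂) s (τ + 1) P :=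
  fun b => .ite (fun h => h₁ h b) (fun h => h₂ h b)

theorem loop_exit {g : Expr} (hg : g.eval w s = 0) (h : P s) : Hoare I w (.loop g c) s 1 P :=
  fun _ => .loop_exit hg (.inl ⟨h, le_rfl⟩)

/-- A loop with an invariant that is indexed by the number of completed iterations. -/
theorem loop_count {g : Expr} {s₀ : Memory} (N : ℕ) (Inv : ℕ → Memory → Prop) (h₀ : Inv 0 s₀)
    (hstep : ∀ i s, i < N → Inv i s → Frame c s₀ s →
      g.eval w s ≠ 0 ∧ Hoare I w c s τ (Inv (i + 1)))
    (hexit : ∀ s, Inv N s → Frame c s₀ s → g.eval w s = 0) :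
    Hoare I w (.loop g c) s₀ (N * (τ + 1) + 1) (Inv N) := by
  suffices ∀ j i s, i + j = N → Inv i s → Frame c s₀ s →
      Hoare I w (.loop g c) s (j * (τ + 1) + 1) (Inv N) from
    this N 0 s₀ (Nat.zero_add N) h₀ (Frame.refl _ _)
  intro j
  induction j with
  | zero =>
    rintro i s rfl hs hf
    exact (loop_exit (hexit s hs hf) hs).mono_time (by omega)
  | succ j ih =>
    intro i s hi hs hf b
    obtain ⟨hg, hc⟩ := hstep i s (by omega) hs hf
    refine (Triple.loop_step hg (hc b) fun s' hs' hf' =>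
      ih (i + 1) s' (by omega) hs' (hf.trans hf') b).mono_time ?_
    rw [Nat.succ_mul]; omega

/-- A loop with an invariant that is indexed by a bound on the number of remaining iterations. -/
theorem loop_fuel {g : Expr} {s₀ : Memory} (N : ℕ) (Inv : ℕ → Memory → Prop) (h₀ : Inv N s₀)
    (hstep : ∀ i s, Inv i s → Frame c s₀ s → g.eval w s ≠ 0 →
      ∃ j, i = j + 1 ∧ Hoare I w c s τ (Inv j)) :
    Hoare I w (.loop g c) s₀ (N * (τ + 1) + 1) (fun s => g.eval w s = 0 ∧ ∃ i, Inv i s) := by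
  suffices ∀ N s, Inv N s → Frame c s₀ s →
      Hoare I w (.loop g c) s (N * (τ + 1) + 1) (fun s => g.eval w s = 0 ∧ ∃ i, Inv i s) from
    this N s₀ h₀ (Frame.refl _ _)
  intro j
  induction j with
  | zero =>
    intro s hs hf
    by_cases hg : g.eval w s = 0
    · exact (loop_exit hg ⟨hg, _, hs⟩).mono_time (by omega)
    · obtain ⟨j, hj, -⟩ := hstep 0 s hs hf hg
      omega
  | succ j ih =>
    intro s hs hf b
    by_cases hg : g.eval w s = 0
    · exact ((loop_exit hg ⟨hg, _, hs⟩).mono_time (by omega)) b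
    · obtain ⟨j', hj, hc⟩ := hstep _ s hs hf hg
      obtain rfl : j = j' := by omega
      refine (Triple.loop_step hg (hc b) fun s' hs' hf' =>
        ih s' hs' (hf.trans hf') b).mono_time ?_
      rw [Nat.succ_mul]; omega

end Hoare

namespace Hoare

variable {n m : ℕ} {I : SetSystem n m} {w : ℕ} {c c₁ c₂ : Cmd} {s : Memory} {τ τ₁ τ₂ : ℕ}
  {P P₁ : Memory → Prop} {ψ : Memory → ℝ} {b : ℝ}

theorem assign_seq {x : ℕ} {e : Expr} {v : ℕ} (hv : e.eval w s = v)
    (h : Hoare I w c (s.setReg x v) τ P) : Hoare I w (.seq (.assign x e) c) s (τ + 2) P :=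
  ((assign (P := fun s' => s' = s.setReg x v) hv rfl).seq
    fun s' hs' _ => by subst hs'; exact h).mono_time (by omega)

theorem store_seq {a : ℕ} {i e : Expr} {u v : ℕ} (hu : i.eval w s = u) (hv : e.eval w s = v)
    (h : Hoare I w c (s.setArr a u v) τ P) : Hoare I w (.seq (.store a i e) c) s (τ + 2) P :=
  ((store (P := fun s' => s' = s.setArr a u v) hu hv rfl).seq
    fun s' hs' _ => by subst hs'; exact h).mono_time (by omega)

theorem setOf_seq {x : ℕ} {e l : Expr} {u v : ℕ} (hu : e.eval w s = u) (hv : l.eval w s = v)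
    (h : Hoare I w c (s.setReg x (I.setOfQuery u v)) τ P) :
    Hoare I w (.seq (.setOf x e l) c) s (τ + 2) P :=
  ((setOf (P := fun s' => s' = s.setReg x (I.setOfQuery u v)) hu hv rfl).seq
    fun s' hs' _ => by subst hs'; exact h).mono_time (by omega)

theorem member_seq {x : ℕ} {e l : Expr} {u v : ℕ} (hu : e.eval w s = u) (hv : l.eval w s = v)
    (h : Hoare I w c (s.setReg x (I.memberQuery u v)) τ P) :
    Hoare I w (.seq (.member x e l) c) s (τ + 2) P :=
  ((member (P := fun s' => s' = s.setReg x (I.memberQuery u v)) hu hv rfl).seq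
    fun s' hs' _ => by subst hs'; exact h).mono_time (by omega)

end Hoare

theorem Triple.assign_seq {n m : ℕ} {I : SetSystem n m} {w : ℕ} {c : Cmd} {s : Memory} {τ : ℕ}
    {P : Memory → Prop} {ψ : Memory → ℝ} {b : ℝ} {x : ℕ} {e : Expr} {v : ℕ}
    (hv : e.eval w s = v) (h : Triple I w c (s.setReg x v) τ P ψ b) :
    Triple I w (.seq (.assign x e) c) s (τ + 2) P ψ b :=
  ((Hoare.assign (P := fun s' => s' = s.setReg x v) hv rfl).seq_triple
    fun s' hs' _ => by subst hs'; exact h).mono_time (by omega)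

/-! ### The two queries in terms of incidence lists -/

namespace SetSystem

variable {n m : ℕ} (I : SetSystem n m)

/-- The indices of the sets containing an element, in the order of the instance. -/
def nbr (e : ℕ) : List ℕ :=
  if h : e < n then (I.setsOf ⟨e, h⟩).map Fin.val else []

theorem nodup_nbr (e : ℕ) : (I.nbr e).Nodup := by
  unfold nbr
  split_ifs
  · exact (I.nodup_setsOf _).map Fin.val_injective
  · exact List.nodup_nil

variable {I} in
theorem lt_of_mem_nbr {e j : ℕ} (h : j ∈ I.nbr e) : j < m := by
  unfold nbr at h
  split_ifs at h
  · obtain ⟨a, -, rfl⟩ := List.mem_map.1 h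
    exact a.2
  · simp at h

theorem mem_nbr (e : Fin n) (j : Fin m) : (j : ℕ) ∈ I.nbr e ↔ e ∈ I.set j := by
  simp [nbr, Fin.val_inj, I.mem_setsOf]

theorem setOfQuery_of_lt {e l : ℕ} (h : l < (I.nbr e).length) :
    I.setOfQuery e l = (I.nbr e)[l] := by
  unfold nbr at h
  split_ifs at h with he
  · simp only [List.length_map] at h
    simp [setOfQuery, nbr, he, h]
  · simp at h

theorem setOfQuery_of_le {e l : ℕ} (h : (I.nbr e).length ≤ l) : I.setOfQuery e l = m := by
  unfold nbr at h
  split_ifs at h with he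
  · simp only [List.length_map] at h
    simp [setOfQuery, he, h.not_gt]
  · simp [setOfQuery, he]

theorem setOfQuery_lt_iff {e l : ℕ} : I.setOfQuery e l < m ↔ l < (I.nbr e).length := by
  rcases lt_or_ge l (I.nbr e).length with h | h
  · simp only [h, I.setOfQuery_of_lt h, iff_true]
    exact lt_of_mem_nbr (List.getElem_mem h)
  · simp [I.setOfQuery_of_le h, h]

theorem memberQuery_ne_zero {e j : ℕ} : I.memberQuery e j ≠ 0 ↔ j ∈ I.nbr e := by
  unfold memberQuery
  split_ifs with h h' <;> simp
  · exact (I.mem_nbr ⟨e, h.1⟩ ⟨j, h.2⟩).2 h'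
  · exact fun H => h' ((I.mem_nbr ⟨e, h.1⟩ ⟨j, h.2⟩).1 H)
  · intro H
    refine h ⟨?_, lt_of_mem_nbr H⟩
    by_contra he
    simp [nbr, he] at H

theorem length_nbr_le (e : ℕ) : (I.nbr e).length ≤ m := by
  have := (I.nodup_nbr e).subperm (l₂ := List.range m) fun j hj =>
    List.mem_range.2 (lt_of_mem_nbr hj)
  simpa using this.length_le

end SetSystem

/-! ### Weighted sampling from a list -/

/-- The element of the list in whose weight interval the number `u` falls. -/
def pick (wt : ℕ → ℕ) : List ℕ → ℕ → ℕ
  | [], _ => 0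
  | a :: l, u => if u < wt a then a else pick wt l (u - wt a)

/-- Each item `a` owns `wt a` consecutive numbers below the total weight, so a uniform number picks
items in proportion to their weights. -/
theorem sum_pick (wt : ℕ → ℕ) (g : ℕ → ℝ) (l : List ℕ) :
    ∑ u ∈ Finset.range (l.map wt).sum, g (pick wt l u) = (l.map fun a => wt a * g a).sum := by
  induction l with
  | nil => simp
  | cons a l ih =>
    simp only [List.map_cons, List.sum_cons, Finset.sum_range_add, ← ih]
    congr 1
    · rw [Finset.sum_congr rfl (g := fun _ => g a), Finset.sum_const]
      · simp
      · intro u hu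
        simp [pick, Finset.mem_range.1 hu]
    · refine Finset.sum_congr rfl fun u _ => ?_
      simp [pick]

theorem pick_eq (wt : ℕ → ℕ) {l : List ℕ} {i u : ℕ} (hi : i < l.length)
    (h₁ : ((l.take i).map wt).sum ≤ u) (h₂ : u < ((l.take (i + 1)).map wt).sum) :
    pick wt l u = l[i] := by
  induction l generalizing i u with
  | nil => simp at hi
  | cons a l ih =>
    cases i with
    | zero => simp at h₂; simp [pick, h₂]
    | succ i =>
      simp only [List.take_succ_cons, List.map_cons, List.sum_cons] at h₁ h₂
      have : ¬ u < wt a := by omega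
      simp only [pick, this, if_false, List.getElem_cons_succ]
      exact ih _ (by omega) (by omega)

/-- The total weight of the sets of the list that contain the element `f`. -/
def SetSystem.hitWeight {n m : ℕ} (I : SetSystem n m) (wt : ℕ → ℕ) (l : List ℕ) (f : ℕ) : ℕ :=
  ((l.filter (· ∈ I.nbr f)).map wt).sum

theorem SetSystem.sum_not_hit {n m : ℕ} (I : SetSystem n m) (wt : ℕ → ℕ) (l : List ℕ) (f : ℕ) :
    (l.map fun a => (wt a : ℝ) * if a ∉ I.nbr f then 1 else 0).sum =
      ((l.map wt).sum : ℕ) - (I.hitWeight wt l f : ℝ) := by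
  unfold hitWeight
  induction l with
  | nil => simp
  | cons a l ih =>
    by_cases h : a ∈ I.nbr f
    · simp_all
    · simp_all; ring

theorem SetSystem.hitWeight_le {n m : ℕ} (I : SetSystem n m) (wt : ℕ → ℕ) (l : List ℕ) (f : ℕ) :
    I.hitWeight wt l f ≤ (l.map wt).sum :=
  (List.filter_sublist.map wt).sum_le_sum (by simp)

/-- Register `15` and arrays `2` and `3` hold the length, the items and the prefix sums of the
weights of the list `l`, and register `16` its total weight. -/
structure Table (wt : ℕ → ℕ) (l : List ℕ) (s : Memory) : Prop where
  length : s.reg 15 = l.length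
  total : s.reg 16 = (l.map wt).sum
  item : ∀ i (h : i < l.length), s.arr 2 i = l[i]
  pre : ∀ i < l.length, s.arr 3 i = ((l.take (i + 1)).map wt).sum

theorem Table.congr {wt : ℕ → ℕ} {l : List ℕ} {s s' : Memory} (h : Table wt l s)
    (h₁ : s'.reg 15 = s.reg 15) (h₂ : s'.reg 16 = s.reg 16) (h₃ : s'.arr 2 = s.arr 2)
    (h₄ : s'.arr 3 = s.arr 3) : Table wt l s' :=
  ⟨h₁ ▸ h.length, h₂ ▸ h.total, h₃ ▸ h.item, h₄ ▸ h.pre⟩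

theorem Table.frame {wt : ℕ → ℕ} {l : List ℕ} {s s' : Memory} {c : Cmd} (h : Table wt l s)
    (hf : Frame c s s') (hr : 15 ∉ c.regs ∧ 16 ∉ c.regs := by decide)
    (ha : 2 ∉ c.arrs ∧ 3 ∉ c.arrs := by decide) : Table wt l s' :=
  h.congr (hf.reg _ hr.1) (hf.reg _ hr.2) (hf.arr _ ha.1) (hf.arr _ ha.2)

/-! ### Weight tables with prefix sums -/

namespace Prog

open Cmd Expr

/-- Start with an empty table. -/
def clear : Cmd := block [.assign 15 (lit 0), .assign 16 (lit 0)]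

/-- Append the set in register `14`, with its current weight, to the table. -/
def push : Cmd := block
  [.store 2 (reg 15) (reg 14),
   .assign 16 (op .add (reg 16) (arr 1 (reg 14))),
   .store 3 (reg 15) (reg 16),
   .assign 15 (op .add (reg 15) (lit 1))]

/-- Put all sets into the table. -/
def tableAll : Cmd := block
  [clear,
   .loop (op .lt (reg 15) (reg 1)) (block [.assign 14 (reg 15), push])]

/-- Put the sets containing the element in register `13` into the table. -/
def tableOf : Cmd := block
  [clear,
   .setOf 14 (reg 13) (reg 15),
   .loop (op .lt (reg 14) (reg 1)) (block [push, .setOf 14 (reg 13) (reg 15)])]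

/-- Find the table entry whose interval of prefix sums contains register `18`. -/
def search : Cmd :=
  .loop (op .lt (reg 19) (reg 20)) (block
    [.assign 21 (op .div (op .add (reg 19) (reg 20)) (lit 2)),
     .ite (op .lt (reg 18) (arr 3 (reg 21))) (.assign 20 (reg 21))
       (.assign 19 (op .add (reg 21) (lit 1)))])

/-- Draw a random set from the table, with probability proportional to its weight. -/
def drawOne : Cmd := block
  [.sample 18 (op .sub (reg 16) (lit 1)),
   .assign 19 (lit 0),
   .assign 20 (op .sub (reg 15) (lit 1)),
   search,
   .assign 14 (arr 2 (reg 19)),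
   .store 0 (reg 0) (reg 14),
   .store 4 (reg 14) (lit 1),
   .assign 0 (op .add (reg 0) (lit 1)),
   .assign 17 (op .add (reg 17) (lit 1))]

/-- Draw as many sets as register `22` says. -/
def draw : Cmd := block
  [.assign 17 (lit 0), .loop (op .lt (reg 17) (reg 22)) drawOne]

end Prog

section Tables

open Prog

variable {n m : ℕ} {I : SetSystem n m} {w : ℕ} {s : Memory}

theorem hoare_clear (wt : ℕ → ℕ) : Hoare I w clear s 5 (Table wt []) := by
  refine Hoare.assign_seq Expr.eval_lit_zero (Hoare.assign_seq Expr.eval_lit_zero (Hoare.skip ?_))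
  constructor <;> simp

theorem hoare_push {wt : ℕ → ℕ} {l : List ℕ} {x : ℕ} (hs : Table wt l s) (hx : s.reg 14 = x)
    (hwt : s.arr 1 x = wt x) (hw : 0 < w) (hsum : (l.map wt).sum + wt x < 2 ^ w)
    (hlen : l.length + 1 < 2 ^ w) : Hoare I w push s 9 (Table wt (l ++ [x])) := by
  have h1 : (1 : ℕ) < 2 ^ w := Nat.one_lt_two_pow hw.ne'
  refine Hoare.store_seq (u := l.length) (v := x) (by simp [hs.length]) (by simp [hx]) ?_
  refine Hoare.assign_seq (Expr.eval_add (a := (l.map wt).sum) (b := wt x)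
    (by simp [hs.total]) (by simp [hx, hwt]) hsum) ?_
  refine Hoare.store_seq (u := l.length) (v := (l.map wt).sum + wt x) (by simp [hs.length])
    (by simp) ?_
  refine Hoare.assign_seq (Expr.eval_add (a := l.length) (b := 1)
    (by simp [hs.length]) (Expr.eval_lit h1) hlen) (Hoare.skip ?_)
  constructor
  · simp
  · simp
  · intro i hi
    rcases eq_or_ne i l.length with rfl | h
    · simp
    · have : i < l.length := by simp at hi; omega
      simp [h, this, hs.item]
  · intro i hi
    rcases eq_or_ne i l.length with rfl | h
    · simp
    · have : i < l.length := by simp at hi; omega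
      simp [h, hs.pre i this, List.take_append_of_le_length this]

theorem sum_map_take_succ (wt : ℕ → ℕ) (l : List ℕ) {i : ℕ} (hi : i < l.length) :
    ((l.take (i + 1)).map wt).sum = ((l.take i).map wt).sum + wt l[i] := by
  rw [List.take_add_one, List.getElem?_eq_getElem hi, List.map_append, List.sum_append]
  simp

theorem sum_map_take_le (wt : ℕ → ℕ) (l : List ℕ) (i : ℕ) :
    ((l.take i).map wt).sum ≤ (l.map wt).sum :=
  ((List.take_sublist i l).map wt).sum_le_sum (by simp)

theorem hoare_tableAll {wt : ℕ → ℕ} (h1 : s.reg 1 = m) (hwt : ∀ j < m, s.arr 1 j = wt j)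
    (hw : 0 < w) (hsum : ((List.range m).map wt).sum < 2 ^ w) (hm : m < 2 ^ w) :
    Hoare I w tableAll s (14 * m + 9) (Table wt (List.range m)) := by
  refine Hoare.mono_time ((hoare_clear wt).seq fun s₁ hs₁ hf₁ => Hoare.seq (τ₁ := 14 * m + 1)
    (P₁ := Table wt (List.range m)) ?_ fun s₂ hs₂ hf₂ => .skip hs₂) (by omega)
  refine ((Hoare.loop_count (τ := 13) m (fun i s => Table wt (List.range i) s) (by simpa using hs₁) ?_
    ?_)).mono_time (by omega)
  · intro i s₂ hi hs₂ hf₂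
    have r1 : s₂.reg 1 = m := by rw [hf₂.reg 1 (by decide), hf₁.reg 1 (by decide), h1]
    have a1 : s₂.arr 1 = s.arr 1 := by rw [hf₂.arr 1 (by decide), hf₁.arr 1 (by decide)]
    refine ⟨by rw [Expr.eval_lt hw (by simp [hs₂.length]; rfl) (by simp [r1]; rfl)]; simp [hi], ?_⟩
    refine Hoare.mono_time (Hoare.assign_seq (v := i) (by simp [hs₂.length])
      (Hoare.seq (hoare_push (l := List.range i) (wt := wt) (x := i)
        (hs₂.congr (by simp) (by simp) (by simp) (by simp))
        (by simp) (by simp [a1, hwt i hi]) hw ?_ (by simp; omega)) fun s₃ hs₃ _ => .skip ?_)) ?_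
    · refine lt_of_le_of_lt ?_ hsum
      have := sum_map_take_succ wt (List.range m) (i := i) (by simpa using hi)
      rw [List.getElem_range, List.take_range, List.take_range, min_eq_left hi.le] at this
      have h' := sum_map_take_le wt (List.range m) (i + 1)
      rw [List.take_range] at h'
      exact this ▸ h'
    · rwa [List.range_succ]
    · exact le_refl 13
  · intro s₂ hs₂ hf₂
    have r1 : s₂.reg 1 = m := by rw [hf₂.reg 1 (by decide), hf₁.reg 1 (by decide), h1]
    rw [Expr.eval_lt hw (by simp [hs₂.length]; rfl) (by simp [r1]; rfl)]
    simp

theorem hoare_tableOf {wt : ℕ → ℕ} {e : ℕ} (h1 : s.reg 1 = m) (h13 : s.reg 13 = e)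
    (hwt : ∀ j < m, s.arr 1 j = wt j) (hw : 0 < w) (hsum : ((I.nbr e).map wt).sum < 2 ^ w)
    (hm : m < 2 ^ w - 1) :
    Hoare I w tableOf s (14 * (I.nbr e).length + 12) (Table wt (I.nbr e)) := by
  set l := I.nbr e with hl
  have hlm : l.length ≤ m := I.length_nbr_le e
  refine Hoare.mono_time ((hoare_clear wt).seq fun s₁ hs₁ hf₁ => Hoare.setOf_seq (u := e) (v := 0)
    (by simp [hf₁.reg 13 (by decide), h13]) (by simp [hs₁.length])
    (Hoare.seq (τ₁ := 14 * l.length + 1)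
    (P₁ := fun s => Table wt (l.take l.length) s ∧ s.reg 14 = I.setOfQuery e l.length) ?_
      fun s₂ hs₂ hf₂ => .skip (by simpa using hs₂.1))) (by omega)
  refine (Hoare.loop_count (τ := 13) l.length (fun i s => Table wt (l.take i) s ∧
    s.reg 14 = I.setOfQuery e i) ⟨?_, by simp⟩ ?_ ?_).mono_time (by omega)
  · simpa using hs₁.congr (by simp) (by simp) (by simp) (by simp)
  · rintro i s₂ hi ⟨hs₂, h14⟩ hf₂
    have r1 : s₂.reg 1 = m := by rw [hf₂.reg 1 (by decide)]; simp [hf₁.reg 1 (by decide), h1]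
    have r13 : s₂.reg 13 = e := by rw [hf₂.reg 13 (by decide)]; simp [hf₁.reg 13 (by decide), h13]
    have a1 : s₂.arr 1 = s.arr 1 := by
      rw [hf₂.arr 1 (by decide), Memory.arr_setReg, hf₁.arr 1 (by decide)]
    rw [I.setOfQuery_of_lt hi] at h14
    have hlt : l[i] < m := SetSystem.lt_of_mem_nbr (List.getElem_mem hi)
    refine ⟨by rw [Expr.eval_lt hw (by simp [h14]; rfl) (by simp [r1]; rfl), if_pos hlt]; simp, ?_⟩
    have hst := sum_map_take_succ wt l hi
    have hst' := sum_map_take_le wt l (i + 1)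
    refine Hoare.mono_time (Hoare.seq (hoare_push (l := l.take i) (wt := wt) (x := l[i])
        hs₂ h14 (by simp [a1, hwt _ hlt]) hw (by omega) (by simp; omega)) fun s₃ hs₃ hf₃ =>
        Hoare.setOf_seq (u := e) (v := i + 1) (by simp [hf₃.reg 13 (by decide), r13])
          (by simp [hs₃.length]; omega) (.skip ⟨?_, by simp⟩)) (le_refl 13)
    rw [List.take_append_getElem hi] at hs₃
    exact hs₃.congr (by simp) (by simp) (by simp) (by simp)
  · rintro s₂ ⟨hs₂, h14⟩ hf₂
    have r1 : s₂.reg 1 = m := by rw [hf₂.reg 1 (by decide)]; simp [hf₁.reg 1 (by decide), h1]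
    -- The Null answer is the number `m`, which makes the loop guard false exactly at the end of the
    -- list.
    rw [I.setOfQuery_of_le le_rfl] at h14
    rw [Expr.eval_lt hw (by simp [h14]; rfl) (by simp [r1]; rfl)]
    simp

end Tables

open Prog

/-! ### Weighted draws and the elements they miss -/

section Draw

variable {n m : ℕ} {I : SetSystem n m} {w : ℕ} {s : Memory} {wt : ℕ → ℕ} {l : List ℕ}

/-- Binary search: the number `u` stays between the prefix sum before register `19` and the one
through register `20`, and the distance of the two registers is halved in every iteration. -/
theorem hoare_search {u J : ℕ} (hs : Table wt l s) (h18 : s.reg 18 = u) (h19 : s.reg 19 = 0)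
    (h20 : s.reg 20 = l.length - 1) (hu : u < (l.map wt).sum) (hJ : l.length ≤ 2 ^ J) (hw : 2 ≤ w)
    (hl : 2 * l.length < 2 ^ w) :
    Hoare I w search s (J * 7 + 1)
      (fun s' => ∃ h : s'.reg 19 < l.length, pick wt l u = l[s'.reg 19]) := by
  have h2 : 2 < 2 ^ w := lt_of_lt_of_le (by norm_num) (Nat.pow_le_pow_right (by norm_num) hw)
  have hpos : 0 < l.length := by
    rcases l with _ | ⟨a, l⟩
    · simp at hu
    · simp
  refine (Hoare.loop_fuel (τ := 6) J (fun j s => s.reg 20 < l.length ∧ s.reg 19 ≤ s.reg 20 ∧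
    s.reg 20 - s.reg 19 < 2 ^ j ∧ ((l.take (s.reg 19)).map wt).sum ≤ u ∧
    u < ((l.take (s.reg 20 + 1)).map wt).sum) ?_ ?_).post ?_
  · refine ⟨by omega, by omega, by omega, by simp [h19], ?_⟩
    rw [h20, Nat.sub_add_cancel hpos]
    simpa using hu
  · rintro j s₁ ⟨h₁, h₂, h₃, h₄, h₅⟩ hf hg
    have hlt : s₁.reg 19 < s₁.reg 20 := (Expr.lt_ne_zero (by omega)).1 hg
    obtain _ | j := j
    · simp at h₃; omega
    refine ⟨j, rfl, ?_⟩
    set mid := (s₁.reg 19 + s₁.reg 20) / 2 with hmid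
    refine Hoare.mono_time (Hoare.assign_seq (v := mid) (Expr.eval_div (a := s₁.reg 19 + s₁.reg 20)
      (b := 2) (Expr.eval_add rfl rfl (by omega)) (Expr.eval_lit h2) (by omega)) (Hoare.seq (τ₁ := 2)
        (τ₂ := 1) (P₁ := fun s => s.reg 20 < l.length ∧ s.reg 19 ≤ s.reg 20 ∧
          s.reg 20 - s.reg 19 < 2 ^ j ∧ ((l.take (s.reg 19)).map wt).sum ≤ u ∧
          u < ((l.take (s.reg 20 + 1)).map wt).sum) (Hoare.ite ?_ ?_)
        fun s₂ hs₂ _ => .skip hs₂)) ?_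
    · intro hc
      rw [Expr.lt_ne_zero (by omega)] at hc
      have hP : s₁.arr 3 mid = ((l.take (mid + 1)).map wt).sum := by
        rw [hf.arr 3 (by decide), hs.pre mid (by omega)]
      have h18' : s₁.reg 18 = u := by rw [hf.reg 18 (by decide), h18]
      simp only [Expr.eval_reg, Expr.eval_arr, Memory.reg_setReg, Memory.arr_setReg, hP,
        if_true] at hc
      refine Hoare.assign (v := mid) (by simp) ?_
      simp only [Memory.reg_setReg, Nat.reduceEqDiff, reduceIte]
        at hc ⊢
      rw [h18'] at hc
      rw [pow_succ] at h₃
      refine ⟨by omega, by omega, by omega, h₄, hc⟩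
    · intro hc
      rw [Expr.lt_eq_zero (by omega)] at hc
      have hP : s₁.arr 3 mid = ((l.take (mid + 1)).map wt).sum := by
        rw [hf.arr 3 (by decide), hs.pre mid (by omega)]
      have h18' : s₁.reg 18 = u := by rw [hf.reg 18 (by decide), h18]
      simp only [Expr.eval_reg, Expr.eval_arr, Memory.reg_setReg, Memory.arr_setReg, hP,
        if_true] at hc
      refine Hoare.assign (v := mid + 1) (Expr.eval_add (by simp)
        (Expr.eval_lit (by omega)) (by omega)) ?_
      simp only [Memory.reg_setReg, Nat.reduceEqDiff, reduceIte]
        at hc ⊢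
      rw [h18'] at hc
      rw [pow_succ] at h₃
      refine ⟨by omega, by omega, by omega, hc, h₅⟩
    · exact le_refl 6
  · rintro s₁ ⟨hc, j, h₁, h₂, h₃, h₄, h₅⟩ -
    rw [Expr.lt_eq_zero (by omega)] at hc
    have : s₁.reg 19 = s₁.reg 20 := le_antisymm h₂ hc
    rw [← this] at h₅ h₁
    exact ⟨h₁, pick_eq wt h₁ h₄ h₅⟩

/-- The effect of drawing one set: `x` is appended to the output, marked, and counted. -/
structure Appended (x : ℕ) (s s' : Memory) : Prop where
  length : s'.reg 0 = s.reg 0 + 1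
  out : ∀ i, s'.arr 0 i = if i = s.reg 0 then x else s.arr 0 i
  mark : ∀ i, s'.arr 4 i = if i = x then 1 else s.arr 4 i
  count : s'.reg 17 = s.reg 17 + 1

theorem triple_drawOne {J : ℕ} (hs : Table wt l s) (hpos : 0 < (l.map wt).sum)
    (htot : (l.map wt).sum < 2 ^ w) (hJ : l.length ≤ 2 ^ J) (hw : 2 ≤ w)
    (hl : 2 * l.length < 2 ^ w) (h0 : s.reg 0 + 1 < 2 ^ w) (h17 : s.reg 17 + 1 < 2 ^ w)
    (g : ℕ → ℝ) :
    Triple I w drawOne s (J * 7 + 19) (fun s' => ∃ x ∈ l, Appended x s s')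
      (fun s' => g (s'.arr 0 (s.reg 0)))
      ((∑ u ∈ Finset.range (l.map wt).sum, g (pick wt l u)) / ((l.map wt).sum : ℕ)) := by
  have h1 : 1 < 2 ^ w := Nat.one_lt_two_pow (by omega)
  have hlpos : 0 < l.length := by
    rcases l with _ | ⟨a, l⟩
    · simp at hpos
    · simp
  refine Triple.mono_time (Triple.seq (P₁ := fun s₁ => ∃ u < (l.map wt).sum, s₁ = s.setReg 18 u)
    (ψ₁ := fun s₁ => g (pick wt l (s₁.reg 18))) (Triple.sample (v := (l.map wt).sum - 1)
      (Expr.eval_sub (by simp [hs.total]) (Expr.eval_lit h1) htot) ?_ ?_)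
    (τ₂ := J * 7 + 17) ?_) (by omega)
  · intro u hu
    exact ⟨u, by omega, rfl⟩
  -- `sample` includes its upper end, so the program passes the total weight minus one; positivity
  -- of the total rules out truncation.
  · rw [Nat.sub_add_cancel hpos]
    simp
  rintro s₁ ⟨u, hu, rfl⟩ -
  refine Hoare.triple (P₁ := fun s' => ∃ x ∈ l, x = pick wt l u ∧ Appended x s s') ?_ ?_
  · refine Hoare.mono_time (Hoare.assign_seq Expr.eval_lit_zero (Hoare.assign_seq
      (v := l.length - 1) (Expr.eval_sub (by simp [hs.length]) (Expr.eval_lit h1) (by omega))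
      (Hoare.seq (hoare_search (u := u) (hs.congr (by simp) (by simp) (by simp) (by simp))
        (by simp) (by simp) (by simp) hu hJ hw hl) (τ₂ := 11) ?_))) (by omega)
    rintro s₂ ⟨hlt, hp⟩ hf
    have hi : s₂.arr 2 (s₂.reg 19) = pick wt l u := by
      rw [hp, ← hs.item _ hlt, hf.arr 2 (by decide)]; simp
    have r0 : s₂.reg 0 = s.reg 0 := by rw [hf.reg 0 (by decide)]; simp
    have r17 : s₂.reg 17 = s.reg 17 := by rw [hf.reg 17 (by decide)]; simp
    have a0 : s₂.arr 0 = s.arr 0 := by rw [hf.arr 0 (by decide)]; simp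
    have a4 : s₂.arr 4 = s.arr 4 := by rw [hf.arr 4 (by decide)]; simp
    refine Hoare.mono_time (Hoare.assign_seq (v := pick wt l u) (by simp [hi])
      (Hoare.store_seq (u := s.reg 0) (v := pick wt l u) (by simp [r0]) (by simp)
      (Hoare.store_seq (u := pick wt l u) (v := 1) (by simp) (Expr.eval_lit h1)
      (Hoare.assign_seq (v := s.reg 0 + 1) (Expr.eval_add (by simp [r0]) (Expr.eval_lit h1) h0)
      (Hoare.assign_seq (v := s.reg 17 + 1) (Expr.eval_add (by simp [r17]) (Expr.eval_lit h1) h17)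
        (Hoare.skip ?_)))))) (by omega)
    refine ⟨pick wt l u, hp ▸ List.getElem_mem hlt, rfl, ?_, ?_, ?_, ?_⟩ <;> simp [a0, a4]
  · rintro s' ⟨x, hx, rfl, h⟩ -
    refine ⟨⟨_, hx, h⟩, ?_⟩
    simp [h.out]

/-- No set in the output from position `st` on contains the element `f`. -/
def Unhit (I : SetSystem n m) (st : ℕ) (s : Memory) (f : ℕ) : Prop :=
  ∀ i, st ≤ i → i < s.reg 0 → s.arr 0 i ∉ I.nbr f

open Classical in
/-- The indicator of `Unhit`. -/
noncomputable def unhit (I : SetSystem n m) (st : ℕ) (s : Memory) (f : ℕ) : ℝ :=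
  if Unhit I st s f then 1 else 0

theorem unhit_nonneg (st : ℕ) (s : Memory) (f : ℕ) : 0 ≤ unhit I st s f := by
  unfold unhit; split_ifs <;> norm_num

theorem unhit_le_one (st : ℕ) (s : Memory) (f : ℕ) : unhit I st s f ≤ 1 := by
  unfold unhit; split_ifs <;> norm_num

theorem unhit_congr {st : ℕ} {s s' : Memory} (h0 : s'.reg 0 = s.reg 0) (h : s'.arr 0 = s.arr 0)
    (f : ℕ) : unhit I st s' f = unhit I st s f := by
  have : Unhit I st s' f ↔ Unhit I st s f := by simp only [Unhit, h0, h]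
  by_cases hf : Unhit I st s f <;> simp [unhit, this, hf]

/-- Being missed is multiplicative over draws; this produces the power of the miss probability in
`triple_draw`. -/
theorem Appended.unhit {x st f : ℕ} {s s' : Memory} (h : Appended x s s') (hst : st ≤ s.reg 0) :
    unhit I st s' f = _root_.unhit I st s f * if x ∉ I.nbr f then 1 else 0 := by
  have : Unhit I st s' f ↔ Unhit I st s f ∧ x ∉ I.nbr f := by
    simp only [Unhit, h.length, h.out]
    constructor
    · intro H
      refine ⟨fun i hi hi' => ?_, ?_⟩
      · have := H i hi (by omega)
        rwa [if_neg (by omega)] at this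
      · have := H _ hst (by omega)
        rwa [if_pos rfl] at this
    · rintro ⟨H, hx⟩ i hi hi'
      split_ifs with h
      · exact hx
      · exact H i hi (by omega)
  unfold _root_.unhit
  by_cases h₁ : Unhit I st s f <;> by_cases h₂ : x ∈ I.nbr f <;> simp [this, h₁, h₂]

/-- The effect of drawing `q` sets from the list `l`. -/
structure Drawn (l : List ℕ) (q : ℕ) (s s' : Memory) : Prop where
  length : s'.reg 0 = s.reg 0 + q
  out : ∀ i < s.reg 0, s'.arr 0 i = s.arr 0 i
  mem : ∀ i < q, s'.arr 0 (s.reg 0 + i) ∈ l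
  mark : ∀ j, s'.arr 4 j ≠ 0 ↔ s.arr 4 j ≠ 0 ∨ ∃ i < q, s'.arr 0 (s.reg 0 + i) = j

theorem Appended.drawn {x q : ℕ} {s s₁ s' : Memory} (h : Appended x s s₁) (hx : x ∈ l)
    (h' : Drawn l q s₁ s') : Drawn l (q + 1) s s' := by
  have e : s'.arr 0 (s.reg 0) = x := by
    rw [h'.out _ (by rw [h.length]; omega), h.out, if_pos rfl]
  have e' : ∀ i, s'.arr 0 (s.reg 0 + (i + 1)) = s'.arr 0 (s₁.reg 0 + i) := fun i => by
    rw [h.length]; congr 1; omega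
  refine ⟨by rw [h'.length, h.length]; omega, fun i hi => ?_, fun i hi => ?_, fun j => ?_⟩
  · rw [h'.out i (by rw [h.length]; omega), h.out, if_neg (by omega)]
  · cases i with
    | zero => rwa [add_zero, e]
    | succ i => rw [e']; exact h'.mem i (by omega)
  · rw [h'.mark, h.mark]
    constructor
    · rintro (h | ⟨i, hi, hj⟩)
      · split_ifs at h with hj
        · exact .inr ⟨0, by omega, by rw [add_zero, e, hj]⟩
        · exact .inl h
      · exact .inr ⟨i + 1, by omega, by rw [e', hj]⟩
    · rintro (h | ⟨i, hi, hj⟩)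
      · left; split_ifs <;> simp [h]
      · cases i with
        | zero => left; rw [add_zero, e] at hj; simp [hj]
        | succ i => exact .inr ⟨i, by omega, by rw [← e', hj]⟩

theorem expect_unhit (hpos : 0 < (l.map wt).sum) (Fs : Finset ℕ) (K : ℕ → ℝ) (v : ℝ) :
    (∑ u ∈ Finset.range (l.map wt).sum,
      (v + ∑ f ∈ Fs, K f * if pick wt l u ∉ I.nbr f then 1 else 0)) / ((l.map wt).sum : ℕ) =
    v + ∑ f ∈ Fs, K f * (1 - I.hitWeight wt l f / ((l.map wt).sum : ℕ)) := by
  have hne : (((l.map wt).sum : ℕ) : ℝ) ≠ 0 := by exact_mod_cast hpos.ne'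
  rw [Finset.sum_add_distrib, Finset.sum_comm, Finset.sum_const, Finset.card_range, nsmul_eq_mul,
    add_div, mul_div_cancel_left₀ _ hne, Finset.sum_div]
  congr 1
  refine Finset.sum_congr rfl fun f _ => ?_
  have := sum_pick wt (fun a => if a ∉ I.nbr f then 1 else 0) l
  rw [I.sum_not_hit] at this
  rw [← Finset.mul_sum, this, mul_div_assoc, sub_div, div_self hne]

/-- The table does not change between draws, so the `q` draws are independent and each misses `f`
with probability one minus the share of the sets containing `f`. The coefficients `K` are left free
in order to carry the exponential factors of the later potential. -/
theorem triple_draw {J q st : ℕ} (hs : Table wt l s) (hpos : 0 < (l.map wt).sum)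
    (htot : (l.map wt).sum < 2 ^ w) (hJ : l.length ≤ 2 ^ J) (hw : 2 ≤ w)
    (hl : 2 * l.length < 2 ^ w) (h22 : s.reg 22 = q) (h0 : s.reg 0 + q < 2 ^ w)
    (hst : st ≤ s.reg 0) (Fs : Finset ℕ) (K : ℕ → ℝ) (v : ℝ) :
    Triple I w draw s (q * (J * 7 + 20) + 5) (Drawn l q s)
      (fun s' => v + ∑ f ∈ Fs, K f * unhit I st s' f)
      (v + ∑ f ∈ Fs, K f * unhit I st s f *
        (1 - I.hitWeight wt l f / ((l.map wt).sum : ℕ)) ^ q) := by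
  suffices ∀ j s₁, Table wt l s₁ → s₁.reg 17 + j = q → s₁.reg 22 = q → s₁.reg 0 + j < 2 ^ w →
      st ≤ s₁.reg 0 → Triple I w (.loop (.op .lt (.reg 17) (.reg 22)) drawOne) s₁
        (j * (J * 7 + 20) + 1) (Drawn l j s₁) (fun s' => v + ∑ f ∈ Fs, K f * unhit I st s' f)
        (v + ∑ f ∈ Fs, K f * unhit I st s₁ f *
          (1 - I.hitWeight wt l f / ((l.map wt).sum : ℕ)) ^ j) by
    refine (Triple.assign_seq Expr.eval_lit_zero ((this q (s.setReg 17 0)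
      (hs.congr (by simp) (by simp) (by simp) (by simp)) (by simp) (by simp [h22])
      (by simpa using h0) (by simpa using hst)).seq (τ₂ := 1) fun s' hs' _ => .skip
        ⟨⟨by simpa using hs'.length, by simpa using hs'.out, by simpa using hs'.mem,
          by simpa using hs'.mark⟩, le_rfl⟩)).mono_time (by omega) |>.mono_bound ?_
    simp only [unhit_congr (s := s) (s' := s.setReg 17 0) (I := I) (st := st) (by simp) (by simp)]
    exact le_rfl
  intro j
  induction j with
  | zero =>
    intro s₁ _ h17 h22 _ _
    refine (Triple.loop_exit ?_ (.inl ⟨⟨rfl, fun _ _ => rfl, by simp, by simp⟩, ?_⟩)).mono_time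
      (by omega)
    · rw [Expr.eval_lt (by omega) rfl rfl, Expr.eval_reg, Expr.eval_reg, if_neg (by omega)]
    · simp
  | succ j ih =>
    intro s₁ hs₁ h17 h22 h0 hst
    refine (Triple.loop_step ?_ ((triple_drawOne hs₁ hpos htot hJ hw hl (by omega) (by omega)
      -- The bound for the remaining `j` draws, as a function of the set `x` drawn now: it depends
      -- on `x` only through which elements `x` hits.
      (fun x => v + ∑ f ∈ Fs, (K f * unhit I st s₁ f *
        (1 - I.hitWeight wt l f / ((l.map wt).sum : ℕ)) ^ j) * if x ∉ I.nbr f then 1 else 0)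
      ).mono_bound ?_) (τ₂ := j * (J * 7 + 20) + 1) ?_).mono_time (by rw [Nat.succ_mul]; omega)
    · rw [Expr.eval_lt (by omega) rfl rfl, Expr.eval_reg, Expr.eval_reg, if_pos (by omega)]
      simp
    · rw [expect_unhit hpos]
      simp only [pow_succ, mul_assoc, le_refl]
    · rintro s₂ ⟨x, hx, h⟩ hf
      refine ((ih s₂ (hs₁.frame hf) (by rw [h.count]; omega)
        (by rw [hf.reg 22 (by decide), h22]) (by rw [h.length]; omega)
        (by rw [h.length]; omega)).post (fun s₃ h₃ _ => .inl ⟨h.drawn hx h₃, le_rfl⟩)).mono_bound ?_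
      have e : s₂.arr 0 (s₁.reg 0) = x := by rw [h.out, if_pos rfl]
      rw [e]
      refine add_le_add le_rfl (Finset.sum_le_sum fun f _ => ?_)
      rw [h.unhit hst]
      apply le_of_eq
      ring

end Draw

/-! ### Coverage tests and reweighting -/

namespace Prog

open Cmd Expr

/-- Test whether a marked set contains the element in register `13`. -/
def listCheck : Cmd := block
  [.assign 23 (lit 0),
   .assign 17 (lit 0),
   .setOf 14 (reg 13) (reg 17),
   .loop (op .lt (reg 14) (reg 1)) (block
    [.ite (arr 4 (reg 14)) (.assign 23 (lit 1)) .skip,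
     .assign 17 (op .add (reg 17) (lit 1)),
     .setOf 14 (reg 13) (reg 17)])]

/-- Test whether a set in the output, from the position in register `8` on, contains the element
in register `13`. -/
def memberCheck : Cmd := block
  [.assign 23 (lit 0),
   .assign 17 (reg 8),
   .loop (op .lt (reg 17) (reg 0)) (block
    [.member 14 (reg 13) (arr 0 (reg 17)),
     .ite (reg 14) (.assign 23 (lit 1)) .skip,
     .assign 17 (op .add (reg 17) (lit 1))])]

/-- Test whether the element in register `13` is covered, by the method given in register `6`. -/
def check : Cmd := .ite (reg 6) listCheck memberCheck

/-- Find the power of two by which the tabulated sets are reweighted. -/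
def factor : Cmd := block
  [.assign 24 (lit 1),
   .assign 28 (reg 16),
   .loop (op .lt (op .mul (op .mul (lit 16) (reg 5)) (reg 28)) (reg 11)) (block
    [.assign 28 (op .add (reg 28) (reg 28)),
     .assign 24 (op .add (reg 24) (reg 24))])]

/-- Reweight the tabulated sets. -/
def scale : Cmd := block
  [.assign 17 (lit 0),
   .loop (op .lt (reg 17) (reg 15)) (block
    [.assign 14 (arr 2 (reg 17)),
     .store 1 (reg 14) (op .mul (arr 1 (reg 14)) (reg 24)),
     .assign 17 (op .add (reg 17) (lit 1))])]

/-- Reweight the sets containing the element in register `13` and draw some of them. -/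
def event : Cmd := block
  [tableOf, factor, scale, .assign 22 (reg 3), draw, .assign 12 (op .add (reg 12) (lit 1))]

end Prog

section Event

variable {n m : ℕ} {I : SetSystem n m} {w : ℕ} {s : Memory}

/-- Among the `m` sets, those that are marked are the ones in the output from position `t` on. -/
def Marked (m t : ℕ) (s : Memory) : Prop :=
  ∀ j < m, s.arr 4 j ≠ 0 ↔ ∃ i, t ≤ i ∧ i < s.reg 0 ∧ s.arr 0 i = j

/-- Thanks to the marks, the cost is the number of sets containing `e`, however many sets have been
drawn. This is the cheaper test for large guesses. -/
theorem hoare_listCheck {t e : ℕ} (h1 : s.reg 1 = m) (h13 : s.reg 13 = e) (hM : Marked m t s)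
    (hw : 0 < w) (hm : m + 1 < 2 ^ w) :
    Hoare I w listCheck s ((I.nbr e).length * 10 + 10)
      (fun s' => s'.reg 23 ≠ 0 ↔ ¬ Unhit I t s e) := by
  have one : 1 < 2 ^ w := Nat.one_lt_two_pow hw.ne'
  have hlm := I.length_nbr_le e
  set l := I.nbr e with hl
  refine Hoare.mono_time (Hoare.assign_seq Expr.eval_lit_zero (Hoare.assign_seq
    Expr.eval_lit_zero (Hoare.setOf_seq (u := e) (v := 0) (by simp [h13]) (by simp)
    (Hoare.seq (τ₁ := l.length * 10 + 1) (P₁ := fun s' => s'.reg 23 ≠ 0 ↔ ¬ Unhit I t s e)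
    ?_ fun s' h' _ => .skip h')))) (by omega)
  refine (Hoare.loop_count (τ := 9) l.length (fun i s' => s'.reg 17 = i ∧
    s'.reg 14 = I.setOfQuery e i ∧ (s'.reg 23 ≠ 0 ↔ ∃ j ∈ l.take i, s.arr 4 j ≠ 0))
    (by simp) ?_ ?_).post ?_
  · rintro i s₁ hi ⟨h17, h14, h23⟩ hf
    have r1 : s₁.reg 1 = m := by rw [hf.reg 1 (by decide)]; simp [h1]
    have r13 : s₁.reg 13 = e := by rw [hf.reg 13 (by decide)]; simp [h13]
    have a4 : s₁.arr 4 = s.arr 4 := by rw [hf.arr 4 (by decide)]; simp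
    rw [I.setOfQuery_of_lt hi] at h14
    have hlt : l[i] < m := SetSystem.lt_of_mem_nbr (List.getElem_mem hi)
    refine ⟨by rw [Expr.lt_ne_zero hw]; simp [h14, r1]; exact hlt, ?_⟩
    have htake : (∃ j ∈ l.take (i + 1), s.arr 4 j ≠ 0) ↔
        (∃ j ∈ l.take i, s.arr 4 j ≠ 0) ∨ s.arr 4 l[i] ≠ 0 := by
      rw [List.take_add_one, List.getElem?_eq_getElem hi]
      simp only [Option.toList_some, List.mem_append, List.mem_singleton]
      constructor
      · rintro ⟨j, h | rfl, h'⟩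
        · exact .inl ⟨j, h, h'⟩
        · exact .inr h'
      · rintro (⟨j, h, h'⟩ | h)
        · exact ⟨j, .inl h, h'⟩
        · exact ⟨_, .inr rfl, h⟩
    refine Hoare.mono_time (Hoare.seq (τ₁ := 2) (P₁ := fun s' => s'.reg 23 ≠ 0 ↔
      ∃ j ∈ l.take (i + 1), s.arr 4 j ≠ 0) (Hoare.ite ?_ ?_) (τ₂ := 5) ?_) (by omega)
    · intro hc
      refine Hoare.assign (Expr.eval_lit one) ?_
      rw [htake]
      simp only [Expr.eval_arr, Expr.eval_reg, h14, a4] at hc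
      simpa using Or.inr hc
    · intro hc
      refine Hoare.skip ?_
      rw [htake, h23]
      simp only [Expr.eval_arr, Expr.eval_reg, h14, a4] at hc
      have hc' : s.arr 4 l[i] = 0 := hc
      simp [hc']
    · intro s₂ h23' hf'
      refine Hoare.assign_seq (v := i + 1) (Expr.eval_add (by simp [hf'.reg 17 (by decide), h17])
        (Expr.eval_lit one) (by omega)) (Hoare.setOf_seq (u := e) (v := i + 1)
          (by simp [hf'.reg 13 (by decide), r13]) (by simp) (Hoare.skip ?_))
      simpa using h23'
  · rintro s₁ ⟨h17, h14, h23⟩ hf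
    have r1 : s₁.reg 1 = m := by rw [hf.reg 1 (by decide)]; simp [h1]
    rw [I.setOfQuery_of_le le_rfl] at h14
    rw [Expr.lt_eq_zero hw]
    simp [h14, r1]
  · rintro s₁ ⟨h17, h14, h23⟩ hf
    rw [h23, List.take_length]
    simp only [Unhit, not_forall, not_not, hl]
    constructor
    · rintro ⟨j, hj, h⟩
      obtain ⟨i, h₁, h₂, rfl⟩ := (hM j (SetSystem.lt_of_mem_nbr hj)).1 h
      exact ⟨i, h₁, h₂, hj⟩
    · rintro ⟨i, h₁, h₂, hj⟩
      exact ⟨_, hj, (hM _ (SetSystem.lt_of_mem_nbr hj)).2 ⟨i, h₁, h₂, rfl⟩⟩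

/-- The cost is the number of sets in the output from position `t` on, however many sets contain
`e`. This is the cheaper test for small guesses. -/
theorem hoare_memberCheck {t e : ℕ} (h8 : s.reg 8 = t) (h13 : s.reg 13 = e) (ht : t ≤ s.reg 0)
    (hw : 0 < w) (h0 : s.reg 0 < 2 ^ w) :
    Hoare I w memberCheck s ((s.reg 0 - t) * 10 + 8)
      (fun s' => s'.reg 23 ≠ 0 ↔ ¬ Unhit I t s e) := by
  have one : 1 < 2 ^ w := Nat.one_lt_two_pow hw.ne'
  refine Hoare.mono_time (Hoare.assign_seq Expr.eval_lit_zero (Hoare.assign_seq (v := t)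
    (by simp [h8]) (Hoare.seq (τ₁ := (s.reg 0 - t) * 10 + 1)
      (P₁ := fun s' => s'.reg 23 ≠ 0 ↔ ¬ Unhit I t s e) ?_ fun s' h' _ => .skip h'))) (by omega)
  refine (Hoare.loop_count (τ := 9) (s.reg 0 - t) (fun i s' => s'.reg 17 = t + i ∧
    (s'.reg 23 ≠ 0 ↔ ∃ i', t ≤ i' ∧ i' < t + i ∧ s.arr 0 i' ∈ I.nbr e))
    (by simp; omega) ?_ ?_).post ?_
  · rintro i s₁ hi ⟨h17, h23⟩ hf
    have r0 : s₁.reg 0 = s.reg 0 := by rw [hf.reg 0 (by decide)]; simp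
    have r13 : s₁.reg 13 = e := by rw [hf.reg 13 (by decide)]; simp [h13]
    have a0 : s₁.arr 0 = s.arr 0 := by rw [hf.arr 0 (by decide)]; simp
    refine ⟨by rw [Expr.lt_ne_zero hw]; simp [r0, h17]; omega, ?_⟩
    have hlt : t + i + 1 < 2 ^ w := by omega
    have hsucc : (∃ i', t ≤ i' ∧ i' < t + (i + 1) ∧ s.arr 0 i' ∈ I.nbr e) ↔
        (∃ i', t ≤ i' ∧ i' < t + i ∧ s.arr 0 i' ∈ I.nbr e) ∨ s.arr 0 (t + i) ∈ I.nbr e := by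
      constructor
      · rintro ⟨i', h₁, h₂, h₃⟩
        rcases eq_or_ne i' (t + i) with rfl | h
        · exact .inr h₃
        · exact .inl ⟨i', h₁, by omega, h₃⟩
      · rintro (⟨i', h₁, h₂, h₃⟩ | h)
        · exact ⟨i', h₁, by omega, h₃⟩
        · exact ⟨t + i, by omega, by omega, h⟩
    refine Hoare.mono_time (Hoare.member_seq (u := e) (v := s.arr 0 (t + i)) (by simp [r13])
      (by simp [h17, a0]) (Hoare.seq (τ₁ := 2) (P₁ := fun s' => s'.reg 23 ≠ 0 ↔
      ∃ i', t ≤ i' ∧ i' < t + (i + 1) ∧ s.arr 0 i' ∈ I.nbr e) (Hoare.ite ?_ ?_) (τ₂ := 3) ?_))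
      (by omega)
    · intro hc
      refine Hoare.assign (Expr.eval_lit one) ?_
      rw [hsucc]
      simp only [Expr.eval_reg, Memory.reg_setReg, if_true, I.memberQuery_ne_zero] at hc
      simpa using Or.inr hc
    · intro hc
      refine Hoare.skip ?_
      rw [hsucc]
      rw [← not_ne_iff] at hc
      simp only [Expr.eval_reg, Memory.reg_setReg, if_true, I.memberQuery_ne_zero] at hc
      simpa [hc] using h23
    · intro s₂ h23' hf'
      refine Hoare.assign_seq (v := t + i + 1) (Expr.eval_add (by
        simp [hf'.reg 17 (by decide), h17]) (Expr.eval_lit one) hlt) (Hoare.skip ?_)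
      exact ⟨by simp [add_assoc], by simpa using h23'⟩
  · rintro s₁ ⟨h17, h23⟩ hf
    have r0 : s₁.reg 0 = s.reg 0 := by rw [hf.reg 0 (by decide)]; simp
    rw [Expr.lt_eq_zero hw]
    simp [r0, h17]; omega
  · rintro s₁ ⟨h17, h23⟩ hf
    rw [h23]
    simp only [Unhit, not_forall, not_not, exists_prop]
    rw [Nat.add_sub_cancel' ht]

/-- Doubling stops at the first power of two that makes the element heavy. If it is not `1`, its
half was still too small, whence the upper bound; it limits the growth of the total weight and rules
out overflow. -/
theorem hoare_factor {acc k W₀ J : ℕ} (h16 : s.reg 16 = acc) (h5 : s.reg 5 = k)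
    (h11 : s.reg 11 = W₀) (hk : 0 < k) (hacc : 0 < acc) (hw : 5 ≤ w)
    (hb : 16 * k * acc < 2 ^ w) (hW : 2 * W₀ < 2 ^ w) (hJ : W₀ ≤ 2 ^ J) :
    Hoare I w factor s (J * 6 + 8) (fun s' => 1 ≤ s'.reg 24 ∧
      W₀ ≤ 16 * k * acc * s'.reg 24 ∧ (s'.reg 24 = 1 ∨ 16 * k * acc * s'.reg 24 < 2 * W₀)) := by
  have one : 1 < 2 ^ w := Nat.one_lt_two_pow (by omega)
  have sixteen : 16 < 2 ^ w :=
    lt_of_lt_of_le (by norm_num) (Nat.pow_le_pow_right (n := 2) (by norm_num) hw)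
  have h16k : 16 * k ≤ 16 * k * acc := Nat.le_mul_of_pos_right _ hacc
  refine Hoare.mono_time (Hoare.assign_seq (Expr.eval_lit one) (Hoare.assign_seq (v := acc)
    (by simp [h16]) (Hoare.seq (τ₁ := J * 6 + 1) (P₁ := fun s' => 1 ≤ s'.reg 24 ∧
      W₀ ≤ 16 * k * acc * s'.reg 24 ∧ (s'.reg 24 = 1 ∨ 16 * k * acc * s'.reg 24 < 2 * W₀))
      ?_ fun s' h' _ => .skip h'))) (by omega)
  have cond : ∀ s₁ : Memory, s₁.reg 5 = k → s₁.reg 28 = acc * s₁.reg 24 →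
      (s₁.reg 24 = 1 ∨ 16 * k * acc * s₁.reg 24 < 2 * W₀) →
      (Expr.op .mul (.op .mul (.lit 16) (.reg 5)) (.reg 28)).eval w s₁ =
        16 * k * acc * s₁.reg 24 := by
    intro s₁ h5 h28 h
    have : 16 * k * acc * s₁.reg 24 < 2 ^ w := by
      rcases h with h | h
      · simpa [h] using hb
      · omega
    rw [mul_assoc (16 * k)] at this ⊢
    exact Expr.eval_mul (Expr.eval_mul (Expr.eval_lit sixteen) h5 (by omega)) h28 this
  -- Fuel `j`: even without the factor `16 * k`, `j` more doublings of the weight would reach `W₀`.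
  refine (Hoare.loop_fuel (τ := 5) J (fun j s₁ => s₁.reg 5 = k ∧ s₁.reg 11 = W₀ ∧ 1 ≤ s₁.reg 24 ∧
    s₁.reg 28 = acc * s₁.reg 24 ∧ W₀ ≤ acc * s₁.reg 24 * 2 ^ j ∧
    (s₁.reg 24 = 1 ∨ 16 * k * acc * s₁.reg 24 < 2 * W₀)) ?_ ?_).post ?_
  · simp [h5, h11]
    exact hJ.trans (Nat.le_mul_of_pos_left _ hacc)
  · rintro j s₁ ⟨r5, r11, r24, r28, hj, hF⟩ - hg
    rw [Expr.lt_ne_zero (by omega), cond s₁ r5 r28 hF, Expr.eval_reg, r11] at hg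
    have hle : 16 * (acc * s₁.reg 24) ≤ 16 * k * acc * s₁.reg 24 := by
      calc 16 * (acc * s₁.reg 24) ≤ 16 * (acc * s₁.reg 24) * k := Nat.le_mul_of_pos_right _ hk
        _ = _ := by ring
    have hle' : s₁.reg 24 ≤ acc * s₁.reg 24 := Nat.le_mul_of_pos_left _ hacc
    obtain _ | j := j
    · simp at hj; omega
    refine ⟨j, rfl, Hoare.mono_time (Hoare.assign_seq (v := acc * s₁.reg 24 + acc * s₁.reg 24)
      (Expr.eval_add r28 r28 (by omega)) (Hoare.assign_seq (v := s₁.reg 24 + s₁.reg 24)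
      (Expr.eval_add (by simp) (by simp) (by omega)) (Hoare.skip ?_))) (le_refl _)⟩
    simp only [Memory.reg_setReg, Nat.reduceEqDiff, reduceIte]
    refine ⟨r5, r11, by omega, by ring, ?_, .inr ?_⟩
    · calc W₀ ≤ acc * s₁.reg 24 * 2 ^ (j + 1) := hj
        _ = _ := by ring
    · calc 16 * k * acc * (s₁.reg 24 + s₁.reg 24) = 2 * (16 * k * acc * s₁.reg 24) := by ring
        _ < _ := by omega
  · rintro s₁ ⟨hc, j, r5, r11, r24, r28, hj, hF⟩ -
    rw [Expr.lt_eq_zero (by omega), cond s₁ r5 r28 hF, Expr.eval_reg, r11] at hc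
    exact ⟨r24, hc, hF⟩

theorem hoare_scale {wt : ℕ → ℕ} {l : List ℕ} {F : ℕ} (hs : Table wt l s) (hl : l.Nodup)
    (h24 : s.reg 24 = F) (hw : 0 < w) (hb : ∀ j ∈ l, s.arr 1 j * F < 2 ^ w)
    (hlen : l.length < 2 ^ w) :
    Hoare I w scale s (l.length * 8 + 6)
      (fun s' => ∀ j, s'.arr 1 j = if j ∈ l then s.arr 1 j * F else s.arr 1 j) := by
  have one : 1 < 2 ^ w := Nat.one_lt_two_pow hw.ne'
  refine Hoare.mono_time (Hoare.assign_seq Expr.eval_lit_zero (Hoare.seq (τ₁ := l.length * 8 + 1)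
    (P₁ := fun s' => s'.reg 17 = l.length ∧
      ∀ j, s'.arr 1 j = if j ∈ l.take l.length then s.arr 1 j * F else s.arr 1 j)
      ?_ fun s' h' _ => .skip (by simpa using h'.2))) (by omega)
  refine Hoare.loop_count (τ := 7) l.length (fun i s' => s'.reg 17 = i ∧
      ∀ j, s'.arr 1 j = if j ∈ l.take i then s.arr 1 j * F else s.arr 1 j) (by simp) ?_ ?_
  · rintro i s₁ hi ⟨h17, hj⟩ hf
    have r15 : s₁.reg 15 = l.length := by rw [hf.reg 15 (by decide)]; simp [hs.length]
    have r24 : s₁.reg 24 = F := by rw [hf.reg 24 (by decide)]; simp [h24]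
    have a2 : s₁.arr 2 i = l[i] := by rw [hf.arr 2 (by decide)]; simp [hs.item i hi]
    -- Since the list has no duplicates, the current set has not been multiplied before.
    have hnot : l[i] ∉ l.take i := by
      intro h
      obtain ⟨i', hi', h⟩ := List.mem_take_iff_getElem.1 h
      have := (hl.getElem_inj_iff).1 h
      omega
    have a1 : s₁.arr 1 l[i] = s.arr 1 l[i] := by rw [hj, if_neg hnot]
    refine ⟨by rw [Expr.lt_ne_zero hw]; simp [r15, h17, hi], ?_⟩
    refine Hoare.mono_time (Hoare.assign_seq (v := l[i]) (by simp [h17, a2])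
      (Hoare.store_seq (u := l[i]) (v := s.arr 1 l[i] * F) (by simp)
      (Expr.eval_mul (by simp [a1]) (by simp [r24]) (hb _ (List.getElem_mem hi)))
      (Hoare.assign_seq (v := i + 1) (Expr.eval_add (by simp [h17]) (Expr.eval_lit one) (by omega))
      (Hoare.skip ⟨by simp, ?_⟩)))) (le_refl _)
    intro j
    have hm : j ∈ l.take (i + 1) ↔ j ∈ l.take i ∨ j = l[i] := by
      rw [← List.take_append_getElem hi, List.mem_append, List.mem_singleton]
    by_cases h : j = l[i]
    · subst h; simp [hm]
    · simp [h, hj, hm]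
  · rintro s₁ ⟨h17, -⟩ hf
    have r15 : s₁.reg 15 = l.length := by rw [hf.reg 15 (by decide)]; simp [hs.length]
    rw [Expr.lt_eq_zero hw]
    simp [h17, r15]

end Event

/-! ### Total weights and their change under reweighting -/

namespace SetSystem

variable {n m : ℕ} (I : SetSystem n m)

/-- The total weight of the sets that contain the element `f`. -/
def weight (wt : ℕ → ℕ) (f : ℕ) : ℕ := ((I.nbr f).map wt).sum

theorem weight_eq (wt : ℕ → ℕ) (f : ℕ) : I.weight wt f = ∑ j ∈ (I.nbr f).toFinset, wt j :=
  (List.sum_toFinset _ (I.nodup_nbr f)).symm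

theorem toFinset_nbr_subset (f : ℕ) : (I.nbr f).toFinset ⊆ Finset.range m := fun _ hj =>
  Finset.mem_range.2 (lt_of_mem_nbr (List.mem_toFinset.1 hj))

theorem sum_range_eq (wt : ℕ → ℕ) : ((List.range m).map wt).sum = ∑ j ∈ Finset.range m, wt j :=
  (Finset.sum_list_map_count _ _).trans (by
    rw [List.toFinset_range]
    refine Finset.sum_congr rfl fun j hj => ?_
    rw [List.count_eq_one_of_mem List.nodup_range (by simpa using hj), one_smul])

theorem weight_le (wt : ℕ → ℕ) (f : ℕ) : I.weight wt f ≤ ((List.range m).map wt).sum := by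
  rw [weight_eq, sum_range_eq]
  exact Finset.sum_le_sum_of_subset (I.toFinset_nbr_subset f)

theorem le_weight (wt : ℕ → ℕ) {f j : ℕ} (h : j ∈ I.nbr f) : wt j ≤ I.weight wt f := by
  rw [weight_eq]
  exact Finset.single_le_sum (fun _ _ => Nat.zero_le _) (List.mem_toFinset.2 h)

theorem hitWeight_eq {l : List ℕ} (wt : ℕ → ℕ) (hl : l.Nodup) (f : ℕ) :
    I.hitWeight wt l f = ∑ j ∈ l.toFinset, if j ∈ I.nbr f then wt j else 0 := by
  rw [hitWeight, ← List.sum_toFinset _ (hl.filter _), List.toFinset_filter, Finset.sum_filter]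
  simp

theorem hitWeight_range (wt : ℕ → ℕ) (f : ℕ) :
    I.hitWeight wt (List.range m) f = I.weight wt f := by
  rw [hitWeight_eq _ _ List.nodup_range, List.toFinset_range, weight_eq, ← Finset.sum_filter]
  congr 1
  ext j
  simp only [Finset.mem_filter, Finset.mem_range, List.mem_toFinset]
  exact ⟨fun h => h.2, fun h => ⟨lt_of_mem_nbr h, h⟩⟩

/-- Only the sets containing both `e` and `f` contribute to the growth. Their weight also determines
the chance that a draw from the sets of `e` hits `f`, which is why the two effects can be balanced
in `triple_event`. -/
theorem weight_scale {wt wt' : ℕ → ℕ} {e F : ℕ}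
    (h : ∀ j, wt' j = if j ∈ I.nbr e then wt j * F else wt j) (hF : 1 ≤ F) (f : ℕ) :
    I.weight wt' f = I.weight wt f + (F - 1) * I.hitWeight wt (I.nbr e) f := by
  rw [hitWeight_eq _ _ (I.nodup_nbr e), weight_eq, weight_eq, ← Finset.sum_filter, Finset.mul_sum]
  have : Finset.filter (fun j => j ∈ I.nbr f) (I.nbr e).toFinset =
      Finset.filter (fun j => j ∈ I.nbr e) (I.nbr f).toFinset := by
    ext j; simp [and_comm]
  rw [this, Finset.sum_filter, ← Finset.sum_add_distrib]
  refine Finset.sum_congr rfl fun j _ => ?_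
  rw [h]
  obtain ⟨F, rfl⟩ := Nat.exists_eq_add_of_le hF
  split_ifs
  · rw [Nat.add_sub_cancel_left]; ring
  · rfl

theorem total_scale {wt wt' : ℕ → ℕ} {e F : ℕ}
    (h : ∀ j, wt' j = if j ∈ I.nbr e then wt j * F else wt j) (hF : 1 ≤ F) :
    ((List.range m).map wt').sum = ((List.range m).map wt).sum + (F - 1) * I.weight wt e := by
  rw [sum_range_eq, sum_range_eq, weight_eq,
    ← Finset.inter_eq_right.2 (I.toFinset_nbr_subset e), ← Finset.filter_mem_eq_inter,
    Finset.mul_sum, Finset.sum_filter, ← Finset.sum_add_distrib]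
  refine Finset.sum_congr rfl fun j _ => ?_
  rw [h]
  obtain ⟨F, rfl⟩ := Nat.exists_eq_add_of_le hF
  simp only [List.mem_toFinset]
  split_ifs
  · rw [Nat.add_sub_cancel_left]; ring
  · rfl

end SetSystem

/-! ### An event does not increase the expected potential -/

section Event

variable {n m : ℕ} {I : SetSystem n m} {w : ℕ} {s : Memory}

/-- The effect of reweighting the sets containing `e` and drawing `ℓ` of them. -/
structure EventPost (I : SetSystem n m) (e ℓ k W₀ F : ℕ) (s s' : Memory) : Prop where
  one_le : 1 ≤ F
  heavy : W₀ ≤ 16 * k * I.weight (s.arr 1) e * F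
  light : F = 1 ∨ 16 * k * I.weight (s.arr 1) e * F < 2 * W₀
  weights : ∀ j, s'.arr 1 j = if j ∈ I.nbr e then s.arr 1 j * F else s.arr 1 j
  drawn : Drawn (I.nbr e) ℓ s s'
  count : s'.reg 12 = s.reg 12 + 1

/-- From `1 - p ≤ exp (-p)`: the chance of `q` misses pays for an exponential factor with exponent
up to `q * p`. It is used for the draws of an event, the opening draw of a round, and the uniform
sample of a run. -/
theorem exp_mul_one_sub_pow_le {x p : ℝ} {q : ℕ} (hp : p ≤ 1) (h : x ≤ q * p) :
    Real.exp x * (1 - p) ^ q ≤ 1 := by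
  have h1 : (1 - p) ^ q ≤ Real.exp (-p) ^ q :=
    pow_le_pow_left₀ (by linarith) (Real.one_sub_le_exp_neg p) q
  calc Real.exp x * (1 - p) ^ q ≤ Real.exp (q * p) * Real.exp (-p) ^ q := by gcongr
    _ = 1 := by rw [← Real.exp_nat_mul, ← Real.exp_add]; simp

/-- The supermartingale step. With `h` the weight shared by `e` and `f`, the exponent of `f` grows
by `8kℓ (F - 1) h / W₀`, which is at most `ℓ h / acc` because `F = 1` or `8k * acc * F ≤ W₀`; the
`ℓ` draws miss `f` with probability `(1 - h / acc)^ℓ`. -/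
theorem triple_event {e ℓ k W₀ D L t : ℕ} (h1 : s.reg 1 = m) (h13 : s.reg 13 = e)
    (h3 : s.reg 3 = ℓ) (h5 : s.reg 5 = k) (h11 : s.reg 11 = W₀) (hk : 0 < k) (hW₀ : 0 < W₀)
    (hacc : 0 < I.weight (s.arr 1) e) (hw : 5 ≤ w) (hb : 16 * k * I.weight (s.arr 1) e < 2 ^ w)
    (hW : 2 * W₀ < 2 ^ w) (hJ : W₀ ≤ 2 ^ (2 * L)) (hD : (I.nbr e).length ≤ D) (hm : m < 2 ^ L)
    (hmw : 2 * m + 1 < 2 ^ w) (h0 : s.reg 0 + ℓ < 2 ^ w) (h12 : s.reg 12 + 1 < 2 ^ w)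
    (ht : t ≤ s.reg 0) (Fs : Finset ℕ) (K : ℕ → ℝ) (hK : ∀ f, 0 ≤ K f) (v : ℝ) :
    Triple I w event s (22 * D + 12 * L + ℓ * (7 * L + 20) + 45)
      (fun s' => ∃ F, EventPost I e ℓ k W₀ F s s')
      (fun s' => v + ∑ f ∈ Fs, K f * unhit I t s' f *
        Real.exp (8 * k * ℓ / W₀ * I.weight (s'.arr 1) f))
      (v + ∑ f ∈ Fs, K f * unhit I t s f *
        Real.exp (8 * k * ℓ / W₀ * I.weight (s.arr 1) f)) := by
  have hacc' : I.weight (s.arr 1) e ≤ 16 * k * I.weight (s.arr 1) e :=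
    Nat.le_mul_of_pos_left _ (by omega)
  have hlm := I.length_nbr_le e
  refine Triple.mono_time (Hoare.seq_triple (hoare_tableOf (wt := s.arr 1) (e := e) h1 h13
    (fun _ _ => rfl) (by omega) (lt_of_le_of_lt hacc' hb) (by omega)) fun s₁ hs₁ hf₁ =>
    Hoare.seq_triple (hoare_factor (acc := I.weight (s.arr 1) e) (k := k) (W₀ := W₀) (J := 2 * L)
      (by rw [hs₁.total]; rfl) (by rw [hf₁.reg 5 (by decide), h5])
      (by rw [hf₁.reg 11 (by decide), h11]) hk hacc hw hb hW hJ) fun s₂ hs₂ hf₂ =>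
    Hoare.seq_triple (hoare_scale (F := s₂.reg 24) (hs₁.frame hf₂) (I.nodup_nbr e) rfl (by omega)
      ?_ (by omega)) (τ₂ := ℓ * (L * 7 + 20) + 5 + 6) fun s₃ hs₃ hf₃ =>
    Triple.assign_seq (v := ℓ) (by simp [hf₃.reg 3 (by decide), hf₂.reg 3 (by decide),
      hf₁.reg 3 (by decide), h3]) ?_) (τ₁ := (14 * (I.nbr e).length + 12) + (((2 * L) * 6 + 8) +
      (((I.nbr e).length * 8 + 6) + (ℓ * (L * 7 + 20) + 5 + 6) + 1) + 1) + 1) ?_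
  · intro j hj
    have e₁ : s₂.arr 1 j = s.arr 1 j := by rw [hf₂.arr 1 (by decide), hf₁.arr 1 (by decide)]
    have := Nat.mul_le_mul_right (s₂.reg 24) (I.le_weight (s.arr 1) hj)
    have h' : I.weight (s.arr 1) e * s₂.reg 24 ≤ 16 * k * I.weight (s.arr 1) e * s₂.reg 24 :=
      Nat.mul_le_mul_right _ hacc'
    rw [e₁]
    rcases hs₂.2.2 with h | h
    · rw [h] at this h' ⊢; omega
    · omega
  · set F := s₂.reg 24 with hF
    have a1 : ∀ j, s₃.arr 1 j = if j ∈ I.nbr e then s.arr 1 j * F else s.arr 1 j := by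
      intro j; rw [hs₃, hf₂.arr 1 (by decide), hf₁.arr 1 (by decide)]
    have r0 : s₃.reg 0 = s.reg 0 := by
      rw [hf₃.reg 0 (by decide), hf₂.reg 0 (by decide), hf₁.reg 0 (by decide)]
    have r12 : s₃.reg 12 = s.reg 12 := by
      rw [hf₃.reg 12 (by decide), hf₂.reg 12 (by decide), hf₁.reg 12 (by decide)]
    have a0 : s₃.arr 0 = s.arr 0 := by
      rw [hf₃.arr 0 (by decide), hf₂.arr 0 (by decide), hf₁.arr 0 (by decide)]
    have a4 : s₃.arr 4 = s.arr 4 := by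
      rw [hf₃.arr 4 (by decide), hf₂.arr 4 (by decide), hf₁.arr 4 (by decide)]
    -- The table still holds the weights from before the reweighting. This does no harm: all its
    -- entries are multiplied by the same factor.
    have htab : Table (s.arr 1) (I.nbr e) (s₃.setReg 22 ℓ) :=
      ((hs₁.frame hf₂).frame hf₃).congr (by simp) (by simp) (by simp) (by simp)
    refine Triple.mono_time (Triple.seq (triple_draw (J := L) (q := ℓ) (st := t) htab hacc
      (lt_of_le_of_lt hacc' hb) (by omega) (by omega) (by omega) (by simp)
      (by simpa [r0] using h0) (by simpa [r0] using ht) Fs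
      (fun f => K f * Real.exp (8 * k * ℓ / W₀ * I.weight (s₃.arr 1) f)) v) (τ₂ := 3)
      fun s₄ hs₄ hf₄ => ?_) (by omega) |>.mono_bound ?_
    · refine Hoare.triple (P₁ := fun s' => s' = s₄.setReg 12 (s.reg 12 + 1)) (Hoare.assign_seq
        (v := s.reg 12 + 1) (Expr.eval_add (a := s.reg 12) (b := 1)
          (by simp [hf₄.reg 12 (by decide), r12])
          (Expr.eval_lit (Nat.one_lt_two_pow (by omega))) h12) (Hoare.skip rfl)) ?_
      rintro s' rfl -
      have a1' : s₄.arr 1 = s₃.arr 1 := by rw [hf₄.arr 1 (by decide)]; simp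
      refine ⟨⟨F, hs₂.1, hs₂.2.1, hs₂.2.2, fun j => ?_, ⟨?_, ?_, ?_, ?_⟩, by simp⟩, ?_⟩
      · simp [a1', a1]
      · simpa [r0] using hs₄.length
      · simpa [r0, a0] using hs₄.out
      · simpa [r0] using hs₄.mem
      · simpa [r0, a4] using hs₄.mark
      · refine add_le_add le_rfl (Finset.sum_le_sum fun f _ => le_of_eq ?_)
        rw [unhit_congr (s := s₄) (by simp) (by simp), Memory.arr_setReg, a1']
        ring
    · refine add_le_add le_rfl (Finset.sum_le_sum fun f _ => ?_)
      rw [unhit_congr (s := s) (by simp [r0]) (by simp [a0]), I.weight_scale a1 hs₂.1]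
      set acc := I.weight (s.arr 1) e with hacc_def
      have hsum : (((I.nbr e).map (s.arr 1)).sum : ℕ) = acc := rfl
      rw [hsum]
      set h := I.hitWeight (s.arr 1) (I.nbr e) f with hh
      have hle : h ≤ acc := I.hitWeight_le _ _ _
      have hW₀' : (0 : ℝ) < W₀ := by exact_mod_cast hW₀
      have haccR : (0 : ℝ) < acc := by exact_mod_cast hacc
      have key : (8 * k * ℓ / W₀ * ((F - 1 : ℕ) * h : ℝ)) ≤ ℓ * ((h : ℝ) / acc) := by
        rcases hs₂.2.2 with h1 | h1
        · rw [h1]; simp only [Nat.sub_self, Nat.cast_zero, zero_mul, mul_zero]; positivity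
        · have h2 : (8 * k * acc * F : ℝ) ≤ W₀ := by
            have : 8 * k * acc * F ≤ W₀ := by
              have : 16 * k * acc * F = 2 * (8 * k * acc * F) := by ring
              omega
            exact_mod_cast this
          have h3 : ((F - 1 : ℕ) : ℝ) ≤ F := by exact_mod_cast Nat.sub_le _ _
          rw [div_mul_eq_mul_div, div_le_iff₀ hW₀', mul_div_assoc', div_mul_eq_mul_div,
            le_div_iff₀ haccR]
          calc (8 * k * ℓ * ((F - 1 : ℕ) * h) * acc : ℝ)
              ≤ 8 * k * ℓ * (F * h) * acc := by gcongr
            _ = (8 * k * acc * F) * (ℓ * h) := by ring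
            _ ≤ W₀ * (ℓ * h) := by gcongr
            _ = ℓ * h * W₀ := by ring
      have := exp_mul_one_sub_pow_le (q := ℓ) (p := (h : ℝ) / acc)
        ((div_le_one haccR).2 (by exact_mod_cast hle)) key
      push_cast
      rw [mul_add, Real.exp_add]
      calc _ = (K f * unhit I t s f * Real.exp (8 * k * ℓ / W₀ * I.weight (s.arr 1) f)) *
            (Real.exp (8 * k * ℓ / W₀ * ((F - 1 : ℕ) * h : ℝ)) * (1 - (h : ℝ) / acc) ^ ℓ) := by ring
        _ ≤ (K f * unhit I t s f * Real.exp (8 * k * ℓ / W₀ * I.weight (s.arr 1) f)) * 1 := by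
          have := hK f
          have := unhit_nonneg (I := I) t s f
          gcongr
        _ = _ := by ring
  · rw [show ℓ * (L * 7 + 20) = ℓ * (7 * L + 20) by ring]
    omega

end Event

/-! ### Sweeps over the elements and their invariant -/

namespace Prog

open Cmd Expr

/-- Process the element in register `13` and move on to the next one. -/
def sweepStep : Cmd := block
  [.setOf 14 (reg 13) (reg 7),
   .ite (op .lt (reg 14) (reg 1)) .skip (block [check, .ite (reg 23) .skip event]),
   .assign 13 (op .add (reg 13) (lit 1))]

/-- Process the elements until they are exhausted or too many of them were not covered. -/
def sweep : Cmd :=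
  .loop (op .mul (op .lt (reg 13) (reg 2)) (op .lt (reg 12) (reg 5))) sweepStep

end Prog

/-- The size constraints on the parameters of a run. -/
structure Params (n m w ℓ L k : ℕ) : Prop where
  k_pos : 0 < k
  ℓ_pos : 0 < ℓ
  m_lt : m < 2 ^ L
  k_le : k ≤ 2 * m
  word : 3 * L + 6 ≤ w
  n_lt : n + 1 < 2 ^ w
  len_lt : 34 * (m * ℓ) + 1 < 2 ^ w

namespace Params

variable {n m w ℓ L k : ℕ} (h : Params n m w ℓ L k)
include h

theorem word_ge : 6 ≤ w := by have := h.word; omega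

theorem m_pos : 0 < m := by have := h.k_pos; have := h.k_le; omega

theorem two_m_lt : 2 * m + 1 < 2 ^ w := by
  have h1 : 2 ^ (L + 1) ≤ 2 ^ w := Nat.pow_le_pow_right (by norm_num) (by have := h.word; omega)
  have := h.m_lt
  rw [pow_succ] at h1
  omega

theorem kℓ_lt : 17 * (k * ℓ) + 1 < 2 ^ w := by
  have : k * ℓ ≤ 2 * m * ℓ := Nat.mul_le_mul_right _ h.k_le
  have := h.len_lt
  rw [mul_assoc] at *
  omega

theorem k_le_kℓ : k ≤ k * ℓ := Nat.le_mul_of_pos_right _ h.ℓ_pos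

theorem k_lt : k < 2 ^ (L + 1) := by
  have := h.m_lt; have := h.k_le
  rw [pow_succ]; omega

/-- Accounts for the word length `3 * L + 6`: the factors `16`, `k` and `W` are bounded by `2^4`,
`2^(L+1)` and `2^(2L+1)`. -/
theorem weight_lt {W : ℕ} (hW : W < 2 ^ (2 * L + 1)) : 16 * k * W < 2 ^ w := by
  calc 16 * k * W = 16 * (k * W) := by ring
    _ < 16 * (2 ^ (L + 1) * 2 ^ (2 * L + 1)) := by
      have := Nat.mul_lt_mul'' h.k_lt hW
      omega
    _ = 2 ^ (3 * L + 6) := by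
      rw [show 3 * L + 6 = 4 + ((L + 1) + (2 * L + 1)) by ring, pow_add 2 4, pow_add 2 (L + 1)]; rfl
    _ ≤ 2 ^ w := Nat.pow_le_pow_right (by norm_num) h.word

theorem total_lt {W : ℕ} (hW : W < 2 ^ (2 * L + 1)) : W < 2 ^ w :=
  lt_of_le_of_lt (Nat.le_mul_of_pos_left _ (by have := h.k_pos; omega)) (h.weight_lt hW)

end Params

/-- The registers that stay fixed during a run have their intended values. -/
structure Env (n m ℓ L k D md : ℕ) (s : Memory) : Prop where
  reg_m : s.reg 1 = m
  reg_n : s.reg 2 = n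
  reg_ℓ : s.reg 3 = ℓ
  reg_rounds : s.reg 4 = 4 * L
  reg_k : s.reg 5 = k
  reg_mode : s.reg 6 = md
  reg_D : s.reg 7 = D
  reg_t : s.reg 8 = 8 * (k * ℓ)

theorem Env.congr {n m ℓ L k D md : ℕ} {s s' : Memory} (h : Env n m ℓ L k D md s)
    (hr : ∀ x, 1 ≤ x → x ≤ 8 → s'.reg x = s.reg x) : Env n m ℓ L k D md s' := by
  constructor
  · rw [hr 1 (by norm_num) (by norm_num), h.reg_m]
  · rw [hr 2 (by norm_num) (by norm_num), h.reg_n]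
  · rw [hr 3 (by norm_num) (by norm_num), h.reg_ℓ]
  · rw [hr 4 (by norm_num) (by norm_num), h.reg_rounds]
  · rw [hr 5 (by norm_num) (by norm_num), h.reg_k]
  · rw [hr 6 (by norm_num) (by norm_num), h.reg_mode]
  · rw [hr 7 (by norm_num) (by norm_num), h.reg_D]
  · rw [hr 8 (by norm_num) (by norm_num), h.reg_t]

section Sweep

variable {n m : ℕ} {I : SetSystem n m} {w ℓ L k D md W₀ : ℕ} {s s' : Memory} {a₀ : ℕ → ℕ}

/-- The invariant of a sweep over the elements. -/
structure Sweep (I : SetSystem n m) (ℓ L k D md W₀ : ℕ) (a₀ : ℕ → ℕ) (s : Memory) : Prop where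
  env : Env n m ℓ L k D md s
  marked : Marked m (8 * (k * ℓ)) s
  pos : ∀ j < m, 1 ≤ s.arr 1 j
  start : s.reg 11 = W₀
  weight : 8 * k * ((List.range m).map (s.arr 1)).sum ≤ (8 * k + s.reg 12) * W₀
  count : s.reg 12 ≤ k
  elem : s.reg 13 ≤ n
  length : s.reg 0 = 16 * (k * ℓ) + s.reg 12 * ℓ
  out : ∀ i < s.reg 0, s.arr 0 i < m
  covered : ∀ f < s.reg 13, (I.nbr f).length ≤ D → ¬ Unhit I (8 * (k * ℓ)) s f
  kept : ∀ i < 8 * (k * ℓ), s.arr 0 i = a₀ i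

/-- The effect of a step for an element that needs no treatment. -/
structure Skipped (s s' : Memory) : Prop where
  arr : s'.arr = s.arr
  reg : ∀ x, x ∉ [13, 14, 17, 23] → s'.reg x = s.reg x
  elem : s'.reg 13 = s.reg 13 + 1

theorem Marked.drawn {t q : ℕ} {l : List ℕ} (h : Marked m t s) (ht : t ≤ s.reg 0)
    (hd : Drawn l q s s') : Marked m t s' := by
  intro j hj
  rw [hd.mark, h j hj, hd.length]
  constructor
  · rintro (⟨i, h₁, h₂, h₃⟩ | ⟨i, h₁, h₂⟩)
    · exact ⟨i, h₁, by omega, by rw [hd.out i h₂, h₃]⟩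
    · exact ⟨s.reg 0 + i, by omega, by omega, h₂⟩
  · rintro ⟨i, h₁, h₂, h₃⟩
    rcases lt_or_ge i (s.reg 0) with h | h
    · exact .inl ⟨i, h₁, h, by rw [← hd.out i h, h₃]⟩
    · exact .inr ⟨i - s.reg 0, by omega, by rw [Nat.add_sub_cancel' h, h₃]⟩

theorem Unhit.of_drawn {t q f : ℕ} {l : List ℕ} (hd : Drawn l q s s') (h : Unhit I t s' f) :
    Unhit I t s f := fun i h₁ h₂ => by
  rw [← hd.out i h₂]
  exact h i h₁ (by rw [hd.length]; omega)

theorem Sweep.skipped (h : Sweep I ℓ L k D md W₀ a₀ s) (hs : Skipped s s') (he : s.reg 13 < n)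
    (hc : (I.nbr (s.reg 13)).length ≤ D → ¬ Unhit I (8 * (k * ℓ)) s (s.reg 13)) :
    Sweep I ℓ L k D md W₀ a₀ s' := by
  have r0 := hs.reg 0 (by simp)
  have r12 := hs.reg 12 (by simp)
  have hU : ∀ f, Unhit I (8 * (k * ℓ)) s' f ↔ Unhit I (8 * (k * ℓ)) s f := fun f => by
    simp only [Unhit, r0, hs.arr]
  constructor
  · exact h.env.congr fun x h₁ h₂ => hs.reg x (by simp; omega)
  · simpa only [Marked, r0, hs.arr] using h.marked
  · simpa only [hs.arr] using h.pos
  · rw [hs.reg 11 (by simp), h.start]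
  · simpa only [hs.arr, r12] using h.weight
  · rw [r12]; exact h.count
  · rw [hs.elem]; exact he
  · rw [r0, r12]; exact h.length
  · simpa only [hs.arr, r0] using h.out
  · intro f hf hD
    rw [hU]
    rw [hs.elem] at hf
    rcases eq_or_ne f (s.reg 13) with rfl | hne
    · exact hc hD
    · exact h.covered f (by omega) hD
  · simpa only [hs.arr] using h.kept

/-- The total weight grows by at most `W₀ / (8k)` per event: a factor `F = 1` adds nothing, and
otherwise even the weight after multiplication is below that. -/
theorem EventPost.excess_le {e F : ℕ} (h : EventPost I e ℓ k W₀ F s s') :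
    8 * k * ((F - 1) * I.weight (s.arr 1) e) ≤ W₀ := by
  rcases h.light with h1 | h1
  · simp [h1]
  · have h2 : 8 * k * ((F - 1) * I.weight (s.arr 1) e) ≤ 8 * k * (F * I.weight (s.arr 1) e) :=
      Nat.mul_le_mul_left _ (Nat.mul_le_mul_right _ (Nat.sub_le _ _))
    have h3 : 16 * k * I.weight (s.arr 1) e * F = 2 * (8 * k * (F * I.weight (s.arr 1) e)) := by ring
    omega

theorem Sweep.event {F : ℕ} (h : Sweep I ℓ L k D md W₀ a₀ s) (hℓ : 0 < ℓ)
    (hp : EventPost I (s.reg 13) ℓ k W₀ F s s') (he : s.reg 13 < n) (hc : s.reg 12 < k)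
    (hr : ∀ x, 1 ≤ x → x ≤ 8 → s'.reg x = s.reg x) (h11 : s'.reg 11 = s.reg 11)
    (h13 : s'.reg 13 = s.reg 13 + 1) : Sweep I ℓ L k D md W₀ a₀ s' := by
  have hlen := h.length
  have ht : 8 * (k * ℓ) ≤ s.reg 0 := by omega
  constructor
  · exact h.env.congr hr
  · exact h.marked.drawn ht hp.drawn
  · intro j hj
    have := h.pos j hj
    rw [hp.weights]
    split_ifs
    · exact Nat.mul_pos this hp.one_le
    · exact this
  · rw [h11, h.start]
  · rw [I.total_scale hp.weights hp.one_le, hp.count, mul_add]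
    have := hp.excess_le
    have := h.weight
    calc _ ≤ (8 * k + s.reg 12) * W₀ + W₀ := by omega
      _ = _ := by ring
  · rw [hp.count]; exact hc
  · rw [h13]; exact he
  · rw [hp.drawn.length, hp.count, hlen]; ring
  · intro i hi
    rw [hp.drawn.length] at hi
    rcases lt_or_ge i (s.reg 0) with h' | h'
    · rw [hp.drawn.out i h']; exact h.out i h'
    · have := hp.drawn.mem (i - s.reg 0) (by omega)
      rw [Nat.add_sub_cancel' h'] at this
      exact SetSystem.lt_of_mem_nbr this
  · intro f hf hD hU
    rw [h13] at hf
    rcases eq_or_ne f (s.reg 13) with rfl | hne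
    -- All sets drawn in the event contain the current element, so the first draw already covers it.
    · have := hp.drawn.mem 0 hℓ
      exact hU _ ht (by rw [hp.drawn.length]; omega) this
    · exact h.covered f (by omega) hD (hU.of_drawn hp.drawn)
  · intro i hi
    rw [hp.drawn.out i (by omega)]
    exact h.kept i hi

theorem Sweep.total_lt (h : Sweep I ℓ L k D md W₀ a₀ s) (hk : 0 < k) (hW₀ : W₀ < 2 ^ (2 * L)) :
    ((List.range m).map (s.arr 1)).sum < 2 ^ (2 * L + 1) := by
  have h1 : 8 * k * ((List.range m).map (s.arr 1)).sum ≤ 8 * k * (2 * W₀) := by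
    refine h.weight.trans ?_
    calc (8 * k + s.reg 12) * W₀ ≤ (16 * k) * W₀ := Nat.mul_le_mul_right _ (by
          have := h.count; omega)
      _ = _ := by ring
  have := Nat.le_of_mul_le_mul_left h1 (by omega)
  rw [pow_succ]
  omega

/-- The constant `90`: a round has at most `9kℓ` sets after position `8kℓ`, namely `8kℓ` from its
opening draw and `ℓ` from each of at most `k` events, and a membership test takes ten steps. -/
theorem hoare_check {Tc : ℕ} (h : Sweep I ℓ L k D md W₀ a₀ s) (hp : Params n m w ℓ L k)
    (hD : (I.nbr (s.reg 13)).length ≤ D) (h₁ : md ≠ 0 → 10 * D + 10 ≤ Tc)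
    (h₀ : md = 0 → 90 * (k * ℓ) + 8 ≤ Tc) :
    Hoare I w check s (Tc + 1)
      (fun s' => s'.reg 23 ≠ 0 ↔ ¬ Unhit I (8 * (k * ℓ)) s (s.reg 13)) := by
  have hw := hp.word_ge
  have hlen := h.length
  have hc : s.reg 12 * ℓ ≤ k * ℓ := Nat.mul_le_mul_right _ h.count
  have hkℓ := hp.kℓ_lt
  refine Hoare.ite (fun hc => ?_) (fun hc => ?_)
  · rw [Expr.eval_reg, h.env.reg_mode] at hc
    have := h₁ hc
    exact (hoare_listCheck h.env.reg_m rfl h.marked (by omega)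
      (by have := hp.two_m_lt; omega)).mono_time (by omega)
  · rw [Expr.eval_reg, h.env.reg_mode] at hc
    have := h₀ hc
    exact (hoare_memberCheck h.env.reg_t rfl (by omega) (by omega) (by omega)).mono_time (by omega)

theorem hoare_sweepStep_skip {Tc : ℕ} (h : Sweep I ℓ L k D md W₀ a₀ s)
    (hp : Params n m w ℓ L k) (he : s.reg 13 < n) (h₁ : md ≠ 0 → 10 * D + 10 ≤ Tc)
    (h₀ : md = 0 → 90 * (k * ℓ) + 8 ≤ Tc)
    (hc : (I.nbr (s.reg 13)).length ≤ D → ¬ Unhit I (8 * (k * ℓ)) s (s.reg 13)) :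
    Hoare I w sweepStep s (Tc + 13) (Skipped s) := by
  have hw := hp.word_ge
  have one : 1 < 2 ^ w := Nat.one_lt_two_pow (by omega)
  have hn := hp.n_lt
  -- A single query recognises the elements in more than `D` sets: positions count from `0`, so
  -- position `D` is occupied exactly for these.
  refine Hoare.mono_time (Hoare.setOf_seq (u := s.reg 13) (v := D) rfl h.env.reg_D
    (Hoare.seq (P₁ := fun s' => s'.arr = s.arr ∧ ∀ x, x ∉ [14, 17, 23] → s'.reg x = s.reg x)
    (τ₁ := Tc + 7) (Hoare.ite (fun hg => Hoare.mono_time (Hoare.skip ⟨rfl, ?_⟩) (by omega))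
    fun hg => ?_) (τ₂ := 3) fun s₁ hs₁ _ => ?_)) (by omega)
  · intro x hx
    simp at hx
    simp [hx]
  · rw [Expr.lt_eq_zero (by omega), Expr.eval_reg, Expr.eval_reg, Memory.reg_setReg,
      Memory.reg_setReg, if_pos rfl, if_neg (by norm_num), h.env.reg_m, ← not_lt,
      I.setOfQuery_lt_iff, not_lt] at hg
    set s₁ := s.setReg 14 (I.setOfQuery (s.reg 13) D) with hs₁
    have hsk : Sweep I ℓ L k D md W₀ a₀ s₁ := by
      constructor
      · exact h.env.congr fun x h₁ h₂ => by simp [hs₁]; omega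
      · exact h.marked
      · exact h.pos
      · exact h.start
      · exact h.weight
      · exact h.count
      · exact h.elem
      · exact h.length
      · exact h.out
      · exact h.covered
      · exact h.kept
    refine Hoare.mono_time (Hoare.seq (hoare_check (Tc := Tc) hsk hp hg h₁ h₀) (τ₂ := 4)
      fun s₂ hs₂ hf₂ => Hoare.mono_time (Hoare.seq (τ₁ := 2) (Hoare.ite
        (fun hg => Hoare.skip (P := fun s' => s' = s₂) rfl) fun hg' => ?_) (τ₂ := 1)
          fun s₃ hs₃ _ => Hoare.skip ?_) (by omega)) (by omega)
    · exact absurd hg' (hs₂.2 (hc hg))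
    · subst hs₃
      refine ⟨?_, fun x hx => ?_⟩
      · ext a : 1
        rw [hf₂.arr a (by simp [check, listCheck, memberCheck, Cmd.block, Cmd.arrs])]
        rfl
      · simp at hx
        rw [hf₂.reg x (by simp [check, listCheck, memberCheck, Cmd.block, Cmd.regs, hx])]
        simp [hs₁, hx]
  · refine Hoare.assign_seq (v := s.reg 13 + 1) (Expr.eval_add (hs₁.2 13 (by simp))
      (Expr.eval_lit one) (by omega)) (Hoare.skip ⟨hs₁.1, fun x hx => ?_, by simp⟩)
    simp at hx
    simp [hx, hs₁.2 x (by simp [hx])]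

end Sweep

/-! ### The expected deficit produced by a sweep -/

/-- A bound on the running time of `Prog.event`. -/
def eventTime (D L ℓ : ℕ) : ℕ := 22 * D + 12 * L + ℓ * (7 * L + 20) + 45

section Sweep

variable {n m : ℕ} {I : SetSystem n m} {w ℓ L k D md W₀ : ℕ} {s s' : Memory} {a₀ : ℕ → ℕ}

theorem EventPost.congr_left {e F : ℕ} {s₁ : Memory} (h : EventPost I e ℓ k W₀ F s₁ s')
    (ha : s₁.arr = s.arr) (h0 : s₁.reg 0 = s.reg 0) (h12 : s₁.reg 12 = s.reg 12) :
    EventPost I e ℓ k W₀ F s s' :=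
  ⟨h.one_le, ha ▸ h.heavy, ha ▸ h.light, ha ▸ h.weights,
    ⟨h0 ▸ h.drawn.length, h0 ▸ ha ▸ h.drawn.out, h0 ▸ h.drawn.mem, h0 ▸ ha ▸ h.drawn.mark⟩,
    h12 ▸ h.count⟩

theorem EventPost.congr_right {e F : ℕ} {s₁ : Memory} (h : EventPost I e ℓ k W₀ F s s₁)
    (ha : s'.arr = s₁.arr) (h0 : s'.reg 0 = s₁.reg 0) (h12 : s'.reg 12 = s₁.reg 12) :
    EventPost I e ℓ k W₀ F s s' :=
  ⟨h.one_le, h.heavy, h.light, ha ▸ h.weights,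
    ⟨h0 ▸ h.drawn.length, ha ▸ h.drawn.out, ha ▸ h.drawn.mem, ha ▸ h.drawn.mark⟩,
    h12 ▸ h.count⟩

theorem triple_sweepStep_event {Tc : ℕ} (h : Sweep I ℓ L k D md W₀ a₀ s)
    (hp : Params n m w ℓ L k) (hne : ∀ e < n, I.nbr e ≠ []) (he : s.reg 13 < n)
    (h₁ : md ≠ 0 → 10 * D + 10 ≤ Tc) (h₀ : md = 0 → 90 * (k * ℓ) + 8 ≤ Tc)
    (hW₀ : 0 < W₀) (hW₀' : W₀ < 2 ^ (2 * L)) (hc : s.reg 12 < k)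
    (hD : (I.nbr (s.reg 13)).length ≤ D) (hU : Unhit I (8 * (k * ℓ)) s (s.reg 13))
    (Fs : Finset ℕ) (K : ℕ → ℝ) (hK : ∀ f, 0 ≤ K f) (v : ℝ) :
    Triple I w sweepStep s (Tc + 15 + eventTime D L ℓ)
      (fun s' => s'.reg 13 = s.reg 13 + 1 ∧ ∃ F, EventPost I (s.reg 13) ℓ k W₀ F s s')
      (fun s' => v + ∑ f ∈ Fs, K f * unhit I (8 * (k * ℓ)) s' f *
        Real.exp (8 * k * ℓ / W₀ * I.weight (s'.arr 1) f))
      (v + ∑ f ∈ Fs, K f * unhit I (8 * (k * ℓ)) s f *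
        Real.exp (8 * k * ℓ / W₀ * I.weight (s.arr 1) f)) := by
  have hw := hp.word_ge
  have one : 1 < 2 ^ w := Nat.one_lt_two_pow (by omega)
  have hn := hp.n_lt
  have hlen := h.length
  have hkℓ := hp.kℓ_lt
  have hcl : (s.reg 12 + 1) * ℓ ≤ k * ℓ := Nat.mul_le_mul_right _ hc
  rw [Nat.succ_mul] at hcl
  have hkk := hp.k_le_kℓ
  have htot := h.total_lt hp.k_pos hW₀'
  have hwt : I.weight (s.arr 1) (s.reg 13) < 2 ^ (2 * L + 1) :=
    lt_of_le_of_lt (I.weight_le _ _) htot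
  have hacc : 0 < I.weight (s.arr 1) (s.reg 13) := by
    obtain ⟨j, hj⟩ := List.exists_mem_of_ne_nil _ (hne _ he)
    exact lt_of_lt_of_le (h.pos j (SetSystem.lt_of_mem_nbr hj)) (I.le_weight _ hj)
  refine Triple.mono_time (Hoare.seq_triple (τ₁ := 1) (Hoare.setOf
    (P := fun s' => s' = s.setReg 14 (I.setOfQuery (s.reg 13) D)) (u := s.reg 13) (v := D) rfl
    h.env.reg_D rfl) fun s₁ hs₁ hf₁ =>
    Triple.seq (τ₁ := (Tc + 7 + eventTime D L ℓ) + 1)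
      (P₁ := fun s' => s'.reg 13 = s.reg 13 ∧ ∃ F, EventPost I (s.reg 13) ℓ k W₀ F s s')
      (ψ₁ := fun s' => v + ∑ f ∈ Fs, K f * unhit I (8 * (k * ℓ)) s' f *
        Real.exp (8 * k * ℓ / W₀ * I.weight (s'.arr 1) f)) (Triple.ite (fun hg => ?_) fun hg => ?_)
      (τ₂ := 3) fun s₂ hs₂ hf₂ => ?_) (by omega)
  · rw [Expr.lt_ne_zero (by omega)] at hg
    subst hs₁
    rw [Expr.eval_reg, Expr.eval_reg, Memory.reg_setReg,
      Memory.reg_setReg, if_pos rfl, if_neg (by norm_num), h.env.reg_m,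
      I.setOfQuery_lt_iff] at hg
    omega
  · have a₁ : s₁.arr = s.arr := by rw [hs₁]; rfl
    have r₁ : ∀ x, x ≠ 14 → s₁.reg x = s.reg x := fun x hx => by rw [hs₁]; simp [hx]
    have hsk : Sweep I ℓ L k D md W₀ a₀ s₁ := by
      subst hs₁
      constructor
      · exact h.env.congr fun x h₁ h₂ => r₁ x (by omega)
      · exact h.marked
      · exact h.pos
      · exact h.start
      · exact h.weight
      · exact h.count
      · exact h.elem
      · exact h.length
      · exact h.out
      · exact h.covered
      · exact h.kept
    have r13 := r₁ 13 (by norm_num)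
    refine Triple.mono_time (Hoare.seq_triple (hoare_check (Tc := Tc) hsk hp (by rwa [r13]) h₁ h₀)
      fun s₂ hs₂ hf₂ => Triple.seq (τ₁ := eventTime D L ℓ + 1) (τ₂ := 1)
        (P₁ := fun s' => s'.reg 13 = s.reg 13 ∧ ∃ F, EventPost I (s.reg 13) ℓ k W₀ F s s')
        (ψ₁ := fun s' => v + ∑ f ∈ Fs, K f * unhit I (8 * (k * ℓ)) s' f *
          Real.exp (8 * k * ℓ / W₀ * I.weight (s'.arr 1) f))
        (Triple.ite (fun hg => ?_) fun hg => ?_) fun s₃ hs₃ _ => Triple.skip ⟨hs₃, le_rfl⟩) (by omega)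
    · refine absurd ?_ (hs₂.1 hg)
      rw [r13]
      simpa only [Unhit, a₁, r₁ 0 (by norm_num)] using hU
    · have a₂ : s₂.arr = s.arr := by
        rw [← a₁]
        ext a : 1
        rw [hf₂.arr a (by simp [check, listCheck, memberCheck, Cmd.block, Cmd.arrs])]
      have r₂ : ∀ x, x ∉ [14, 17, 23] → s₂.reg x = s.reg x := fun x hx => by
        simp at hx
        rw [hf₂.reg x (by simp [check, listCheck, memberCheck, Cmd.block, Cmd.regs, hx]),
          r₁ x hx.1]
      refine (Triple.post (triple_event (e := s.reg 13) (ℓ := ℓ) (k := k) (W₀ := W₀) (D := D)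
        (L := L) (t := 8 * (k * ℓ)) (by rw [r₂ 1 (by simp), h.env.reg_m]) (r₂ 13 (by simp))
        (by rw [r₂ 3 (by simp), h.env.reg_ℓ]) (by rw [r₂ 5 (by simp), h.env.reg_k])
        (by rw [r₂ 11 (by simp), h.start]) hp.k_pos hW₀ (by rwa [a₂]) (by omega)
        (by rw [a₂]; exact hp.weight_lt hwt)
        (hp.total_lt (W := 2 * W₀) (by rw [pow_succ]; omega)) hW₀'.le hD hp.m_lt hp.two_m_lt
        (by rw [r₂ 0 (by simp)]; omega) (by rw [r₂ 12 (by simp)]; omega)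
        (by rw [r₂ 0 (by simp)]; omega) Fs K hK v) ?_).mono_bound ?_
      · rintro s₃ ⟨F, hF⟩ hf₃
        refine .inl ⟨⟨?_, F, hF.congr_left a₂ (r₂ 0 (by simp)) (r₂ 12 (by simp))⟩, le_rfl⟩
        rw [hf₃.reg 13 (by decide), r₂ 13 (by simp)]
      · rw [a₂]
        simp only [unhit_congr (r₂ 0 (by simp)) (congrFun a₂ 0), le_refl]
  · obtain ⟨h13, F, hF⟩ := hs₂
    refine Hoare.triple (P₁ := fun s' => s' = s₂.setReg 13 (s.reg 13 + 1)) (Hoare.assign_seq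
      (v := s.reg 13 + 1) (Expr.eval_add h13 (Expr.eval_lit one) (by omega)) (Hoare.skip rfl)) ?_
    rintro s₃ rfl -
    refine ⟨⟨by simp, F, hF.congr_right rfl (by simp) (by simp)⟩, ?_⟩
    refine add_le_add le_rfl (Finset.sum_le_sum fun f _ => le_of_eq ?_)
    rw [unhit_congr (s := s₂) (by simp) (by simp), Memory.arr_setReg]

/-- The number of treatments of elements that did not double the weight of a set in `C`, at least
if there were `base` treatments in the previous sweeps. -/
def deficit (C : Finset ℕ) (base : ℕ) (s : Memory) : ℕ :=
  base + s.reg 12 - ∑ j ∈ C, Nat.log 2 (s.arr 1 j)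

/-- The elements from `e` on that lie in few sets. -/
def SetSystem.pending (I : SetSystem n m) (D e : ℕ) : Finset ℕ :=
  (Finset.range n).filter fun f => e ≤ f ∧ (I.nbr f).length ≤ D

/-- The expected cost of the elements in `Fs` to be treated although they are heavy. -/
noncomputable def risk (I : SetSystem n m) (k ℓ W₀ : ℕ) (Fs : Finset ℕ) (s : Memory) : ℝ :=
  ∑ f ∈ Fs, Real.exp (-(ℓ / 2)) * unhit I (8 * (k * ℓ)) s f *
    Real.exp (8 * k * ℓ / W₀ * I.weight (s.arr 1) f)

theorem risk_nonneg (Fs : Finset ℕ) (s : Memory) : 0 ≤ risk I k ℓ W₀ Fs s :=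
  Finset.sum_nonneg fun f _ => by
    have := unhit_nonneg (I := I) (8 * (k * ℓ)) s f
    positivity

theorem risk_mono {Fs Fs' : Finset ℕ} (h : Fs ⊆ Fs') (s : Memory) :
    risk I k ℓ W₀ Fs s ≤ risk I k ℓ W₀ Fs' s :=
  Finset.sum_le_sum_of_subset_of_nonneg h fun f _ _ => by
    have := unhit_nonneg (I := I) (8 * (k * ℓ)) s f
    positivity

theorem pending_succ_subset (e : ℕ) : I.pending D (e + 1) ⊆ I.pending D e := fun f hf => by
  simp only [SetSystem.pending, Finset.mem_filter] at hf ⊢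
  exact ⟨hf.1, by omega, hf.2.2⟩

/-- A light element forces `F ≥ 2`, so the set of `C` containing it at least doubles, and the gain
in the sum of logarithms offsets the additional event. Only heavy elements can raise the deficit. -/
theorem deficit_event {C : Finset ℕ} {base F : ℕ} (hC : C ⊆ Finset.range m)
    (hcov : ∃ j ∈ C, j ∈ I.nbr (s.reg 13)) (h : Sweep I ℓ L k D md W₀ a₀ s)
    (hp : EventPost I (s.reg 13) ℓ k W₀ F s s') :
    deficit C base s' ≤ deficit C base s + 1 ∧
      (16 * k * I.weight (s.arr 1) (s.reg 13) < W₀ → deficit C base s' ≤ deficit C base s) := by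
  have hmono : ∀ j ∈ C, Nat.log 2 (s.arr 1 j) ≤ Nat.log 2 (s'.arr 1 j) := by
    intro j _
    rw [hp.weights]
    split_ifs
    · exact Nat.log_mono_right (Nat.le_mul_of_pos_right _ hp.one_le)
    · exact le_rfl
  have hsum := Finset.sum_le_sum hmono
  unfold deficit
  rw [hp.count]
  refine ⟨by omega, fun hlt => ?_⟩
  have hF : 2 ≤ F := by
    have := hp.one_le
    by_contra hF
    obtain rfl : F = 1 := by omega
    have := hp.heavy
    omega
  obtain ⟨j, hj, hje⟩ := hcov
  have : ∑ j ∈ C, Nat.log 2 (s.arr 1 j) < ∑ j ∈ C, Nat.log 2 (s'.arr 1 j) := by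
    refine Finset.sum_lt_sum hmono ⟨j, hj, ?_⟩
    have hpos := h.pos j (Finset.mem_range.1 (hC hj))
    rw [hp.weights, if_pos hje]
    calc Nat.log 2 (s.arr 1 j) < Nat.log 2 (s.arr 1 j * 2) := by
          rw [Nat.log_mul_base (by norm_num) (by omega)]; omega
      _ ≤ _ := Nat.log_mono_right (Nat.mul_le_mul_left _ hF)
  omega

/-- Deficit plus risk does not grow in expectation. Passing an element removes its term from the
risk; if the element is treated while heavy, that term is at least `1` and pays for the rise of the
deficit. -/
theorem triple_sweep {Tc base : ℕ} {C : Finset ℕ} (hp : Params n m w ℓ L k)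
    (h₁ : md ≠ 0 → 10 * D + 10 ≤ Tc) (h₀ : md = 0 → 90 * (k * ℓ) + 8 ≤ Tc)
    (hW₀ : 0 < W₀) (hW₀' : W₀ < 2 ^ (2 * L)) (hC : C ⊆ Finset.range m)
    (hcov : ∀ e < n, ∃ j ∈ C, j ∈ I.nbr e) (v β : ℝ) (hβ : 0 ≤ β)
    (h : Sweep I ℓ L k D md W₀ a₀ s) :
    Triple I w sweep s (n * (Tc + 16) + k * eventTime D L ℓ + 1)
      (fun s' => Sweep I ℓ L k D md W₀ a₀ s' ∧ (s'.reg 13 = n ∨ s'.reg 12 = k))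
      (fun s' => v + β * deficit C base s')
      (v + β * deficit C base s + β * risk I k ℓ W₀ (I.pending D (s.reg 13)) s) := by
  have hw := hp.word_ge
  suffices ∀ j s, s.reg 13 + j = n → Sweep I ℓ L k D md W₀ a₀ s →
      Triple I w sweep s (j * (Tc + 16) + (k - s.reg 12) * eventTime D L ℓ + 1)
      (fun s' => Sweep I ℓ L k D md W₀ a₀ s' ∧ (s'.reg 13 = n ∨ s'.reg 12 = k))
      (fun s' => v + β * deficit C base s')
      (v + β * deficit C base s + β * risk I k ℓ W₀ (I.pending D (s.reg 13)) s) by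
    refine (this (n - s.reg 13) s (Nat.add_sub_cancel' h.elem) h).mono_time ?_
    gcongr <;> omega
  intro j
  induction j with
  | zero =>
    intro s hj h
    refine (Triple.loop_exit ?_ (.inl ⟨⟨h, .inl hj⟩, ?_⟩)).mono_time (by omega)
    · rw [Expr.and_lt_eq_zero (by omega)]
      simp only [Expr.eval_reg, h.env.reg_n]
      omega
    · have := risk_nonneg (I := I) (k := k) (ℓ := ℓ) (W₀ := W₀) (I.pending D (s.reg 13)) s
      have := mul_nonneg hβ this
      linarith
  | succ j ih =>
    intro s hj h
    have hrisk := mul_nonneg hβ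
      (risk_nonneg (I := I) (k := k) (ℓ := ℓ) (W₀ := W₀) (I.pending D (s.reg 13)) s)
    rcases h.count.eq_or_lt with hk | hk
    · refine (Triple.loop_exit ?_ (.inl ⟨⟨h, .inr hk⟩, by linarith⟩)).mono_time (by omega)
      rw [Expr.and_lt_eq_zero (by omega)]
      simp only [Expr.eval_reg, h.env.reg_k]
      omega
    have hg : (Expr.op .mul (.op .lt (.reg 13) (.reg 2)) (.op .lt (.reg 12) (.reg 5))).eval w s
        ≠ 0 := by
      rw [Expr.and_lt_ne_zero (by omega)]
      simp only [Expr.eval_reg, h.env.reg_n, h.env.reg_k]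
      omega
    have he : s.reg 13 < n := by omega
    by_cases hc : (I.nbr (s.reg 13)).length ≤ D → ¬ Unhit I (8 * (k * ℓ)) s (s.reg 13)
    · refine (Triple.loop_step hg (hoare_sweepStep_skip h hp he h₁ h₀ hc _)
        (τ₂ := j * (Tc + 16) + (k - s.reg 12) * eventTime D L ℓ + 1) fun s₁ hs₁ _ => ?_).mono_time
          (by rw [Nat.succ_mul]; omega)
      have r12 := hs₁.reg 12 (by simp)
      have := ih s₁ (by rw [hs₁.elem]; omega) (h.skipped hs₁ he hc)
      rw [r12] at this
      refine this.mono_bound ?_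
      have e₁ : deficit C base s₁ = deficit C base s := by unfold deficit; rw [r12, hs₁.arr]
      have e₂ : ∀ Fs, risk I k ℓ W₀ Fs s₁ = risk I k ℓ W₀ Fs s := fun Fs => by
        unfold risk
        simp only [unhit_congr (hs₁.reg 0 (by simp)) (congrFun hs₁.arr 0), hs₁.arr]
      rw [e₁, e₂, hs₁.elem]
      have := risk_mono (I := I) (k := k) (ℓ := ℓ) (W₀ := W₀)
        (pending_succ_subset (I := I) (D := D) (s.reg 13)) s
      gcongr
    · push Not at hc
      obtain ⟨hD, hU⟩ := hc
      have hne : ∀ e < n, I.nbr e ≠ [] := fun e he => by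
        obtain ⟨j, -, hj⟩ := hcov e he
        exact List.ne_nil_of_mem hj
      set Fs := I.pending D (s.reg 13 + 1) with hFs
      -- The charge of this event to the deficit: `0` for a light element and `1` for a heavy one.
      set b : ℕ := if 16 * k * I.weight (s.arr 1) (s.reg 13) < W₀ then 0 else 1 with hb
      have hstart := triple_sweepStep_event h hp hne he h₁ h₀ hW₀ hW₀' hk hD hU Fs
        (fun _ => β * Real.exp (-(ℓ / 2))) (fun _ => by positivity)
        (v + β * (deficit C base s + b : ℕ))
      refine (Triple.loop_step hg hstart
        (τ₂ := j * (Tc + 16) + (k - (s.reg 12 + 1)) * eventTime D L ℓ + 1) fun s₁ hs₁ hf₁ =>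
          ?_).mono_time ?_ |>.mono_bound ?_
      · obtain ⟨h13, F, hF⟩ := hs₁
        have hsw := h.event hp.ℓ_pos hF he hk (fun x h₁ h₂ => hf₁.reg x (by
          interval_cases x <;> decide)) (hf₁.reg 11 (by decide)) h13
        have := ih s₁ (by rw [h13]; omega) hsw
        rw [hF.count] at this
        refine this.mono_bound ?_
        have hdef := deficit_event (base := base) hC (hcov _ he) h hF
        have hle : deficit C base s₁ ≤ deficit C base s + b := by
          rw [hb]
          split_ifs with hlt
          · exact hdef.2 hlt
          · exact hdef.1
        rw [h13, risk, Finset.mul_sum]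
        have : (deficit C base s₁ : ℝ) ≤ (deficit C base s + b : ℕ) := by exact_mod_cast hle
        gcongr ?_ + ?_
        · gcongr
        · exact le_of_eq (Finset.sum_congr rfl fun f _ => by ring)
      · obtain ⟨i, hi⟩ := Nat.exists_eq_add_of_lt hk
        rw [hi, show s.reg 12 + i + 1 - (s.reg 12 + 1) = i by omega,
          show s.reg 12 + i + 1 - s.reg 12 = i + 1 by omega, Nat.succ_mul, Nat.succ_mul]
        omega
      · have hmem : s.reg 13 ∈ I.pending D (s.reg 13) := by
          simp [SetSystem.pending, he, hD]
        have hnot : s.reg 13 ∉ Fs := by simp [hFs, SetSystem.pending]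
        have hsub : insert (s.reg 13) Fs ⊆ I.pending D (s.reg 13) :=
          Finset.insert_subset hmem (pending_succ_subset _)
        have hr := risk_mono (I := I) (k := k) (ℓ := ℓ) (W₀ := W₀) hsub s
        rw [risk, Finset.sum_insert hnot, unhit, if_pos hU] at hr
        -- For a heavy element `8kℓ * weight / W₀ ≥ ℓ/2`, so the two exponentials multiply to at
        -- least `1`.
        have hbound : (b : ℝ) ≤ Real.exp (-(ℓ / 2)) * 1 *
            Real.exp (8 * k * ℓ / W₀ * I.weight (s.arr 1) (s.reg 13)) := by
          rw [hb]
          split_ifs with hlt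
          · simp only [Nat.cast_zero]; positivity
          · rw [mul_one, ← Real.exp_add, Nat.cast_one]
            refine Real.one_le_exp ?_
            have hW : (0 : ℝ) < W₀ := by exact_mod_cast hW₀
            have : (W₀ : ℝ) ≤ 16 * k * I.weight (s.arr 1) (s.reg 13) := by
              exact_mod_cast not_lt.1 hlt
            rw [neg_add_eq_sub, sub_nonneg, div_mul_eq_mul_div, le_div_iff₀ hW]
            calc (ℓ / 2 * W₀ : ℝ) ≤ ℓ / 2 * (16 * k * I.weight (s.arr 1) (s.reg 13)) := by gcongr
              _ = _ := by ring
        have hr' := mul_le_mul_of_nonneg_left (le_trans (add_le_add hbound le_rfl) hr) hβ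
        rw [mul_add, Finset.mul_sum] at hr'
        have hsum : ∑ f ∈ Fs, β * Real.exp (-(ℓ / 2)) * unhit I (8 * (k * ℓ)) s f *
            Real.exp (8 * k * ℓ / W₀ * I.weight (s.arr 1) f) =
            ∑ f ∈ Fs, β * (Real.exp (-(ℓ / 2)) * unhit I (8 * (k * ℓ)) s f *
            Real.exp (8 * k * ℓ / W₀ * I.weight (s.arr 1) f)) :=
          Finset.sum_congr rfl fun f _ => by ring
        rw [hsum]
        push_cast
        linarith

end Sweep

/-! ### Rounds -/

namespace Prog

open Cmd Expr

/-- Fill the first cells of an array, one for each set, with a constant. -/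
def fill (a v : ℕ) : Cmd := block
  [.assign 17 (lit 0),
   .loop (op .lt (reg 17) (reg 1)) (block
    [.store a (reg 17) (lit v), .assign 17 (op .add (reg 17) (lit 1))])]

/-- Draw sets according to the current weights, then sweep over the elements. -/
def round : Cmd := block
  [.assign 0 (reg 8), tableAll, .assign 11 (reg 16), fill 4 0, .assign 22 (reg 8), draw,
   .assign 12 (lit 0), .assign 13 (lit 0), sweep,
   .ite (op .lt (reg 13) (reg 2)) .skip (.assign 10 (lit 1)),
   .assign 9 (op .add (reg 9) (lit 1))]

end Prog

/-- A bound on the running time of `Prog.round`, if one test for being covered takes time `Tc`. -/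
def roundTime (n m ℓ L k D Tc : ℕ) : ℕ :=
  22 * m + 8 * (k * ℓ) * (7 * L + 20) + n * (Tc + 16) + k * eventTime D L ℓ + 60

section Round

variable {n m : ℕ} {I : SetSystem n m} {w ℓ L k D md : ℕ} {s s' : Memory} {a₀ : ℕ → ℕ}

theorem hoare_fill {a v : ℕ} (h1 : s.reg 1 = m) (hw : 0 < w) (hm : m < 2 ^ w) (hv : v < 2 ^ w) :
    Hoare I w (fill a v) s (6 * m + 5) (fun s' => ∀ j < m, s'.arr a j = v) := by
  have one : 1 < 2 ^ w := Nat.one_lt_two_pow hw.ne'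
  refine Hoare.mono_time (Hoare.assign_seq Expr.eval_lit_zero (Hoare.seq (τ₁ := m * 6 + 1)
    (P₁ := fun s' => s'.reg 17 = m ∧ ∀ j < m, s'.arr a j = v)
      (Hoare.loop_count (τ := 5) m (fun i s' => s'.reg 17 = i ∧ ∀ j < i, s'.arr a j = v)
        (by simp) ?_ ?_) fun s' h' _ => .skip h'.2)) (by omega)
  · rintro i s₁ hi ⟨h17, hj⟩ hf
    have r1 : s₁.reg 1 = m := by rw [hf.reg 1 (by simp [Cmd.block, Cmd.regs])]; simp [h1]
    refine ⟨by rw [Expr.lt_ne_zero hw]; simp [h17, r1, hi], ?_⟩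
    refine Hoare.mono_time (Hoare.store_seq (u := i) (v := v) h17 (Expr.eval_lit hv)
      (Hoare.assign_seq (v := i + 1) (Expr.eval_add (by simp [h17]) (Expr.eval_lit one) (by omega))
      (Hoare.skip ⟨by simp, fun j hj' => ?_⟩))) (le_refl _)
    simp only [Memory.arr_setReg, Memory.arr_setArr, true_and]
    split_ifs
    · rfl
    · exact hj j (by omega)
  · rintro s₁ ⟨h17, -⟩ hf
    have r1 : s₁.reg 1 = m := by rw [hf.reg 1 (by simp [Cmd.block, Cmd.regs])]; simp [h1]
    rw [Expr.lt_eq_zero hw]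
    simp [h17, r1]

/-- The state between the rounds of a run, after `r` rounds. -/
structure Between (n m ℓ L k D md : ℕ) (a₀ : ℕ → ℕ) (r : ℕ) (s : Memory) : Prop where
  env : Env n m ℓ L k D md s
  pos : ∀ j < m, 1 ≤ s.arr 1 j
  weight : 8 ^ r * ((List.range m).map (s.arr 1)).sum ≤ 9 ^ r * m
  round : s.reg 9 = r
  kept : ∀ i < 8 * (k * ℓ), s.arr 0 i = a₀ i

/-- The state after a successful round. -/
structure Finished (I : SetSystem n m) (ℓ k D : ℕ) (a₀ : ℕ → ℕ) (s : Memory) : Prop where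
  ok : s.reg 10 = 1
  le_length : 8 * (k * ℓ) ≤ s.reg 0
  length_le : s.reg 0 ≤ 17 * (k * ℓ)
  out : ∀ i < s.reg 0, s.arr 0 i < m
  covered : ∀ f < n, (I.nbr f).length ≤ D → ∃ i < s.reg 0, s.arr 0 i ∈ I.nbr f
  kept : ∀ i < 8 * (k * ℓ), s.arr 0 i = a₀ i

/-- Because `9^4 ≤ 2 * 8^4`, the growth over `4 * L` rounds is at most `2^L`, and the initial total
`m` is below `2^L` as well. -/
theorem weight_lt_of_rounds {r W : ℕ} (h : 8 ^ r * W ≤ 9 ^ r * m) (hr : r ≤ 4 * L)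
    (hm : m < 2 ^ L) : W < 2 ^ (2 * L) := by
  obtain ⟨j, hj⟩ := Nat.exists_eq_add_of_le hr
  have h1 : 8 ^ (4 * L) * W ≤ 9 ^ (4 * L) * m := by
    rw [hj, pow_add, pow_add]
    calc 8 ^ r * 8 ^ j * W = (8 ^ r * W) * 8 ^ j := by ring
      _ ≤ (9 ^ r * m) * 9 ^ j := Nat.mul_le_mul h (Nat.pow_le_pow_left (by norm_num) _)
      _ = _ := by ring
  have h2 : 9 ^ (4 * L) ≤ 8 ^ (4 * L) * 2 ^ L := by
    rw [pow_mul, pow_mul, ← mul_pow]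
    exact Nat.pow_le_pow_left (by norm_num) _
  have h3 : 8 ^ (4 * L) * W < 8 ^ (4 * L) * 2 ^ (2 * L) := by
    calc _ ≤ 9 ^ (4 * L) * m := h1
      _ ≤ 8 ^ (4 * L) * 2 ^ L * m := Nat.mul_le_mul_right _ h2
      _ < 8 ^ (4 * L) * 2 ^ L * 2 ^ L := by gcongr
      _ = _ := by rw [two_mul, pow_add]; ring
  exact lt_of_mul_lt_mul_left h3 (Nat.zero_le _)

/-- The opening draw leaves `f` uncovered with probability `(1 - w_f / W₀)^(8kℓ)`, which absorbs the
exponential of the potential. So the risk at the start of the sweep is at most `n * exp (-ℓ/2)` in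
expectation, and this is what one round can add to the deficit. A successful round drops the deficit
from the bound. -/
theorem triple_round {Tc r : ℕ} {C : Finset ℕ} (hp : Params n m w ℓ L k)
    (h₁ : md ≠ 0 → 10 * D + 10 ≤ Tc) (h₀ : md = 0 → 90 * (k * ℓ) + 8 ≤ Tc)
    (hC : C ⊆ Finset.range m) (hcov : ∀ e < n, ∃ j ∈ C, j ∈ I.nbr e) (v β : ℝ) (hβ : 0 ≤ β)
    (hr : r < 4 * L) (ha₀ : ∀ i < 8 * (k * ℓ), a₀ i < m)
    (h : Between n m ℓ L k D md a₀ r s) (hok : s.reg 10 = 0) :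
    Triple I w round s (roundTime n m ℓ L k D Tc)
      (fun s' => Between n m ℓ L k D md a₀ (r + 1) s' ∧
        (s'.reg 10 = 0 ∨ Finished I ℓ k D a₀ s'))
      (fun s' => v + β * if s'.reg 10 = 0 then
        ((k * (r + 1) - ∑ j ∈ C, Nat.log 2 (s'.arr 1 j) : ℕ) : ℝ) else 0)
      (v + β * ((k * r - ∑ j ∈ C, Nat.log 2 (s.arr 1 j) : ℕ) : ℝ) +
        β * (n * Real.exp (-(ℓ / 2)))) := by
  have hw := hp.word_ge
  have one : 1 < 2 ^ w := Nat.one_lt_two_pow (by omega)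
  have hn := hp.n_lt
  have hm2 := hp.two_m_lt
  have hkℓ := hp.kℓ_lt
  have hrw : r + 1 < 2 ^ w := by
    have h2 : 2 ^ w ≥ 2 ^ (3 * L + 6) := Nat.pow_le_pow_right (by norm_num) hp.word
    have h3 : 3 * L + 6 < 2 ^ (3 * L + 6) := Nat.lt_two_pow_self
    have h4 : 2 ^ (3 * L + 6) = 64 * (2 ^ L * 2 ^ L * 2 ^ L) := by
      rw [pow_add, show 3 * L = L + L + L by ring, pow_add, pow_add]; ring
    have h5 : L < 2 ^ L := Nat.lt_two_pow_self
    have h6 : 1 ≤ 2 ^ L * 2 ^ L := Nat.mul_pos (by positivity) (by positivity)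
    have h7 : 2 ^ L ≤ 2 ^ L * 2 ^ L * 2 ^ L := Nat.le_mul_of_pos_left _ h6
    omega
  set W₀ := ((List.range m).map (s.arr 1)).sum with hW₀def
  have hW₀ : W₀ < 2 ^ (2 * L) := weight_lt_of_rounds h.weight hr.le hp.m_lt
  have hW₀pos : 0 < W₀ := by
    rw [hW₀def, SetSystem.sum_range_eq]
    exact Finset.sum_pos (fun j hj => h.pos j (Finset.mem_range.1 hj))
      ⟨0, Finset.mem_range.2 hp.m_pos⟩
  have hW₀w : W₀ < 2 ^ w := hp.total_lt (hW₀.trans_le (Nat.pow_le_pow_right (by norm_num) (by omega)))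
  refine Triple.mono_time (Triple.assign_seq (v := 8 * (k * ℓ)) h.env.reg_t
    (Hoare.seq_triple (hoare_tableAll (wt := s.arr 1) (by simp [h.env.reg_m]) (fun _ _ => rfl)
      (by omega) hW₀w (by omega)) fun s₁ hs₁ hf₁ =>
    Triple.assign_seq (v := W₀) hs₁.total
    (Hoare.seq_triple (hoare_fill (m := m) (by simp [hf₁.reg 1 (by decide), h.env.reg_m])
      (by omega) (by omega) (by omega)) fun s₂ hs₂ hf₂ =>
    Triple.assign_seq (v := 8 * (k * ℓ)) (by simp [hf₂.reg 8 (by decide), hf₁.reg 8 (by decide),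
      h.env.reg_t]) (τ := (8 * (k * ℓ) * (L * 7 + 20) + 5) +
        (n * (Tc + 16) + k * eventTime D L ℓ + 14) + 1) ?_))) (by
          rw [roundTime, mul_comm L 7]; omega)
  set s₃ := s₂.setReg 22 (8 * (k * ℓ)) with hs₃
  have e₃ : ∀ x, 1 ≤ x → x ≤ 10 → s₃.reg x = s.reg x := fun x h₁ h₂ => by
    have : s₃.reg x = s₂.reg x := by rw [hs₃]; simp; omega
    rw [this, hf₂.reg x (by interval_cases x <;> decide), Memory.reg_setReg, if_neg (by omega),
      hf₁.reg x (by interval_cases x <;> decide), Memory.reg_setReg, if_neg (by omega)]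
  have r0 : s₃.reg 0 = 8 * (k * ℓ) := by
    have : s₃.reg 0 = s₂.reg 0 := by rw [hs₃]; simp
    rw [this, hf₂.reg 0 (by decide), Memory.reg_setReg, if_neg (by omega),
      hf₁.reg 0 (by decide), Memory.reg_setReg, if_pos rfl]
  have r11 : s₃.reg 11 = W₀ := by
    have : s₃.reg 11 = s₂.reg 11 := by rw [hs₃]; simp
    rw [this, hf₂.reg 11 (by decide), Memory.reg_setReg, if_pos rfl]
  have a0 : s₃.arr 0 = s.arr 0 := by
    rw [hs₃, Memory.arr_setReg, hf₂.arr 0 (by decide), Memory.arr_setReg, hf₁.arr 0 (by decide),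
      Memory.arr_setReg]
  have a1 : s₃.arr 1 = s.arr 1 := by
    rw [hs₃, Memory.arr_setReg, hf₂.arr 1 (by decide), Memory.arr_setReg, hf₁.arr 1 (by decide),
      Memory.arr_setReg]
  have a4 : ∀ j < m, s₃.arr 4 j = 0 := hs₂
  have htab : Table (s.arr 1) (List.range m) s₃ := by
    have h15 : s₂.reg 15 = s₁.reg 15 := by rw [hf₂.reg 15 (by decide)]; simp
    have h16 : s₂.reg 16 = s₁.reg 16 := by rw [hf₂.reg 16 (by decide)]; simp
    refine hs₁.congr (by simp [hs₃, h15]) (by simp [hs₃, h16]) ?_ ?_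
    · rw [hs₃, Memory.arr_setReg, hf₂.arr 2 (by decide), Memory.arr_setReg]
    · rw [hs₃, Memory.arr_setReg, hf₂.arr 3 (by decide), Memory.arr_setReg]
  set B : ℝ := v + β * ((k * r - ∑ j ∈ C, Nat.log 2 (s.arr 1 j) : ℕ) : ℝ) with hB
  refine Triple.mono_bound (Triple.seq (triple_draw (J := L) (q := 8 * (k * ℓ)) (st := 8 * (k * ℓ))
    htab hW₀pos hW₀w (by simpa using hp.m_lt.le) (by omega) (by simp; omega) (by simp [hs₃])
    -- The coefficients are chosen so that the sum left after the draw is `β` times the risk.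
    (by omega) (by omega) (I.pending D 0) (fun f => β * (Real.exp (-(ℓ / 2)) *
      Real.exp (8 * k * ℓ / W₀ * I.weight (s.arr 1) f))) B)
    fun s₄ hs₄ hf₄ => ?_) ?_
  · have e₄ : ∀ x, 1 ≤ x → x ≤ 11 → s₄.reg x = s₃.reg x := fun x h₁ h₂ =>
      hf₄.reg x (by interval_cases x <;> decide)
    have a1' : s₄.arr 1 = s.arr 1 := by rw [hf₄.arr 1 (by decide), a1]
    have hlen := hs₄.length
    rw [r0] at hlen
    set s₅ := (s₄.setReg 12 0).setReg 13 0 with hs₅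
    have hsweep : Sweep I ℓ L k D md W₀ a₀ s₅ := by
      constructor
      · refine h.env.congr fun x h₁ h₂ => ?_
        rw [← e₃ x h₁ (by omega), ← e₄ x h₁ (by omega), hs₅]
        simp only [Memory.reg_setReg]
        rw [if_neg (by omega), if_neg (by omega)]
      · intro j hj
        have := hs₄.mark j
        rw [a4 j hj, r0] at this
        rw [show s₅.arr = s₄.arr from rfl, show s₅.reg 0 = s₄.reg 0 by simp [hs₅], this, hlen]
        simp only [ne_eq, not_true_eq_false, false_or]
        constructor
        · rintro ⟨i, hi, hj⟩
          exact ⟨_, by omega, by omega, hj⟩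
        · rintro ⟨i, h₁, h₂, hj⟩
          exact ⟨i - 8 * (k * ℓ), by omega, by rwa [Nat.add_sub_cancel' h₁]⟩
      · rw [show s₅.arr = s₄.arr from rfl, a1']; exact h.pos
      · rw [show s₅.reg 11 = s₄.reg 11 by simp [hs₅], e₄ 11 (by norm_num) (by norm_num), r11]
      · rw [show s₅.arr = s₄.arr from rfl, a1', show s₅.reg 12 = 0 by simp [hs₅]]; exact le_rfl
      · simp [hs₅]
      · simp [hs₅]
      · simp [hs₅, hlen]; ring
      · intro i hi
        rw [show s₅.reg 0 = s₄.reg 0 by simp [hs₅], hlen] at hi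
        rw [show s₅.arr = s₄.arr from rfl]
        rcases lt_or_ge i (8 * (k * ℓ)) with h' | h'
        · rw [hs₄.out i (by omega), a0, h.kept i h']; exact ha₀ i h'
        · have := hs₄.mem (i - 8 * (k * ℓ)) (by omega)
          rw [r0, Nat.add_sub_cancel' h'] at this
          simpa using this
      · simp [hs₅]
      · intro i hi
        rw [show s₅.arr = s₄.arr from rfl, hs₄.out i (by omega), a0, h.kept i hi]
    refine Triple.mono_time (Triple.assign_seq Expr.eval_lit_zero (Triple.assign_seq
      Expr.eval_lit_zero (Triple.seq ((triple_sweep (base := k * r) hp h₁ h₀ hW₀pos hW₀ hC hcov v β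
        hβ hsweep).mono_bound ?_) (τ₂ := 7) fun s₆ hs₆ hf₆ => ?_))) (by omega)
    · have hd : deficit C (k * r) s₅ = k * r - ∑ j ∈ C, Nat.log 2 (s.arr 1 j) := by
        rw [deficit, show s₅.arr = s₄.arr from rfl, a1']; simp [hs₅]
      rw [hd, hB]
      refine add_le_add le_rfl (le_of_eq ?_)
      rw [show s₅.reg 13 = 0 by simp [hs₅], risk, Finset.mul_sum, show s₅.arr = s₄.arr from rfl, a1']
      refine Finset.sum_congr rfl fun f _ => ?_
      have hu : unhit I (8 * (k * ℓ)) s₅ f = unhit I (8 * (k * ℓ)) s₄ f :=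
        unhit_congr (by simp [hs₅]) rfl f
      rw [hu]
      ring
    · obtain ⟨hs₆, hend⟩ := hs₆
      have e₆ : s₆.reg 9 = r ∧ s₆.reg 10 = 0 := by
        constructor
        · rw [hf₆.reg 9 (by decide), show s₅.reg 9 = s₄.reg 9 by simp [hs₅],
            e₄ 9 (by norm_num) (by norm_num), e₃ 9 (by norm_num) (by norm_num), h.round]
        · rw [hf₆.reg 10 (by decide), show s₅.reg 10 = s₄.reg 10 by simp [hs₅],
            e₄ 10 (by norm_num) (by norm_num), e₃ 10 (by norm_num) (by norm_num), hok]
      have hbet : ∀ b, Between n m ℓ L k D md a₀ (r + 1) ((s₆.setReg 10 b).setReg 9 (r + 1)) := by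
        intro b
        constructor
        · refine hs₆.env.congr fun x h₁ h₂ => ?_
          simp only [Memory.reg_setReg]
          rw [if_neg (by omega), if_neg (by omega)]
        · exact hs₆.pos
        · have h8 : 8 * ((List.range m).map (s₆.arr 1)).sum ≤ 9 * W₀ := by
            refine Nat.le_of_mul_le_mul_left ?_ hp.k_pos
            calc k * (8 * ((List.range m).map (s₆.arr 1)).sum)
                = 8 * k * ((List.range m).map (s₆.arr 1)).sum := by ring
              _ ≤ (8 * k + s₆.reg 12) * W₀ := hs₆.weight
              _ ≤ (8 * k + k) * W₀ := Nat.mul_le_mul_right _ (by have := hs₆.count; omega)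
              _ = _ := by ring
          simp only [Memory.arr_setReg]
          rw [pow_succ, pow_succ]
          calc 8 ^ r * 8 * ((List.range m).map (s₆.arr 1)).sum
              = 8 ^ r * (8 * ((List.range m).map (s₆.arr 1)).sum) := by ring
            _ ≤ 8 ^ r * (9 * W₀) := Nat.mul_le_mul_left _ h8
            _ = 9 * (8 ^ r * W₀) := by ring
            _ ≤ 9 * (9 ^ r * m) := Nat.mul_le_mul_left _ h.weight
            _ = _ := by ring
        · simp
        · exact hs₆.kept
      by_cases hlt : s₆.reg 13 < n
      -- A sweep that stopped with elements left has used up its `k` events, so the events counted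
      -- grow from at least `k * r` to `k * (r + 1)`.
      · have h12 : s₆.reg 12 = k := by omega
        refine (Hoare.seq (τ₁ := 2) (τ₂ := 3) (P₁ := fun s' => s' = s₆)
          (Hoare.ite (fun _ => Hoare.skip rfl) fun hg => ?_) fun s₇ hs₇ _ =>
          Hoare.assign_seq (P := fun s' => s' = s₆.setReg 9 (r + 1)) (v := r + 1)
          (Expr.eval_add (by rw [hs₇]; exact e₆.1) (Expr.eval_lit one) hrw)
            (Hoare.skip (by rw [hs₇]))).mono_time (by omega) |>.triple ?_
        · rw [Expr.lt_eq_zero (by omega), Expr.eval_reg, Expr.eval_reg, hs₆.env.reg_n] at hg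
          omega
        · rintro s' rfl -
          have := hbet 0
          have e : s₆.setReg 10 0 = s₆ := by
            ext x
            · by_cases hx : x = 10 <;> simp [hx, e₆.2]
            · rfl
          rw [e] at this
          refine ⟨⟨this, .inl (by simp [e₆.2])⟩, ?_⟩
          rw [if_pos (by simp [e₆.2]), deficit, h12, Nat.mul_succ]
          simp
      · refine (Hoare.seq (τ₁ := 2) (τ₂ := 3) (P₁ := fun s' => s' = s₆.setReg 10 1)
          (Hoare.ite (fun hg => ?_) fun hg => Hoare.assign (Expr.eval_lit one) rfl) fun s₇ hs₇ _ =>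
          Hoare.assign_seq (P := fun s' => s' = (s₆.setReg 10 1).setReg 9 (r + 1)) (v := r + 1)
          (Expr.eval_add (by rw [hs₇]; simpa using e₆.1) (Expr.eval_lit one) hrw)
            (Hoare.skip (by rw [hs₇]))).mono_time (by omega) |>.triple ?_
        · rw [Expr.lt_ne_zero (by omega), Expr.eval_reg, Expr.eval_reg, hs₆.env.reg_n] at hg
          omega
        · rintro s' rfl -
          have hl := hs₆.length
          have hc : s₆.reg 12 * ℓ ≤ k * ℓ := Nat.mul_le_mul_right _ hs₆.count
          refine ⟨⟨hbet 1, .inr ⟨by simp, ?_, ?_, ?_, ?_, hs₆.kept⟩⟩, ?_⟩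
          · simp; omega
          · simp; omega
          · simpa using hs₆.out
          · intro f hf hD
            have := hs₆.covered f (by omega) hD
            simp only [Unhit, not_forall, not_not] at this
            obtain ⟨i, -, hi, hif⟩ := this
            exact ⟨i, by simpa using hi, by simpa using hif⟩
          · rw [if_neg (by simp)]
            have := mul_nonneg hβ (Nat.cast_nonneg (α := ℝ) (deficit C (k * r) s₆))
            linarith
  · refine add_le_add le_rfl ?_
    have hW : (0 : ℝ) < W₀ := by exact_mod_cast hW₀pos
    calc _ ≤ ∑ f ∈ I.pending D 0, β * Real.exp (-(ℓ / 2)) := by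
          refine Finset.sum_le_sum fun f _ => ?_
          rw [I.hitWeight_range]
          have hle : (I.weight (s.arr 1) f : ℝ) / W₀ ≤ 1 :=
            (div_le_one hW).2 (by exact_mod_cast I.weight_le _ _)
          have := exp_mul_one_sub_pow_le (q := 8 * (k * ℓ)) hle
            (x := 8 * k * ℓ / W₀ * I.weight (s.arr 1) f) (by push_cast; apply le_of_eq; ring)
          have hu := unhit_le_one (I := I) (8 * (k * ℓ)) s₃ f
          have hu' := unhit_nonneg (I := I) (8 * (k * ℓ)) s₃ f
          have hpow : (0 : ℝ) ≤ (1 - I.weight (s.arr 1) f / W₀) ^ (8 * (k * ℓ)) :=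
            pow_nonneg (by linarith) _
          calc _ = (β * Real.exp (-(ℓ / 2))) * (unhit I (8 * (k * ℓ)) s₃ f *
                (Real.exp (8 * k * ℓ / W₀ * I.weight (s.arr 1) f) *
                (1 - I.weight (s.arr 1) f / W₀) ^ (8 * (k * ℓ)))) := by ring
            _ ≤ (β * Real.exp (-(ℓ / 2))) * (1 * 1) := by gcongr
            _ = _ := by ring
      _ = (I.pending D 0).card * (β * Real.exp (-(ℓ / 2))) := by rw [Finset.sum_const, nsmul_eq_mul]
      _ ≤ n * (β * Real.exp (-(ℓ / 2))) := by
          gcongr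
          exact (Finset.card_filter_le _ _).trans (Finset.card_range n).le
      _ = _ := by ring

end Round

/-! ### A run for a fixed guess -/

namespace Prog

open Cmd Expr

/-- Look for a cover under the assumption that the optimum is at most register `5`. -/
def run : Cmd := block
  [.assign 7 (op .div (reg 1) (reg 5)),
   .assign 8 (op .mul (lit 8) (op .mul (reg 5) (reg 3))),
   fill 1 1, .assign 0 (lit 0), tableAll, .assign 22 (reg 8), draw,
   .assign 9 (lit 0), .assign 10 (lit 0),
   .loop (op .mul (op .lt (reg 9) (reg 4)) (op .lt (reg 10) (lit 1))) round]

end Prog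

/-- A bound on the running time of `Prog.run`, if one test for being covered takes time `Tc`. -/
def runTime (n m ℓ L k D Tc : ℕ) : ℕ :=
  4 * L * (roundTime n m ℓ L k D Tc + 1) + 20 * m + 8 * (k * ℓ) * (7 * L + 20) + 50

section Run

variable {n m : ℕ} {I : SetSystem n m} {w ℓ L k D md : ℕ} {s s' : Memory} {a₀ : ℕ → ℕ}

/-- After `4 * L` failed rounds the deficit is at least `4Lk - 2Lk`, as no set of `C` has a weight
above `2^(2L)`. When `C` has at most `k` sets, `β` times the deficit is then at least `1`, and
Markov's inequality applies. If `C` is larger, failing is an admissible outcome, which is why the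
condition on `β` presupposes `C.card ≤ k`. -/
theorem triple_rounds {Tc : ℕ} {C : Finset ℕ} (hp : Params n m w ℓ L k)
    (h₁ : md ≠ 0 → 10 * D + 10 ≤ Tc) (h₀ : md = 0 → 90 * (k * ℓ) + 8 ≤ Tc)
    (hC : C ⊆ Finset.range m) (hcov : ∀ e < n, ∃ j ∈ C, j ∈ I.nbr e) {v β : ℝ} (hv : 0 ≤ v)
    (hβ : 0 ≤ β) (hβ₁ : C.card ≤ k → 1 ≤ β * (2 * L * k : ℕ))
    (ha₀ : ∀ i < 8 * (k * ℓ), a₀ i < m) (j : ℕ) :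
    ∀ {r : ℕ} {s : Memory}, r + j = 4 * L → Between n m ℓ L k D md a₀ r s →
    (s.reg 10 = 0 ∨ Finished I ℓ k D a₀ s) →
    Triple I w (.loop (.op .mul (.op .lt (.reg 9) (.reg 4)) (.op .lt (.reg 10) (.lit 1))) round) s
      (j * (roundTime n m ℓ L k D Tc + 1) + 1)
      (fun s' => Finished I ℓ k D a₀ s' ∨ s'.reg 10 = 0 ∧ k < C.card) (fun _ => v)
      (v + (β * if s.reg 10 = 0 then
        ((k * r - ∑ j ∈ C, Nat.log 2 (s.arr 1 j) : ℕ) : ℝ) else 0) +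
        j * (β * (n * Real.exp (-(ℓ / 2))))) := by
  have hw := hp.word_ge
  have one : 1 < 2 ^ w := Nat.one_lt_two_pow (by omega)
  have hε : 0 ≤ β * (n * Real.exp (-(ℓ / 2))) := by positivity
  have hexit : ∀ (r : ℕ) (s : Memory) (j : ℕ), Finished I ℓ k D a₀ s →
      Triple I w (.loop (.op .mul (.op .lt (.reg 9) (.reg 4)) (.op .lt (.reg 10) (.lit 1))) round) s
      (j * (roundTime n m ℓ L k D Tc + 1) + 1)
      (fun s' => Finished I ℓ k D a₀ s' ∨ s'.reg 10 = 0 ∧ k < C.card) (fun _ => v)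
      (v + (β * if s.reg 10 = 0 then
        ((k * r - ∑ j ∈ C, Nat.log 2 (s.arr 1 j) : ℕ) : ℝ) else 0) +
        j * (β * (n * Real.exp (-(ℓ / 2))))) := by
    intro r s j h
    refine (Triple.loop_exit ?_ (.inl ⟨.inl h, ?_⟩)).mono_time (by omega)
    · rw [Expr.and_lt_eq_zero (by omega), Expr.eval_lit one, Expr.eval_reg (x := 10), h.ok]
      exact .inr le_rfl
    · rw [if_neg (by simp [h.ok])]
      have : 0 ≤ j * (β * (n * Real.exp (-(ℓ / 2)))) := by positivity
      linarith
  induction j with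
  | zero =>
    intro r s hr hs hok
    rcases hok with hok | hok
    swap
    · exact hexit r s 0 hok
    refine (Triple.loop_exit ?_ ?_).mono_time (by omega)
    · rw [Expr.and_lt_eq_zero (by omega), Expr.eval_reg, Expr.eval_reg, hs.round,
        hs.env.reg_rounds]
      exact .inl (by omega)
    · rcases lt_or_ge k C.card with hk | hk
      · refine .inl ⟨.inr ⟨hok, hk⟩, ?_⟩
        rw [if_pos hok]
        have : 0 ≤ β * ((k * r - ∑ j ∈ C, Nat.log 2 (s.arr 1 j) : ℕ) : ℝ) := by positivity
        simp only [Nat.cast_zero, zero_mul]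
        linarith
      · right
        rw [if_pos hok]
        have hlog : ∀ j ∈ C, Nat.log 2 (s.arr 1 j) ≤ 2 * L := by
          intro j hj
          have hW := weight_lt_of_rounds hs.weight (by omega) hp.m_lt
          have hle : s.arr 1 j ≤ ((List.range m).map (s.arr 1)).sum := by
            rw [SetSystem.sum_range_eq]
            exact Finset.single_le_sum (fun _ _ => Nat.zero_le _) (hC hj)
          exact (Nat.log_mono_right (hle.trans hW.le)).trans (Nat.log_pow (by norm_num) _).le
        have hsum : ∑ j ∈ C, Nat.log 2 (s.arr 1 j) ≤ k * (2 * L) :=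
          (Finset.sum_le_card_nsmul _ _ _ hlog).trans (by
            rw [smul_eq_mul]; exact Nat.mul_le_mul_right _ hk)
        have hge : 2 * L * k ≤ k * r - ∑ j ∈ C, Nat.log 2 (s.arr 1 j) := by
          have : k * r = k * (2 * L) + 2 * L * k := by
            rw [show r = 4 * L by omega]; ring
          omega
        have : (1 : ℝ) ≤ β * ((k * r - ∑ j ∈ C, Nat.log 2 (s.arr 1 j) : ℕ) : ℝ) :=
          (hβ₁ hk).trans (by gcongr)
        simp only [Nat.cast_zero, zero_mul]
        linarith
  | succ j ih =>
    intro r s hr hs hok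
    rcases hok with hok | hok
    swap
    · exact hexit r s (j + 1) hok
    refine (Triple.loop_step ?_ (triple_round hp h₁ h₀ hC hcov
      (v + j * (β * (n * Real.exp (-(ℓ / 2))))) β hβ (by omega) ha₀ hs hok)
      (τ₂ := j * (roundTime n m ℓ L k D Tc + 1) + 1) fun s₁ hs₁ _ => ?_).mono_time
      (by rw [Nat.succ_mul]; omega) |>.mono_bound ?_
    · rw [Expr.and_lt_ne_zero (by omega), Expr.eval_lit one, Expr.eval_reg, Expr.eval_reg,
        Expr.eval_reg, hs.round, hs.env.reg_rounds, hok]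
      omega
    · refine (ih (by omega) hs₁.1 hs₁.2).mono_bound (le_of_eq ?_)
      ring
    · rw [if_pos hok]
      push_cast
      linarith

/-- The output of a successful run is a cover. -/
structure Covering (I : SetSystem n m) (r : ℕ) (s : Memory) : Prop where
  length_le : s.reg 0 ≤ r
  out : ∀ i < s.reg 0, s.arr 0 i < m
  covered : ∀ f < n, ∃ i < s.reg 0, s.arr 0 i ∈ I.nbr f

/-- An element in more than `m / k` sets is hit by a uniform draw with probability at least `1/k`.
Of the resulting exponent `-8ℓ` only `-ℓ/2` is needed. -/
theorem exp_half_mul_miss_le {d : ℕ} (hk : 0 < k) (hd : m / k < d) (hdm : d ≤ m) :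
    (1 - d / m : ℝ) ^ (8 * (k * ℓ)) ≤ Real.exp (-(ℓ / 2)) := by
  have hm : (0 : ℝ) < m := by exact_mod_cast (Nat.zero_le _).trans_lt (hd.trans_le hdm)
  have hkd : (m : ℝ) ≤ k * d := by
    have := (Nat.div_lt_iff_lt_mul hk).1 hd
    rw [mul_comm] at this
    exact_mod_cast this.le
  have h := exp_mul_one_sub_pow_le (q := 8 * (k * ℓ)) (p := (d : ℝ) / m) (x := ℓ / 2)
    ((div_le_one hm).2 (by exact_mod_cast hdm)) (by
      rw [mul_div_assoc', le_div_iff₀ hm]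
      push_cast
      calc (ℓ / 2 * m : ℝ) ≤ ℓ / 2 * (k * d) := by gcongr
        _ = (k * d * ℓ) * (1 / 2) := by ring
        _ ≤ (k * d * ℓ) * 8 := by gcongr; norm_num
        _ = _ := by ring)
  rw [Real.exp_neg, ← one_div, le_div_iff₀ (Real.exp_pos _), mul_comm]
  exact h

/-- Of the error `3 * n * exp (-ℓ/2)`, one third is for missing an element that lies in more than `m
/ k` sets and two thirds are for the rounds. -/
theorem triple_run {Tc : ℕ} {C : Finset ℕ} (hp : Params n m w ℓ L k) (hL : 0 < L)
    (hm : s.reg 1 = m) (hn : s.reg 2 = n) (hℓ : s.reg 3 = ℓ) (h4 : s.reg 4 = 4 * L)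
    (hk : s.reg 5 = k) (hmd : s.reg 6 = md)
    (h₁ : md ≠ 0 → 10 * (m / k) + 10 ≤ Tc) (h₀ : md = 0 → 90 * (k * ℓ) + 8 ≤ Tc)
    (hC : C ⊆ Finset.range m) (hcov : ∀ e < n, ∃ j ∈ C, j ∈ I.nbr e) {v : ℝ} (hv : 0 ≤ v) :
    Triple I w run s (runTime n m ℓ L k (m / k) Tc)
      (fun s' => s'.reg 10 = 1 ∧ Covering I (17 * (k * ℓ)) s' ∨ s'.reg 10 = 0 ∧ k < C.card)
      (fun _ => v) (v + 3 * n * Real.exp (-(ℓ / 2))) := by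
  have hw := hp.word_ge
  have one : 1 < 2 ^ w := Nat.one_lt_two_pow (by omega)
  have eight : 8 < 2 ^ w :=
    lt_of_lt_of_le (by norm_num : 8 < 2 ^ 6) (Nat.pow_le_pow_right (by norm_num) hw)
  have hm2 := hp.two_m_lt
  have hkℓ := hp.kℓ_lt
  set D := m / k with hD
  have htot : ((List.range m).map (fun _ => 1)).sum = m := by simp
  refine Triple.mono_time (Triple.assign_seq (v := D) (Expr.eval_div hm hk (by omega))
    (Triple.assign_seq (v := 8 * (k * ℓ)) (Expr.eval_mul (Expr.eval_lit eight)
      (Expr.eval_mul (by simp [hk]) (by simp [hℓ]) (by omega)) (by omega))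
    (Hoare.seq_triple (hoare_fill (m := m) (by simp [hm]) (by omega) (by omega) one)
      fun s₁ hs₁ hf₁ => Triple.assign_seq Expr.eval_lit_zero
    (Hoare.seq_triple (hoare_tableAll (wt := fun _ => 1) (by simp [hf₁.reg 1 (by decide), hm])
      hs₁ (by omega) (by rw [htot]; omega) (by omega)) fun s₂ hs₂ hf₂ =>
    Triple.assign_seq (v := 8 * (k * ℓ)) (by simp [hf₂.reg 8 (by decide), hf₁.reg 8 (by decide)])
    (τ := (8 * (k * ℓ) * (L * 7 + 20) + 5) +
        (4 * L * (roundTime n m ℓ L k D Tc + 1) + 1 + 6) + 1) ?_)))) (by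
          rw [runTime, mul_comm L 7]; omega)
  set s₃ := s₂.setReg 22 (8 * (k * ℓ)) with hs₃
  have hfix : ∀ x, 1 ≤ x → x ≤ 6 → s₃.reg x = s.reg x := fun x h₁ h₂ => by
    have : s₃.reg x = s₂.reg x := by rw [hs₃]; simp; omega
    rw [this, hf₂.reg x (by interval_cases x <;> decide), Memory.reg_setReg, if_neg (by omega),
      hf₁.reg x (by interval_cases x <;> decide), Memory.reg_setReg, if_neg (by omega),
      Memory.reg_setReg, if_neg (by omega)]
  have henv : Env n m ℓ L k D md s₃ := by
    constructor
    · rw [hfix 1 (by norm_num) (by norm_num), hm]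
    · rw [hfix 2 (by norm_num) (by norm_num), hn]
    · rw [hfix 3 (by norm_num) (by norm_num), hℓ]
    · rw [hfix 4 (by norm_num) (by norm_num), h4]
    · rw [hfix 5 (by norm_num) (by norm_num), hk]
    · rw [hfix 6 (by norm_num) (by norm_num), hmd]
    · simp [hs₃, hf₂.reg 7 (by decide), hf₁.reg 7 (by decide)]
    · simp [hs₃, hf₂.reg 8 (by decide), hf₁.reg 8 (by decide)]
  have r0 : s₃.reg 0 = 0 := by simp [hs₃, hf₂.reg 0 (by decide)]
  have a1 : ∀ j < m, s₃.arr 1 j = 1 := fun j hj => by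
    rw [hs₃, Memory.arr_setReg, hf₂.arr 1 (by decide), Memory.arr_setReg, hs₁ j hj]
  have htab : Table (fun _ => 1) (List.range m) s₃ :=
    hs₂.congr (by simp [hs₃]) (by simp [hs₃]) (by simp [hs₃]) (by simp [hs₃])
  -- With `β = 1 / (2Lk)` a deficit of `2Lk` counts as certain failure, while the `4L` rounds
  -- contribute the factor `4Lβ = 2/k ≤ 2`.
  have hβ : ∃ β : ℝ, 0 ≤ β ∧ (C.card ≤ k → 1 ≤ β * (2 * L * k : ℕ)) ∧ β * (4 * L) ≤ 2 := by
    have hkR : (1 : ℝ) ≤ k := by exact_mod_cast hp.k_pos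
    have hLR : (0 : ℝ) < L := by exact_mod_cast hL
    refine ⟨1 / (2 * L * k), by positivity, fun _ => ?_, ?_⟩
    · push_cast
      rw [one_div, inv_mul_cancel₀ (by positivity)]
    · rw [div_mul_eq_mul_div, div_le_iff₀ (by positivity)]
      nlinarith
  obtain ⟨β, hβ₀, hβ₁, hβ₂⟩ := hβ
  set ε : ℝ := Real.exp (-(ℓ / 2)) with hε
  have hε₀ : 0 < ε := Real.exp_pos _
  set v' : ℝ := v + (4 * L : ℕ) * (β * (n * ε)) with hv'
  have hv'₀ : 0 ≤ v' := by positivity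
  set H := (Finset.range n).filter fun f => D < (I.nbr f).length with hH
  refine Triple.mono_bound (Triple.seq (triple_draw (J := L) (q := 8 * (k * ℓ)) (st := 0) htab
    (by rw [htot]; exact hp.m_pos) (by rw [htot]; omega) (by simpa using hp.m_lt.le) (by omega)
    (by simp; omega) (by simp [hs₃]) (by omega) (Nat.zero_le _) H (fun _ => 1) v')
    fun s₄ hs₄ hf₄ => ?_) ?_
  -- If some element in more than `D` sets was missed, its indicator alone makes the bound at least
  -- `1`.
  · by_cases hall : ∀ f ∈ H, ¬ Unhit I 0 s₄ f
    swap
    · push Not at hall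
      obtain ⟨f, hf, hU⟩ := hall
      refine Triple.of_one_le ?_
      have : (1 : ℝ) * unhit I 0 s₄ f ≤ ∑ f ∈ H, 1 * unhit I 0 s₄ f :=
        Finset.single_le_sum (f := fun f => 1 * unhit I 0 s₄ f) (fun f _ => by
          rw [one_mul]; exact unhit_nonneg _ _ _) hf
      rw [unhit, if_pos hU] at this
      linarith
    have hle : v' ≤ v' + ∑ f ∈ H, 1 * unhit I 0 s₄ f :=
      le_add_of_nonneg_right (Finset.sum_nonneg fun f _ => by
        rw [one_mul]; exact unhit_nonneg _ _ _)
    refine Triple.mono_bound ?_ hle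
    have hlen := hs₄.length
    rw [r0, zero_add] at hlen
    have ha₀ : ∀ i < 8 * (k * ℓ), s₄.arr 0 i < m := fun i hi => by
      have := hs₄.mem i hi
      rw [r0, zero_add] at this
      simpa using this
    have a1' : s₄.arr 1 = s₃.arr 1 := hf₄.arr 1 (by decide)
    -- The uniform sample is frozen as the reference `a₀`; every round restarts its output after
    -- these `8kℓ` cells.
    have hbet : Between n m ℓ L k D md (s₄.arr 0) 0 ((s₄.setReg 9 0).setReg 10 0) := by
      constructor
      · refine henv.congr fun x h₁ h₂ => ?_
        simp only [Memory.reg_setReg]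
        rw [if_neg (by omega), if_neg (by omega), hf₄.reg x (by interval_cases x <;> decide)]
      · intro j hj
        rw [show ((s₄.setReg 9 0).setReg 10 0).arr = s₄.arr from rfl, a1', a1 j hj]
      · rw [show ((s₄.setReg 9 0).setReg 10 0).arr = s₄.arr from rfl, a1', SetSystem.sum_range_eq,
          Finset.sum_congr rfl fun j hj => a1 j (Finset.mem_range.1 hj)]
        simp
      · simp
      · intro i _; rfl
    refine Triple.mono_time (Triple.assign_seq Expr.eval_lit_zero (Triple.assign_seq
      Expr.eval_lit_zero (Triple.seq ((triple_rounds hp h₁ h₀ hC hcov hv hβ₀ hβ₁ ha₀ (4 * L)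
        (Nat.zero_add _) hbet (.inl (by simp))).mono_bound ?_) (τ₂ := 1) fun s₅ hs₅ _ =>
          Triple.skip ⟨?_, le_rfl⟩))) (by omega)
    · rw [if_pos (by simp), hv', mul_zero, Nat.zero_sub, Nat.cast_zero, mul_zero, add_zero]
    · refine hs₅.imp_left fun h => ⟨h.ok, h.length_le, h.out, fun f hf => ?_⟩
      rcases le_or_gt (I.nbr f).length D with hfD | hfD
      · exact h.covered f hf hfD
      · have := hall f (by simp [hH, hf, hfD])
        simp only [Unhit, not_forall, not_not] at this
        obtain ⟨i, -, hi, hif⟩ := this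
        have hi' : i < 8 * (k * ℓ) := by omega
        exact ⟨i, lt_of_lt_of_le hi' h.le_length, by rw [h.kept i hi']; exact hif⟩
  · have hsum : ∑ f ∈ H, 1 * unhit I 0 s₃ f *
        (1 - I.hitWeight (fun _ => 1) (List.range m) f /
          (((List.range m).map (fun _ => 1)).sum : ℕ) : ℝ) ^ (8 * (k * ℓ)) ≤ ∑ f ∈ H, ε := by
      refine Finset.sum_le_sum fun f hf => ?_
      rw [htot, I.hitWeight_range, one_mul]
      have hf' : D < I.weight (fun _ => 1) f := by
        have := (Finset.mem_filter.1 hf).2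
        simpa [SetSystem.weight] using this
      have hfm : I.weight (fun _ => 1) f ≤ m := (I.weight_le _ _).trans htot.le
      have h1 := exp_half_mul_miss_le (ℓ := ℓ) hp.k_pos hf' hfm
      have h2 := unhit_le_one (I := I) 0 s₃ f
      have h3 := unhit_nonneg (I := I) 0 s₃ f
      calc _ ≤ unhit I 0 s₃ f * ε := mul_le_mul_of_nonneg_left h1 h3
        _ ≤ 1 * ε := by gcongr
        _ = ε := one_mul _
    have hcard : ∑ f ∈ H, ε ≤ n * ε := by
      rw [Finset.sum_const, nsmul_eq_mul]
      gcongr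
      exact (Finset.card_filter_le _ _).trans (Finset.card_range n).le
    have : ((4 * L : ℕ) : ℝ) * (β * (n * ε)) ≤ 2 * (n * ε) := by
      have h' : ((4 * L : ℕ) : ℝ) * (β * (n * ε)) = β * (4 * L) * (n * ε) := by push_cast; ring
      rw [h']
      gcongr
    rw [hv']
    linarith

end Run

/-! ### The search for the right guess -/

namespace Prog

open Cmd Expr

/-- Compute the binary length of the number in register `y` into register `x`. -/
def bits (x y : ℕ) : Cmd := block
  [.assign x (lit 0), .assign 28 (reg y),
   .loop (op .lt (lit 0) (reg 28)) (block
    [.assign 28 (op .div (reg 28) (lit 2)), .assign x (op .add (reg x) (lit 1))])]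

/-- Guess the optimum from below and from above. -/
def bracket : Cmd :=
  .loop (op .mul (op .lt (reg 10) (lit 1)) (op .lt (reg 27) (lit 1))) (block
    [.assign 5 (reg 25), .assign 6 (lit 0), run,
     .ite (reg 10) .skip (block
      [.assign 5 (reg 26), .assign 6 (lit 1), run,
       .ite (reg 10)
        (block [.assign 10 (lit 0), .assign 25 (op .add (reg 25) (reg 25)),
          .assign 26 (op .div (reg 26) (lit 2))])
        (.assign 27 (lit 1))])])

/-- Increase the guess until a cover is found. -/
def climb : Cmd :=
  .loop (op .lt (reg 10) (lit 1)) (block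
    [.assign 26 (op .add (op .add (reg 26) (reg 26)) (lit 1)),
     .assign 5 (reg 26), .assign 6 (lit 1), run])

/-- The set cover algorithm; the number of samples is governed by the constant `c`. -/
def main (c : ℕ) : Cmd := block
  [.assign 2 (reg 0), bits 3 2, .assign 3 (op .mul (lit c) (reg 3)),
   bits 4 1, .assign 4 (op .mul (lit 4) (reg 4)),
   .assign 25 (lit 1), .assign 26 (reg 1), bracket, climb]

end Prog

section Main

variable {n m : ℕ} {I : SetSystem n m} {w ℓ L : ℕ} {s s' : Memory}

theorem hoare_bits {x y v : ℕ} (hy : s.reg y = v) (hxy : y ≠ x) (hx : x ≠ 28) (hw : 2 ≤ w)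
    (hv : v < 2 ^ w) (hs : Nat.size v < 2 ^ w) :
    Hoare I w (bits x y) s (Nat.size v * 6 + 7) (fun s' => s'.reg x = Nat.size v) := by
  have two : 2 < 2 ^ w := lt_of_lt_of_le (by norm_num) (Nat.pow_le_pow_right (by norm_num) hw)
  refine Hoare.mono_time (Hoare.assign_seq Expr.eval_lit_zero (Hoare.assign_seq (v := v)
    (by simp [hy, hxy]) (Hoare.seq (τ₁ := Nat.size v * 6 + 1)
      (P₁ := fun s' => s'.reg x = Nat.size v ∧ s'.reg 28 = v / 2 ^ Nat.size v)
      (Hoare.loop_count (τ := 5) (Nat.size v) (fun i s' => s'.reg x = i ∧ s'.reg 28 = v / 2 ^ i)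
        (by simp [hx]) ?_ ?_) fun s' h' _ => .skip h'.1))) (by omega)
  · rintro i s₁ hi ⟨hx₁, h28⟩ -
    refine ⟨?_, ?_⟩
    · rw [Expr.lt_ne_zero (by omega), Expr.eval_lit_zero, Expr.eval_reg, h28]
      exact Nat.div_pos (Nat.lt_size.1 hi) (by positivity)
    · refine Hoare.mono_time (Hoare.assign_seq (v := v / 2 ^ i / 2) (Expr.eval_div h28
        (Expr.eval_lit two) ((Nat.div_le_self _ _).trans_lt hv)) (Hoare.assign_seq (v := i + 1)
        (Expr.eval_add (by simp [hx, hx₁]) (Expr.eval_lit (by omega)) (by omega))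
        (Hoare.skip ⟨by simp, ?_⟩))) (le_refl _)
      simp [hx.symm, Nat.div_div_eq_div_mul, pow_succ]
  · rintro s₁ ⟨-, h28⟩ -
    rw [Expr.lt_eq_zero (by omega), Expr.eval_lit_zero, Expr.eval_reg, h28,
      Nat.div_eq_of_lt (Nat.lt_size_self v)]

/-- The registers that stay fixed during the whole search. -/
structure Glob (n m ℓ L : ℕ) (s : Memory) : Prop where
  reg_m : s.reg 1 = m
  reg_n : s.reg 2 = n
  reg_ℓ : s.reg 3 = ℓ
  reg_rounds : s.reg 4 = 4 * L

theorem Glob.congr (h : Glob n m ℓ L s) (hr : ∀ x, 1 ≤ x → x ≤ 4 → s'.reg x = s.reg x) :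
    Glob n m ℓ L s' := by
  constructor
  · rw [hr 1 (by norm_num) (by norm_num), h.reg_m]
  · rw [hr 2 (by norm_num) (by norm_num), h.reg_n]
  · rw [hr 3 (by norm_num) (by norm_num), h.reg_ℓ]
  · rw [hr 4 (by norm_num) (by norm_num), h.reg_rounds]

/-- What the search knows about the instance: the optimum `q`, and a uniform bound `R` on the
running time of the runs for the guesses that occur, which are related to numbers up to `A`. -/
structure Search (I : SetSystem n m) (w ℓ L q A R : ℕ) (C : Finset ℕ) : Prop where
  params : ∀ k, 0 < k → k ≤ 2 * m → Params n m w ℓ L k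
  L_pos : 0 < L
  subset : C ⊆ Finset.range m
  cover : ∀ e < n, ∃ j ∈ C, j ∈ I.nbr e
  card : C.card = q
  q_le : q ≤ m
  q_pos : 0 < q
  le_of_covering : ∀ r s, Covering I r s → q ≤ r
  le_A : ∀ a, a ≤ 2 * q → a * q ≤ 34 * ℓ * m → a ≤ A
  time_up : ∀ a, 0 < a → a ≤ A → a ≤ 2 * m → runTime n m ℓ L a (m / a) (90 * (a * ℓ) + 8) ≤ R
  time_down : ∀ a b, 0 < a → a ≤ A → 0 < b → b ≤ 2 * m → m / b ≤ 2 * a →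
    runTime n m ℓ L b (m / b) (10 * (m / b) + 10) ≤ R

/-- Passing from `b` to `2b + 1` doubles `b + 1`, so `j + 1` runs suffice. Each failure certifies
that the guess is below the optimum, hence the next guess is below `2q`. The inequality `m < (b + 1)
* a` keeps the list scans, of length at most `m / (2b + 1) ≤ 2a`, within the time bound `R`. -/
theorem triple_climb {q A R a : ℕ} {C : Finset ℕ} (hS : Search I w ℓ L q A R C) (ha : 0 < a)
    (haA : a ≤ A) {v : ℝ} (hv : 0 ≤ v) (j : ℕ) : ∀ {b : ℕ} {s : Memory}, Glob n m ℓ L s →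
    s.reg 26 = b → b < q → q ≤ (b + 1) * 2 ^ j → m < (b + 1) * a → s.reg 10 = 0 →
    Triple I w climb s ((j + 1) * (R + 9) + 1) (Covering I (34 * (q * ℓ))) (fun _ => v)
      (v + (j + 1 : ℕ) * (3 * n * Real.exp (-(ℓ / 2)))) := by
  set ε := 3 * n * Real.exp (-(ℓ / 2)) with hε
  have hε₀ : 0 ≤ ε := by positivity
  have hm2 := (hS.params 1 one_pos (by have := hS.q_le; have := hS.q_pos; omega)).two_m_lt
  have hw := (hS.params 1 one_pos (by have := hS.q_le; have := hS.q_pos; omega)).word_ge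
  have one : 1 < 2 ^ w := Nat.one_lt_two_pow (by omega)
  have hqm := hS.q_le
  have step : ∀ (b : ℕ) (s : Memory) (v : ℝ), 0 ≤ v → Glob n m ℓ L s → s.reg 26 = b → b < q →
      m < (b + 1) * a → Triple I w (Cmd.block
      [.assign 26 (.op .add (.op .add (.reg 26) (.reg 26)) (.lit 1)),
       .assign 5 (.reg 26), .assign 6 (.lit 1), run]) s (R + 8)
      (fun s' => Glob n m ℓ L s' ∧ s'.reg 26 = 2 * b + 1 ∧
        (s'.reg 10 = 1 ∧ Covering I (34 * (q * ℓ)) s' ∨ s'.reg 10 = 0 ∧ 2 * b + 1 < q))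
      (fun _ => v) (v + ε) := by
    intro b s v hv hg h26 hb hm
    have hp := hS.params (2 * b + 1) (by omega) (by omega)
    have hdiv : m / (2 * b + 1) ≤ 2 * a := by
      refine (Nat.div_lt_of_lt_mul (hm.trans_le ?_)).le
      exact Nat.mul_le_mul (by omega) (by omega)
    refine Triple.mono_time (Triple.assign_seq (v := 2 * b + 1) (Expr.eval_add (a := b + b) (b := 1)
      (Expr.eval_add (by simp [h26]) (by simp [h26]) (by omega)) (Expr.eval_lit one) (by omega) |>.trans
        (by ring)) (Triple.assign_seq (v := 2 * b + 1) (by simp) (Triple.assign_seq (v := 1)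
        (Expr.eval_lit one) (Triple.seq (triple_run (k := 2 * b + 1) (md := 1)
          (Tc := 10 * (m / (2 * b + 1)) + 10) (C := C) hp hS.L_pos
          (by simp [hg.reg_m]) (by simp [hg.reg_n]) (by simp [hg.reg_ℓ]) (by simp [hg.reg_rounds])
          (by simp) (by simp) (by simp) (by simp) hS.subset hS.cover hv |>.mono_time
            (hS.time_down a (2 * b + 1) ha haA (by omega) (by omega) hdiv)) (τ₂ := 1) ?_))))
      (by omega)
    intro s₁ hs₁ hf₁
    refine Triple.skip ⟨⟨hg.congr fun x h₁ h₂ => ?_, ?_, ?_⟩, le_rfl⟩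
    · rw [hf₁.reg x (by interval_cases x <;> decide)]
      simp only [Memory.reg_setReg]
      rw [if_neg (by omega), if_neg (by omega), if_neg (by omega)]
    · rw [hf₁.reg 26 (by decide)]
      simp
    · rw [hS.card] at hs₁
      refine hs₁.imp_left fun h => ⟨h.1, ?_, h.2.out, h.2.covered⟩
      refine h.2.length_le.trans ?_
      calc 17 * ((2 * b + 1) * ℓ) ≤ 17 * ((2 * q) * ℓ) := by gcongr; omega
        _ = _ := by ring
  have hguard : ∀ s : Memory, (Expr.op .lt (.reg 10) (.lit 1)).eval w s ≠ 0 ↔ s.reg 10 = 0 := by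
    intro s
    rw [Expr.lt_ne_zero (by omega), Expr.eval_lit one, Expr.eval_reg]
    omega
  induction j with
  | zero =>
    intro b s hg h26 hb hq hm h10
    refine (Triple.loop_step ((hguard s).2 h10) (step b s v hv hg h26 hb hm) (τ₂ := 1)
      fun s₁ hs₁ _ => ?_).mono_time (by omega) |>.mono_bound (by push_cast; linarith)
    obtain ⟨-, -, h | h⟩ := hs₁
    · exact Triple.loop_exit (by rw [← not_ne_iff, hguard, h.1]; norm_num) (.inl ⟨h.2, le_rfl⟩)
    -- Here `q ≤ b + 1`, so the guess `2b + 1` cannot be below `q`.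
    · omega
  | succ j ih =>
    intro b s hg h26 hb hq hm h10
    have hv' : 0 ≤ v + (j + 1 : ℕ) * ε := by positivity
    refine (Triple.loop_step ((hguard s).2 h10) (step b s _ hv' hg h26 hb hm)
      (τ₂ := (j + 1) * (R + 9) + 1) fun s₁ hs₁ _ => ?_).mono_time
        (by rw [Nat.succ_mul (j + 1)]; omega) |>.mono_bound (by push_cast; linarith)
    obtain ⟨hg₁, h26₁, h | h⟩ := hs₁
    · exact (Triple.loop_exit (by rw [← not_ne_iff, hguard, h.1]; norm_num)
        (.inl ⟨h.2, le_add_of_nonneg_right (by positivity)⟩)).mono_time (by omega)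
    · refine ih hg₁ h26₁ h.2 (hq.trans (le_of_eq ?_)) (hm.trans_le ?_) h.1
      · ring
      · gcongr; omega

/-- The guesses `a` and `m / a` approach the optimum from both sides at comparable cost. A success
at `a` gives a cover from a guess below `2q`. A failure at `m / a` hands a lower bound over to
`climb`. A success at `m / a` yields a cover that may be far too large and is discarded, but it
bounds the optimum by `17ℓm/a` and so justifies doubling `a`. -/
theorem triple_bracket {q A R : ℕ} {C : Finset ℕ} (hS : Search I w ℓ L q A R C)
    {v : ℝ} (hv : 0 ≤ v) (j : ℕ) : ∀ {a : ℕ} {s : Memory}, 0 < a → a ≤ A → a < 2 * q →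
    Glob n m ℓ L s → s.reg 25 = a → s.reg 26 = m / a → q ≤ a * 2 ^ j → s.reg 10 = 0 →
    s.reg 27 = 0 →
    Triple I w bracket s ((j + 1) * (2 * R + 24) + 1)
      (fun s' => s'.reg 10 = 1 ∧ Covering I (34 * (q * ℓ)) s' ∨ s'.reg 10 = 0 ∧ Glob n m ℓ L s' ∧
        s'.reg 26 < q ∧ ∃ a, 0 < a ∧ a ≤ A ∧ m < (s'.reg 26 + 1) * a) (fun _ => v)
      (v + (j + 1 : ℕ) * (2 * (3 * n * Real.exp (-(ℓ / 2))))) := by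
  set ε := 3 * n * Real.exp (-(ℓ / 2)) with hε
  have hε₀ : 0 ≤ ε := by positivity
  have hm2 := (hS.params 1 one_pos (by have := hS.q_le; have := hS.q_pos; omega)).two_m_lt
  have hw := (hS.params 1 one_pos (by have := hS.q_le; have := hS.q_pos; omega)).word_ge
  have one : 1 < 2 ^ w := Nat.one_lt_two_pow (by omega)
  have two : 2 < 2 ^ w :=
    lt_of_lt_of_le (by norm_num : 2 < 2 ^ 6) (Nat.pow_le_pow_right (by norm_num) hw)
  have hqm := hS.q_le
  set Done : Memory → Prop := fun s' => s'.reg 10 = 1 ∧ Covering I (34 * (q * ℓ)) s' with hDone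
  set Low : Memory → Prop := fun s' => s'.reg 10 = 0 ∧ Glob n m ℓ L s' ∧
        s'.reg 26 < q ∧ ∃ a, 0 < a ∧ a ≤ A ∧ m < (s'.reg 26 + 1) * a with hLow
  set Next : ℕ → Memory → Prop := fun a s' => s'.reg 10 = 0 ∧ s'.reg 27 = 0 ∧ Glob n m ℓ L s' ∧
    s'.reg 25 = 2 * a ∧ s'.reg 26 = m / (2 * a) ∧ 2 * a < 2 * q ∧ 2 * a ≤ A with hNext
  have step : ∀ (a : ℕ) (s : Memory) (v : ℝ), 0 ≤ v → 0 < a → a ≤ A → a < 2 * q →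
      Glob n m ℓ L s → s.reg 25 = a → s.reg 26 = m / a → s.reg 27 = 0 →
      Triple I w (Cmd.block
      [.assign 5 (.reg 25), .assign 6 (.lit 0), run,
       .ite (.reg 10) .skip (.block
        [.assign 5 (.reg 26), .assign 6 (.lit 1), run,
         .ite (.reg 10)
          (.block [.assign 10 (.lit 0), .assign 25 (.op .add (.reg 25) (.reg 25)),
            .assign 26 (.op .div (.reg 26) (.lit 2))])
          (.assign 27 (.lit 1))])]) s (2 * R + 23)
      (fun s' => Done s' ∨ (Low s' ∧ s'.reg 27 = 1) ∨ Next a s') (fun _ => v) (v + 2 * ε) := by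
    intro a s v hv ha haA haq hg h25 h26 h27
    refine Triple.mono_time (Triple.assign_seq (v := a) (by simp [h25]) (Triple.assign_seq
      Expr.eval_lit_zero (Triple.seq (((triple_run (k := a) (md := 0) (Tc := 90 * (a * ℓ) + 8)
        (C := C) (hS.params a ha (by omega)) hS.L_pos
          (by simp [hg.reg_m]) (by simp [hg.reg_n]) (by simp [hg.reg_ℓ]) (by simp [hg.reg_rounds])
          (by simp) (by simp) (by simp) (by simp) hS.subset hS.cover (v := v + ε)
          (by positivity)).mono_time
            (hS.time_up a ha haA (by omega))).mono_bound (le_of_eq (by ring))) (τ₂ := R + 18)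
      fun s₁ hs₁ hf₁ => ?_))) (by omega)
    have hg₁ : Glob n m ℓ L s₁ := hg.congr fun x h₁ h₂ => by
      rw [hf₁.reg x (by interval_cases x <;> decide)]
      simp only [Memory.reg_setReg]
      rw [if_neg (by omega), if_neg (by omega)]
    have h25₁ : s₁.reg 25 = a := by rw [hf₁.reg 25 (by decide)]; simp [h25]
    have h26₁ : s₁.reg 26 = m / a := by rw [hf₁.reg 26 (by decide)]; simp [h26]
    have h27₁ : s₁.reg 27 = 0 := by rw [hf₁.reg 27 (by decide)]; simp [h27]
    rw [hS.card] at hs₁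
    refine Triple.mono_time (Triple.seq (τ₁ := (R + 15) + 1) (τ₂ := 1)
      (P₁ := fun s' => Done s' ∨ (Low s' ∧ s'.reg 27 = 1) ∨ Next a s') (ψ₁ := fun _ => v)
      (Triple.ite (fun h10 => ?_) fun h10 => ?_) fun s₂ hs₂ _ => .skip ⟨hs₂, le_rfl⟩) (by omega)
    · rw [Expr.eval_reg] at h10
      rcases hs₁ with hs₁ | hs₁
      · refine (Triple.skip ⟨.inl ⟨hs₁.1, ?_, hs₁.2.out, hs₁.2.covered⟩, by linarith⟩).mono_time
          (by omega)
        refine hs₁.2.length_le.trans ?_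
        calc 17 * (a * ℓ) ≤ 17 * ((2 * q) * ℓ) := by gcongr
          _ = _ := by ring
      · exact absurd hs₁.1 h10
    rw [Expr.eval_reg] at h10
    rcases hs₁ with hs₁ | hs₁
    · rw [hs₁.1] at h10; omega
    have haq' := hs₁.2
    set b := m / a with hb
    have hb₀ : 0 < b := Nat.div_pos (by omega) ha
    have hbm : b ≤ m := Nat.div_le_self _ _
    have hab : a * b ≤ m := Nat.mul_div_le m a
    have hab' : m < (b + 1) * a := by
      have := Nat.lt_mul_div_succ m ha
      rw [mul_comm]; exact this
    have hdiv : m / b ≤ 2 * a := by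
      refine (Nat.div_lt_of_lt_mul (hab'.trans_le ?_)).le
      calc (b + 1) * a ≤ (2 * b) * a := by gcongr; omega
        _ = b * (2 * a) := by ring
    refine Triple.mono_time (Triple.assign_seq (v := b) (by simp [h26₁]) (Triple.assign_seq (v := 1)
      (Expr.eval_lit one) (Triple.seq ((triple_run (k := b) (md := 1) (Tc := 10 * (m / b) + 10)
        (C := C) (hS.params b hb₀ (by omega)) hS.L_pos
          (by simp [hg₁.reg_m]) (by simp [hg₁.reg_n]) (by simp [hg₁.reg_ℓ])
          (by simp [hg₁.reg_rounds])
          (by simp) (by simp) (by simp) (by simp) hS.subset hS.cover hv).mono_time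
            (hS.time_down a b ha haA hb₀ (by omega) hdiv)) (τ₂ := 10)
      fun s₂ hs₂ hf₂ => ?_))) (by omega)
    have hg₂ : Glob n m ℓ L s₂ := hg₁.congr fun x h₁ h₂ => by
      rw [hf₂.reg x (by interval_cases x <;> decide)]
      simp only [Memory.reg_setReg]
      rw [if_neg (by omega), if_neg (by omega)]
    have h25₂ : s₂.reg 25 = a := by rw [hf₂.reg 25 (by decide)]; simp [h25₁]
    have h26₂ : s₂.reg 26 = b := by rw [hf₂.reg 26 (by decide)]; simp [h26₁]
    have h27₂ : s₂.reg 27 = 0 := by rw [hf₂.reg 27 (by decide)]; simp [h27₁]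
    rw [hS.card] at hs₂
    refine Triple.mono_time (Triple.seq (τ₁ := 7 + 1) (τ₂ := 1)
      (P₁ := fun s' => Done s' ∨ (Low s' ∧ s'.reg 27 = 1) ∨ Next a s') (ψ₁ := fun _ => v)
      (Triple.ite (fun h10 => ?_) fun h10 => ?_) fun s₂ hs₂ _ => .skip ⟨hs₂, le_rfl⟩) (by omega)
    · rw [Expr.eval_reg] at h10
      rcases hs₂ with hs₂ | hs₂
      swap
      · exact absurd hs₂.1 h10
      have hqb := hS.le_of_covering _ _ hs₂.2
      refine Triple.assign_seq Expr.eval_lit_zero (Triple.assign_seq (v := a + a) (Expr.eval_add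
        (by simp [h25₂]) (by simp [h25₂]) (by omega)) (Triple.assign_seq (v := b / 2)
        (Expr.eval_div (by simp [h26₂]) (Expr.eval_lit two) (by omega))
        (Triple.skip ⟨.inr (.inr ⟨by simp, by simp [h27₂], ?_, ?_, ?_, by omega, ?_⟩), le_rfl⟩)))
      · refine hg₂.congr fun x h₁ h₂ => ?_
        simp only [Memory.reg_setReg]
        rw [if_neg (by omega), if_neg (by omega), if_neg (by omega)]
      · simp; ring
      · simp [hb, Nat.div_div_eq_div_mul, mul_comm]
      · refine hS.le_A _ (by omega) ?_
        -- The cover from the guess `b` gives `q ≤ 17 * b * ℓ`, and `a * b ≤ m`; the failure at `a`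
        -- has given `a < q`.
        calc 2 * a * q ≤ 2 * a * (17 * (b * ℓ)) := by gcongr
          _ = 34 * ℓ * (a * b) := by ring
          _ ≤ 34 * ℓ * m := by gcongr
    · rw [Expr.eval_reg] at h10
      rcases hs₂ with hs₂ | hs₂
      · rw [hs₂.1] at h10; omega
      refine (Triple.assign (v := 1) (Expr.eval_lit one) ⟨.inr (.inl ⟨⟨by simp [h10], ?_, ?_, ?_⟩,
        by simp⟩), le_rfl⟩).mono_time (by omega)
      · refine hg₂.congr fun x h₁ h₂ => ?_
        simp only [Memory.reg_setReg]
        rw [if_neg (by omega)]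
      · simp [h26₂, hs₂.2]
      · exact ⟨a, ha, haA, by simpa [h26₂] using hab'⟩
  have hguard : ∀ s : Memory, (Expr.op .mul (.op .lt (.reg 10) (.lit 1))
      (.op .lt (.reg 27) (.lit 1))).eval w s ≠ 0 ↔ s.reg 10 = 0 ∧ s.reg 27 = 0 := by
    intro s
    rw [Expr.and_lt_ne_zero (by omega), Expr.eval_lit one, Expr.eval_reg, Expr.eval_reg]
    omega
  induction j with
  | zero =>
    intro a s ha haA haq hg h25 h26 hq h10 h27
    refine (Triple.loop_step ((hguard s).2 ⟨h10, h27⟩) (step a s v hv ha haA haq hg h25 h26 h27)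
      (τ₂ := 1) fun s₁ hs₁ _ => ?_).mono_time (by omega) |>.mono_bound (by push_cast; linarith)
    rcases hs₁ with h | h | h
    · exact Triple.loop_exit (by rw [← not_ne_iff, hguard, h.1]; norm_num)
        (.inl ⟨.inl h, le_rfl⟩)
    · exact Triple.loop_exit (by rw [← not_ne_iff, hguard, h.2]; norm_num)
        (.inl ⟨.inr h.1, le_rfl⟩)
    -- No further doubling can occur: `q ≤ a` contradicts `2 * a < 2 * q`.
    · have := h.2.2.2.2.2.1
      omega
  | succ j ih =>
    intro a s ha haA haq hg h25 h26 hq h10 h27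
    have hv' : 0 ≤ v + (j + 1 : ℕ) * (2 * ε) := by positivity
    refine (Triple.loop_step ((hguard s).2 ⟨h10, h27⟩) (step a s _ hv' ha haA haq hg h25 h26 h27)
      (τ₂ := (j + 1) * (2 * R + 24) + 1) fun s₁ hs₁ _ => ?_).mono_time
        (by rw [Nat.succ_mul (j + 1)]; omega) |>.mono_bound (by push_cast; linarith)
    rcases hs₁ with h | h | h
    · exact (Triple.loop_exit (by rw [← not_ne_iff, hguard, h.1]; norm_num)
        (.inl ⟨.inl h, le_add_of_nonneg_right (by positivity)⟩)).mono_time (by omega)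
    · exact (Triple.loop_exit (by rw [← not_ne_iff, hguard, h.2]; norm_num)
        (.inl ⟨.inr h.1, le_add_of_nonneg_right (by positivity)⟩)).mono_time (by omega)
    · obtain ⟨h10, h27, hg, h25, h26, h2q, h2A⟩ := h
      refine ih (by omega) h2A h2q hg h25 h26 (hq.trans (le_of_eq ?_)) h10 h27
      ring

/-- Each of the `j + 1` iterations of `bracket` makes at most two runs and each of those of `climb`
makes one; three errors of `3 * n * exp (-ℓ/2)` give the constant `9`. -/
theorem triple_main {q A R j c : ℕ} {C : Finset ℕ} (hℓ : ℓ = c * Nat.size n) (hL : L = Nat.size m)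
    (hS : Search I w ℓ L q A R C) (hA : 0 < A) (hc : c < 2 ^ w)
    (hn : Nat.size n < 2 ^ w) (hm : 4 * Nat.size m < 2 ^ w) (hℓw : ℓ < 2 ^ w) (hj : q ≤ 2 ^ j) :
    Triple I w (main c) (Memory.start n m)
      (((j + 1) * (3 * R + 33)) + 6 * (Nat.size n + Nat.size m) + 38)
      (Covering I (34 * (q * ℓ))) (fun _ => 0) ((j + 1 : ℕ) * (9 * n * Real.exp (-(ℓ / 2)))) := by
  set ε := 3 * n * Real.exp (-(ℓ / 2)) with hε
  have hε₀ : 0 ≤ ε := by positivity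
  have hp := hS.params 1 one_pos (by have := hS.q_le; have := hS.q_pos; omega)
  have hm2 := hp.two_m_lt
  have hnw := hp.n_lt
  have hw := hp.word_ge
  have one : 1 < 2 ^ w := Nat.one_lt_two_pow (by omega)
  have four : 4 < 2 ^ w :=
    lt_of_lt_of_le (by norm_num : 4 < 2 ^ 6) (Nat.pow_le_pow_right (by norm_num) hw)
  have hqm := hS.q_le
  have hq₀ := hS.q_pos
  refine Triple.mono_time (Triple.assign_seq (v := n) (by simp [Memory.start])
    (Hoare.seq_triple (hoare_bits (v := n) (by simp) (by norm_num) (by norm_num) (by omega)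
      (by omega) hn) fun s₁ h₁ hf₁ => Triple.assign_seq (v := ℓ) (by
        rw [hℓ]; exact Expr.eval_mul (Expr.eval_lit hc) h₁ (hℓ ▸ hℓw))
    (Hoare.seq_triple (hoare_bits (v := m) (by simp [hf₁.reg 1 (by decide), Memory.start])
      (by norm_num) (by norm_num) (by omega) (by omega) (by omega)) fun s₂ h₂ hf₂ =>
    Triple.assign_seq (v := 4 * L) (by
      rw [hL]; exact Expr.eval_mul (Expr.eval_lit four) h₂ hm)
    (Triple.assign_seq (v := 1) (Expr.eval_lit one) (Triple.assign_seq (v := m) (by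
      simp [hf₂.reg 1 (by decide), hf₁.reg 1 (by decide), Memory.start])
    (Triple.seq (P₁ := fun s' => s'.reg 10 = 1 ∧ Covering I (34 * (q * ℓ)) s' ∨
      s'.reg 10 = 0 ∧ Glob n m ℓ L s' ∧
        s'.reg 26 < q ∧ ∃ a, 0 < a ∧ a ≤ A ∧ m < (s'.reg 26 + 1) * a)
      ((triple_bracket (a := 1) hS (v := (j + 1 : ℕ) * ε) (by positivity) j one_pos (by omega)
        (by omega) ?_ (by simp) (by simp) (by omega) ?_ ?_).mono_bound ?_)
      (τ₂ := (j + 1) * (R + 9) + 3) fun s₃ hs₃ _ => ?_)))))) ?_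
  · constructor
    · simp [hf₂.reg 1 (by decide), hf₁.reg 1 (by decide), Memory.start]
    · simp [hf₂.reg 2 (by decide), hf₁.reg 2 (by decide)]
    · simp [hf₂.reg 3 (by decide)]
    · simp
  · simp [hf₂.reg 10 (by decide), hf₁.reg 10 (by decide), Memory.start]
  · simp [hf₂.reg 27 (by decide), hf₁.reg 27 (by decide), Memory.start]
  · push_cast; linarith
  · refine Triple.mono_time (Triple.seq (P₁ := Covering I (34 * (q * ℓ))) (ψ₁ := fun _ => 0)
      (τ₁ := (j + 1) * (R + 9) + 1) (τ₂ := 1) ?_ fun s₄ hs₄ _ => .skip ⟨hs₄, le_rfl⟩) (by omega)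
    rcases hs₃ with h | ⟨h10, hg, h26, a, ha, haA, hma⟩
    · refine (Triple.loop_exit ?_ (.inl ⟨h.2, by positivity⟩)).mono_time (by omega)
      rw [Expr.lt_eq_zero (by omega), Expr.eval_lit one, Expr.eval_reg, h.1]
    · exact (triple_climb hS ha haA le_rfl j hg rfl h26 (hj.trans
        (Nat.le_mul_of_pos_left _ (Nat.succ_pos _))) hma h10).mono_bound (by rw [zero_add])
  · rw [show (j + 1) * (3 * R + 33) = (j + 1) * (2 * R + 24) + (j + 1) * (R + 9) by ring]
    omega

end Main

/-! ### From the logic to the machine -/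

section Machine

open scoped ENNReal

variable {n m : ℕ} {I : SetSystem n m} {w : ℕ} {r : ℝ}

/-- The probability of not having succeeded after `t` steps. -/
noncomputable def failureProb (I : SetSystem n m) (w : ℕ) (r : ℝ) (t : ℕ) (k : List Cmd)
    (s : Memory) : ℝ :=
  ((machineRun I w t (k, s)).toOuterMeasure (SuccessWithin I r)ᶜ).toReal

theorem machineRun_nil (t : ℕ) (s : Memory) : machineRun I w t ([], s) = PMF.pure ([], s) := by
  induction t with
  | zero => rfl
  | succ t ih => rw [machineRun, machineStep, PMF.pure_bind, ih]

theorem PMF.toOuterMeasure_le_one {α : Type*} (p : PMF α) (A : Set α) :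
    p.toOuterMeasure A ≤ 1 := by
  rw [PMF.toOuterMeasure_apply, ← p.tsum_coe]
  exact ENNReal.tsum_le_tsum fun a => Set.indicator_le_self _ _ _

theorem failureProb_succ_of_step {t : ℕ} {k k' : List Cmd} {s s' : Memory}
    (h : machineStep I w (k, s) = PMF.pure (k', s')) :
    failureProb I w r (t + 1) k s = failureProb I w r t k' s' := by
  rw [failureProb, machineRun, h, PMF.pure_bind, failureProb]

theorem failureProb_le_one (t : ℕ) (k : List Cmd) (s : Memory) :
    failureProb I w r t k s ≤ 1 :=
  ENNReal.toReal_le_of_le_ofReal zero_le_one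
    (by simpa using PMF.toOuterMeasure_le_one _ _)

theorem failureProb_sample (t : ℕ) (k : List Cmd) (s : Memory) (x : ℕ) (e : Expr) :
    failureProb I w r (t + 1) (.sample x e :: k) s =
      (∑ v ∈ Finset.range (e.eval w s + 1), failureProb I w r t k (s.setReg x v)) /
        ((e.eval w s + 1 : ℕ) : ℝ) := by
  have step : machineRun I w (t + 1) (.sample x e :: k, s) =
      (PMF.uniformOfFintype (Fin (e.eval w s + 1))).bind fun v =>
        machineRun I w t (k, s.setReg x v) := by
    -- Makes explicit the transport of the uniform law from `Fin` to `ℕ`.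
    change ((((PMF.uniformOfFintype (Fin (e.eval w s + 1))).bind fun v =>
      PMF.pure (v : ℕ)).map fun v => (k, s.setReg x v)).bind (machineRun I w t)) = _
    simp only [PMF.map_bind, PMF.pure_map, PMF.bind_bind, PMF.pure_bind]
  simp only [failureProb]
  rw [step, PMF.toOuterMeasure_bind_apply, tsum_fintype, ENNReal.toReal_sum]
  · rw [Finset.sum_div, ← Fin.sum_univ_eq_sum_range (fun v =>
      ((machineRun I w t (k, s.setReg x v)).toOuterMeasure (SuccessWithin I r)ᶜ).toReal /
        ((e.eval w s + 1 : ℕ) : ℝ))]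
    refine Finset.sum_congr rfl fun v _ => ?_
    rw [ENNReal.toReal_mul, PMF.uniformOfFintype_apply, Fintype.card_fin, ENNReal.toReal_inv,
      ENNReal.toReal_natCast, div_eq_inv_mul]
  · intro v _
    exact ENNReal.mul_ne_top (PMF.apply_ne_top _ _)
      (ne_top_of_le_ne_top ENNReal.one_ne_top (PMF.toOuterMeasure_le_one _ _))

theorem failureProb_nil (t : ℕ) (s : Memory) :
    failureProb I w r t [] s = failureProb I w r 0 [] s := by
  rw [failureProb, machineRun_nil]; rfl

theorem failureProb_zero_cons (c : Cmd) (k : List Cmd) (s : Memory) :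
    failureProb I w r 0 (c :: k) s = 1 := by
  rw [failureProb, machineRun, PMF.toOuterMeasure_pure_apply, if_pos, ENNReal.toReal_one]
  exact fun h => List.cons_ne_nil _ _ h.1

/-- Only monotonicity in time needs an argument: a halted machine stays where it is, and a machine
that still has commands counts as failed at time `0`; the rest is induction on `t`. -/
theorem failureFn_failureProb (I : SetSystem n m) (w : ℕ) (r : ℝ) :
    FailureFn I w (failureProb I w r) where
  le_one := failureProb_le_one
  anti t := by
    induction t with
    | zero =>
      intro k s
      cases k with
      | nil => rw [failureProb_nil]
      | cons c k => rw [failureProb_zero_cons]; exact failureProb_le_one _ _ _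
    | succ t ih =>
      intro k s
      cases k with
      | nil => rw [failureProb_nil, failureProb_nil (t + 1)]
      | cons c k =>
        cases c with
        | sample x e =>
          rw [failureProb_sample, failureProb_sample]
          gcongr
          exact ih _ _
        | _ =>
          refine (failureProb_succ_of_step rfl).trans_le
            ((ih _ _).trans (failureProb_succ_of_step rfl).ge)
  skip _ _ _ := failureProb_succ_of_step rfl
  assign _ _ _ _ _ := failureProb_succ_of_step rfl
  store _ _ _ _ _ _ := failureProb_succ_of_step rfl
  sample := failureProb_sample
  setOf _ _ _ _ _ _ := failureProb_succ_of_step rfl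
  member _ _ _ _ _ _ := failureProb_succ_of_step rfl
  seq _ _ _ _ _ := failureProb_succ_of_step rfl
  ite _ _ _ _ _ _ := failureProb_succ_of_step rfl
  loop _ _ _ _ _ := failureProb_succ_of_step rfl

theorem ofReal_one_sub_failureProb_le (t : ℕ) (k : List Cmd) (s : Memory) :
    ENNReal.ofReal (1 - failureProb I w r t k s) ≤
      (machineRun I w t (k, s)).toOuterMeasure (SuccessWithin I r) := by
  set p := machineRun I w t (k, s)
  have hfin : p.toOuterMeasure (SuccessWithin I r)ᶜ ≠ ⊤ :=
    ne_top_of_le_ne_top ENNReal.one_ne_top (PMF.toOuterMeasure_le_one _ _)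
  have h : (1 : ℝ≥0∞) ≤ p.toOuterMeasure (SuccessWithin I r) +
      p.toOuterMeasure (SuccessWithin I r)ᶜ := by
    calc (1 : ℝ≥0∞) = p.toOuterMeasure Set.univ := by
          rw [PMF.toOuterMeasure_apply, Set.indicator_univ, p.tsum_coe]
      _ ≤ _ := by rw [← Set.union_compl_self (SuccessWithin I r)]; exact MeasureTheory.measure_union_le _ _
  rw [failureProb, ENNReal.ofReal_sub _ ENNReal.toReal_nonneg, ENNReal.ofReal_one,
    ENNReal.ofReal_toReal hfin]
  exact tsub_le_iff_right.2 h

/-- A bound on the failure probability of a program yields a bound on its success probability. -/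
theorem le_successProb_of_triple {p : Cmd} {τ t : ℕ} {P : Memory → Prop} {b : ℝ}
    (h : Triple I w p (Memory.start n m) τ P (fun _ => 0) b) (ht : τ ≤ t)
    (hP : ∀ s, P s → ([], s) ∈ SuccessWithin I r) :
    ENNReal.ofReal (1 - b) ≤ successProb p w I t r := by
  refine le_trans (ENNReal.ofReal_le_ofReal ?_) (ofReal_one_sub_failureProb_le t _ _)
  have := h.mono_time ht _ (failureFn_failureProb I w r) [] 0 fun s hs _ => by
    rw [failureProb, machineRun, PMF.toOuterMeasure_pure_apply, if_neg fun h => h (hP s hs),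
      ENNReal.toReal_zero]
  rw [zero_add] at this
  linarith

end Machine

/-! ### Covers and the optimum -/

section Instance

variable {n m : ℕ} {I : SetSystem n m} {r : ℕ} {s : Memory}

/-- The list of sets that a memory representing a cover outputs. -/
theorem Covering.exists_list (h : Covering I r s) : ∃ L : List (Fin m),
    s.output = L.map Fin.val ∧ I.IsCover L.toFinset ∧ L.length ≤ r := by
  have hlt : ∀ j ∈ s.output, j < m := by
    intro j hj
    obtain ⟨i, hi, rfl⟩ := List.mem_map.1 hj
    exact h.out i (List.mem_range.1 hi)
  have hout : s.output = (s.output.pmap Fin.mk hlt).map Fin.val := by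
    rw [List.map_pmap]
    simp
  refine ⟨s.output.pmap Fin.mk hlt, hout, fun e => ?_, ?_⟩
  · obtain ⟨i, hi, hc⟩ := h.covered e e.2
    have hi' : s.arr 0 i ∈ s.output := List.mem_map.2 ⟨i, List.mem_range.2 hi, rfl⟩
    refine ⟨⟨s.arr 0 i, h.out i hi⟩, ?_, (I.mem_nbr e ⟨_, h.out i hi⟩).1 hc⟩
    exact List.mem_toFinset.2 (List.mem_pmap.2 ⟨_, hi', rfl⟩)
  · rw [List.length_pmap, Memory.output, List.length_map, List.length_range]
    exact h.length_le

theorem SetSystem.opt_spec (hI : I.Coverable) :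
    ∃ C : Finset (Fin m), I.IsCover C ∧ C.card = I.opt :=
  Nat.sInf_mem (s := {k | ∃ C : Finset (Fin m), I.IsCover C ∧ C.card = k})
    ⟨_, Finset.univ, fun e => (hI e).imp fun j hj => ⟨Finset.mem_univ j, hj⟩, rfl⟩

theorem SetSystem.opt_le {C : Finset (Fin m)} (hC : I.IsCover C) : I.opt ≤ C.card :=
  Nat.sInf_le ⟨C, hC, rfl⟩

theorem Covering.opt_le (h : Covering I r s) : I.opt ≤ r := by
  obtain ⟨L, -, hL, hr⟩ := h.exists_list
  exact (SetSystem.opt_le hL).trans ((List.toFinset_card_le L).trans hr)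

theorem Covering.success (h : Covering I r s) {x : ℝ} (hx : (r : ℝ) ≤ x) :
    ([], s) ∈ SuccessWithin I x := by
  obtain ⟨L, h₁, h₂, h₃⟩ := h.exists_list
  exact ⟨rfl, L, h₁, h₂, le_trans (by exact_mod_cast h₃) hx⟩

theorem SetSystem.opt_le_card_sets (hI : I.Coverable) : I.opt ≤ m := by
  obtain ⟨C, -, hC⟩ := SetSystem.opt_spec hI
  rw [← hC]
  simpa using Finset.card_le_univ C

theorem SetSystem.opt_le_card_elements (hI : I.Coverable) : I.opt ≤ n := by
  choose f hf using hI
  refine (SetSystem.opt_le (C := Finset.univ.image f) fun e => ⟨f e, by simp, hf e⟩).trans ?_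
  exact Finset.card_image_le.trans (by simp)

theorem SetSystem.opt_pos (hI : I.Coverable) (hn : 0 < n) : 0 < I.opt := by
  obtain ⟨C, hc, hC⟩ := SetSystem.opt_spec hI
  obtain ⟨j, hj, -⟩ := hc ⟨0, hn⟩
  rw [← hC]
  exact Finset.card_pos.2 ⟨j, hj⟩

end Instance

/-! ### Numerical estimates -/

section Estimates

variable {n m ℓ L : ℕ}

/-- The events of a round are affordable since `k * D ≤ m`. The parameter `a`, separate from `k`,
measures the cost of one coverage test, so that one estimate serves both kinds of test. -/
theorem runTime_le {k D Tc a S : ℕ} (hS : S = ℓ + L + 1) (hℓ : 0 < ℓ) (hL : 0 < L) (hm : 0 < m)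
    (hk : k ≤ 2 * m) (hkD : k * D ≤ m) (hTc : Tc + 16 ≤ 114 * (a * S)) :
    runTime n m ℓ L k D Tc ≤ 1720 * S ^ 3 * (m + n * a) := by
  have hS3 : 3 ≤ S := by omega
  have hS2 : 9 ≤ S ^ 2 := by nlinarith
  have hLS : L ≤ S := by omega
  have h₁ : 7 * L + 20 ≤ 20 * S := by omega
  have h₂ : k * ℓ ≤ 2 * m * S := Nat.mul_le_mul hk (by omega)
  have h₃ : k * ℓ * (7 * L + 20) ≤ 40 * (m * S ^ 2) := by
    calc k * ℓ * (7 * L + 20) ≤ 2 * m * S * (20 * S) := Nat.mul_le_mul h₂ h₁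
      _ = _ := by ring
  have h₄ : m * 9 ≤ m * S ^ 2 := Nat.mul_le_mul_left _ hS2
  have h₅ : k * (12 * L + 45) ≤ 30 * (m * S ^ 2) := by
    calc k * (12 * L + 45) ≤ 2 * m * (15 * S ^ 2) := Nat.mul_le_mul hk (by nlinarith)
      _ = _ := by ring
  have h₆ : k * eventTime D L ℓ ≤ 22 * m + 70 * (m * S ^ 2) := by
    calc k * eventTime D L ℓ = 22 * (k * D) + k * ℓ * (7 * L + 20) + k * (12 * L + 45) := by
          rw [eventTime]; ring
      _ ≤ _ := by omega
  have h₇ : n * (Tc + 16) ≤ 114 * (n * a * S) := by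
    calc n * (Tc + 16) ≤ n * (114 * (a * S)) := Nat.mul_le_mul_left _ hTc
      _ = _ := by ring
  have h₈ : roundTime n m ℓ L k D Tc + 1 ≤ 402 * (m * S ^ 2) + 114 * (n * a * S) := by
    rw [roundTime, mul_assoc 8]
    omega
  have h₉ : 4 * L * (roundTime n m ℓ L k D Tc + 1) ≤
      1608 * (m * S ^ 3) + 456 * (n * a * S ^ 2) := by
    calc _ ≤ 4 * S * (402 * (m * S ^ 2) + 114 * (n * a * S)) :=
          Nat.mul_le_mul (Nat.mul_le_mul_left _ hLS) h₈
      _ = _ := by ring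
  have h₁₀ : n * a * S ^ 2 * 3 ≤ n * a * S ^ 3 := by
    calc _ ≤ n * a * S ^ 2 * S := Nat.mul_le_mul_left _ hS3
      _ = _ := by ring
  have h₁₁ : m * S ^ 2 * 3 ≤ m * S ^ 3 := by
    calc _ ≤ m * S ^ 2 * S := Nat.mul_le_mul_left _ hS3
      _ = _ := by ring
  calc runTime n m ℓ L k D Tc
      = 4 * L * (roundTime n m ℓ L k D Tc + 1) + 20 * m + 8 * (k * ℓ * (7 * L + 20)) + 50 := by
        rw [runTime, mul_assoc 8]
    _ ≤ 1720 * (m * S ^ 3) + 1720 * (n * a * S ^ 3) := by omega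
    _ = _ := by ring

/-- From `2^(size x - 1) ≤ x`; the additive one is absorbed using `T ≥ 2`, and `2 / log 2 < 3`. -/
theorem size_le_log {x : ℕ} {T : ℝ} (hx : 0 < x) (hxT : (x : ℝ) ≤ T) (hT : 2 ≤ T) :
    (Nat.size x : ℝ) ≤ 3 * Real.log T := by
  have hs : 0 < Nat.size x := Nat.size_pos.2 hx
  have h₁ : 2 ^ (Nat.size x - 1) ≤ x := Nat.lt_size.1 (by omega)
  have h₂ : ((2 : ℝ) ^ (Nat.size x - 1)) ≤ T := le_trans (by exact_mod_cast h₁) hxT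
  have h₃ := Real.log_le_log (by positivity) h₂
  rw [Real.log_pow, Nat.cast_sub hs, Nat.cast_one] at h₃
  have h₄ := Real.log_le_log two_pos hT
  have := Real.log_two_gt_d9
  have h₅ : (0 : ℝ) ≤ Nat.size x := Nat.cast_nonneg _
  nlinarith

theorem max_le_coverTime {q : ℕ} (hq : 0 < q) (hqm : q ≤ m) (hqn : q ≤ n) :
    (m : ℝ) ≤ coverTime n m q ∧ (n : ℝ) ≤ coverTime n m q := by
  have hq' : (0 : ℝ) < q := by exact_mod_cast hq
  have h1 : (1 : ℝ) ≤ q := by exact_mod_cast hq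
  have hm' : (q : ℝ) ≤ m := by exact_mod_cast hqm
  have hn' : (q : ℝ) ≤ n := by exact_mod_cast hqn
  refine ⟨le_min ?_ ((le_div_iff₀ hq').2 ?_), le_min ?_ ((le_div_iff₀ hq').2 ?_)⟩ <;> nlinarith

/-- The two bounds on `A` match the two terms of the minimum: `A ≤ 2q` gives `m + nq`, and `A ≤
34ℓm/q` gives `mn/q`, where `m ≤ mn/q` because `q ≤ n`. -/
theorem add_mul_le_coverTime {q A S : ℕ} (hq : 0 < q) (hqn : q ≤ n) (hS : ℓ + 1 ≤ S)
    (hA₁ : A ≤ 2 * q) (hA₂ : A * q ≤ 34 * ℓ * m) :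
    ((m + n * A : ℕ) : ℝ) ≤ 35 * S * coverTime n m q := by
  have hq' : (0 : ℝ) < q := by exact_mod_cast hq
  have key : (m + n * A) ≤ 35 * S * (m + n * q) ∧ (m + n * A) * q ≤ 35 * S * (m * n) := by
    constructor
    · calc m + n * A ≤ m + n * (2 * q) := by gcongr
        _ ≤ 2 * (m + n * q) := by ring_nf; omega
        _ ≤ _ := by gcongr; omega
    · calc (m + n * A) * q = m * q + n * (A * q) := by ring
        _ ≤ m * n + n * (34 * ℓ * m) := by gcongr
        _ = (34 * ℓ + 1) * (m * n) := by ring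
        _ ≤ _ := by gcongr; omega
  have hS' : (0 : ℝ) < 35 * S := by
    have : 0 < S := by omega
    positivity
  rw [← div_le_iff₀' hS']
  refine le_min ((div_le_iff₀' hS').2 (by exact_mod_cast key.1)) ?_
  rw [div_le_iff₀' hS', ← mul_div_assoc, le_div_iff₀ hq']
  exact_mod_cast key.2

/-- Here `exp (-ℓ/2) ≤ n^(-(c+7))`. The other factors are at most `18 * n^2`, and `n^5 ≥ 32` beats
the `18`. -/
theorem error_le {j c : ℕ} (hn : 2 ≤ n) (hj : j ≤ n) (hℓ : ℓ = 2 * (c + 7) * Nat.size n) :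
    ((j + 1 : ℕ) : ℝ) * (9 * n * Real.exp (-(ℓ / 2))) ≤ 1 / (n : ℝ) ^ c := by
  have hn' : (2 : ℝ) ≤ n := by exact_mod_cast hn
  have hn₀ : (0 : ℝ) < n := by linarith
  have h₁ : Real.exp (-(ℓ / 2)) ≤ 1 / (n : ℝ) ^ (c + 7) := by
    have h₂ : (n : ℝ) ≤ Real.exp (Nat.size n) := by
      calc (n : ℝ) ≤ 2 ^ Nat.size n := by exact_mod_cast (Nat.lt_size_self n).le
        _ ≤ Real.exp 1 ^ Nat.size n := by
          gcongr
          have := Real.add_one_le_exp 1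
          linarith
        _ = _ := by rw [← Real.exp_nat_mul, mul_one]
    rw [Real.exp_neg, ← one_div]
    refine one_div_le_one_div_of_le (by positivity) ?_
    calc (n : ℝ) ^ (c + 7) ≤ Real.exp (Nat.size n) ^ (c + 7) := by gcongr
      _ = Real.exp (ℓ / 2) := by
        rw [← Real.exp_nat_mul, hℓ]; congr 1; push_cast; ring
  have h₃ : (18 : ℝ) ≤ (n : ℝ) ^ 5 := by
    calc (18 : ℝ) ≤ 2 ^ 5 := by norm_num
      _ ≤ _ := by gcongr
  calc ((j + 1 : ℕ) : ℝ) * (9 * n * Real.exp (-(ℓ / 2)))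
      ≤ (2 * n : ℕ) * (9 * n * (1 / (n : ℝ) ^ (c + 7))) := by
        gcongr
        omega
    _ = 18 / ((n : ℝ) ^ 5 * (n : ℝ) ^ c) := by
      push_cast; field_simp; ring
    _ ≤ (n : ℝ) ^ 5 / ((n : ℝ) ^ 5 * (n : ℝ) ^ c) := by gcongr
    _ = _ := by field_simp

end Estimates

/-! ### Assembly of the theorem -/

section Main

variable {n m : ℕ} {I : SetSystem n m} {w ℓ L : ℕ}

theorem SetSystem.search (hI : I.Coverable) (hn : 0 < n) {A S : ℕ} (hS : S = ℓ + L + 1)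
    (hℓ : 0 < ℓ) (hL : 0 < L) (hA : A = min (2 * I.opt) (34 * ℓ * m / I.opt))
    (hp : ∀ k, 0 < k → k ≤ 2 * m → Params n m w ℓ L k) :
    ∃ C, Search I w ℓ L I.opt A (1720 * S ^ 3 * (m + n * A)) C := by
  obtain ⟨C, hC, hcard⟩ := SetSystem.opt_spec hI
  have hq := SetSystem.opt_pos hI hn
  have hqm := SetSystem.opt_le_card_sets hI
  have hmono : ∀ a ≤ A, 1720 * S ^ 3 * (m + n * a) ≤ 1720 * S ^ 3 * (m + n * A) := by
    intro a ha; gcongr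
  refine ⟨C.image Fin.val, hp, hL, fun j hj => ?_, fun e he => ?_, ?_, hqm, hq,
    fun r s h => h.opt_le, fun a h₁ h₂ => ?_, fun a ha haA ham => ?_,
    fun a b ha haA hb hbm hab => ?_⟩
  · obtain ⟨i, -, rfl⟩ := Finset.mem_image.1 hj
    exact Finset.mem_range.2 i.2
  · obtain ⟨j, hj, hje⟩ := hC ⟨e, he⟩
    exact ⟨j, Finset.mem_image_of_mem _ hj, (I.mem_nbr ⟨e, he⟩ j).2 hje⟩
  · rw [Finset.card_image_of_injective _ Fin.val_injective, hcard]
  · rw [hA]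
    exact le_min h₁ ((Nat.le_div_iff_mul_le hq).2 h₂)
  · refine (runTime_le hS hℓ hL (by omega) ham (Nat.mul_div_le m a) (a := a) ?_).trans (hmono a haA)
    have h₁ : a * ℓ ≤ a * S := Nat.mul_le_mul_left _ (by omega)
    have h₂ : 1 ≤ a * S := Nat.mul_pos ha (by omega)
    omega
  · refine (runTime_le hS hℓ hL (by omega) hbm (Nat.mul_div_le m b) (a := a) ?_).trans (hmono a haA)
    have h₁ : a ≤ a * S := Nat.le_mul_of_pos_right _ (by omega)
    omega

end Main

theorem theorem3 :
    ∃ d : ℕ, ∀ c : ℕ, ∃ (A K : ℝ) (k : ℕ) (p : Cmd), 1 ≤ k ∧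
      ∀ (n m : ℕ) (I : SetSystem n m), 1 ≤ n → I.Coverable →
        ENNReal.ofReal (1 - 1 / (n : ℝ) ^ c) ≤
          successProb p (wordLength k n m) I
            ⌊K * (coverTime n m I.opt * Real.log (coverTime n m I.opt) ^ d)⌋₊
            (A * Real.log n * I.opt) := by
  -- The exponent `5` counts factors `S = O(log T)`: three in the time of a run, one for the number
  -- of guesses, and one for the factor `ℓ` in the bound on `A`. Moreover `204 = 34 * 2 * 3`, the
  -- `3` from `size_le_log`, and `240800 = 6880 * 35`. The word length leaves room for the constant
  -- `68 * (c + 7)` through `x ≤ 2^x`.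
  refine ⟨5, fun c => ⟨204 * (c + 7), 240800 * (6 * (c + 8)) ^ 5, 68 * (c + 7) + 10,
    Prog.main (2 * (c + 7)), by omega, fun n m I hn₁ hI => ?_⟩⟩
  obtain rfl | hn : n = 1 ∨ 2 ≤ n := by omega
  -- For `n = 1` the required probability is `0`.
  · simp
  have hq := SetSystem.opt_pos hI hn₁
  have hqm := SetSystem.opt_le_card_sets hI
  have hqn := SetSystem.opt_le_card_elements hI
  have hwl : wordLength (68 * (c + 7) + 10) n m = (68 * (c + 7) + 10) * Nat.size (n + m) := rfl
  set w := wordLength (68 * (c + 7) + 10) n m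
  set q := I.opt with hq_def
  set ℓ := 2 * (c + 7) * Nat.size n with hℓ
  set L := Nat.size m with hL
  set Z := Nat.size (n + m) with hZ
  set S := ℓ + L + 1 with hS
  set A := min (2 * q) (34 * ℓ * m / q) with hA
  set T := coverTime n m q with hT
  have hn₀ : 0 < Nat.size n := Nat.size_pos.2 hn₁
  have hL₀ : 0 < L := Nat.size_pos.2 (by omega)
  have hℓ₀ : 0 < ℓ := Nat.mul_pos (by omega) hn₀
  have hnZ : Nat.size n ≤ Z := Nat.size_le_size (by omega)
  have hLZ : L ≤ Z := Nat.size_le_size (by omega)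
  have hZ₂ : 2 ≤ Z := Nat.lt_size.2 (by omega)
  have hZlt : n + m < 2 ^ Z := Nat.lt_size_self _
  have hℓZ : ℓ ≤ 2 * (c + 7) * Z := Nat.mul_le_mul_left _ hnZ
  have hw : 68 * (c + 7) + 8 + 2 * Z + 4 * Z ≤ w := by
    rw [hwl]; nlinarith
  have hwℓ : ℓ ≤ w := hℓZ.trans (by rw [hwl]; gcongr; omega)
  have hww : w < 2 ^ w := Nat.lt_two_pow_self
  have hZw : 2 ^ Z ≤ 2 ^ w := Nat.pow_le_pow_right two_pos (by omega)
  have hlen : 34 * (m * ℓ) + 1 < 2 ^ w := by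
    have hZ' : Z < 2 ^ Z := Nat.lt_two_pow_self
    calc 34 * (m * ℓ) + 1 ≤ 34 * (2 ^ Z * (2 * (c + 7) * 2 ^ Z)) + 1 := by
          gcongr
          · omega
          · exact hℓZ.trans (by gcongr)
      _ = 68 * (c + 7) * (2 ^ Z * 2 ^ Z) + 1 := by ring
      _ ≤ 68 * (c + 7) * (2 ^ Z * 2 ^ Z) + 2 ^ Z * 2 ^ Z := by
          gcongr; exact Nat.mul_pos (by positivity) (by positivity)
      _ = (68 * (c + 7) + 1) * 2 ^ (2 * Z) := by ring
      _ ≤ 2 ^ (68 * (c + 7) + 1) * 2 ^ (2 * Z) := by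
          gcongr; exact Nat.lt_two_pow_self.le
      _ = 2 ^ (68 * (c + 7) + 1 + 2 * Z) := by rw [← pow_add]
      _ < 2 ^ w := Nat.pow_lt_pow_right (by norm_num) (by omega)
  obtain ⟨C, hsearch⟩ := SetSystem.search (w := w) hI hn₁ (A := A) hS hℓ₀ hL₀ hA
    fun k hk hkm => ⟨hk, hℓ₀, Nat.lt_size_self m, hkm, by omega, by omega, hlen⟩
  have hA₀ : 0 < A := lt_min (by omega) (Nat.div_pos (hqm.trans
    (Nat.le_mul_of_pos_left _ (by omega))) hq)
  have hsize : Nat.size q ≤ q := Nat.size_le.2 Nat.lt_two_pow_self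
  obtain ⟨hmT, hnT⟩ := max_le_coverTime hq hqm hqn
  have hT₂ : (2 : ℝ) ≤ T := le_trans (by exact_mod_cast hn) hnT
  have htriple := triple_main (j := Nat.size q) hℓ hL hsearch hA₀ (by omega) (by omega) (by omega)
    (by omega) (Nat.lt_size_self q).le
  refine (ENNReal.ofReal_le_ofReal (sub_le_sub_left
    (error_le hn (hsize.trans hqn) hℓ) 1)).trans (le_successProb_of_triple htriple ?_ ?_)
  · refine Nat.le_floor ?_
    have hjL : Nat.size q ≤ L := Nat.size_le_size hqm
    set R := 1720 * S ^ 3 * (m + n * A) with hR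
    have hS₃ : 3 ≤ S := by omega
    have hsteps : (Nat.size q + 1) * (3 * R + 33) + 6 * (Nat.size n + Nat.size m) + 38 ≤
        6880 * S ^ 4 * (m + n * A) := by
      have hnℓ : Nat.size n ≤ ℓ := Nat.le_mul_of_pos_left _ (by omega)
      have hR' : 58 ≤ R := by
        calc 58 ≤ 1720 * 1 ^ 3 * (1 + 0) := by norm_num
          _ ≤ R := by rw [hR]; gcongr <;> omega
      have h₁ : (Nat.size q + 1) * (3 * R + 33) ≤ 3 * (S * R) + 33 * S := by
        calc _ ≤ S * (3 * R + 33) := by gcongr; omega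
          _ = _ := by ring
      have h₂ : S * 58 ≤ S * R := Nat.mul_le_mul_left _ hR'
      calc _ ≤ 4 * (S * R) := by
            omega
        _ = _ := by rw [hR]; ring
    refine (Nat.cast_le.2 hsteps).trans ?_
    have hlog : 0 ≤ Real.log T := Real.log_nonneg (by linarith)
    have hS' : (S : ℝ) ≤ 6 * (c + 8) * Real.log T := by
      have h₁ := size_le_log hn₁ hnT hT₂
      have h₂ := size_le_log (hq.trans_le hqm) hmT hT₂
      have h₃ : (1 : ℝ) ≤ Nat.size n := by exact_mod_cast hn₀
      have h₄ : (S : ℝ) = 2 * (c + 7) * Nat.size n + Nat.size m + 1 := by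
        rw [hS, hℓ, hL]; push_cast; ring
      calc (S : ℝ) ≤ 2 * (c + 7) * (3 * Real.log T) + 3 * Real.log T + 3 * Real.log T := by
            rw [h₄]; gcongr; linarith
        _ = _ := by ring
    have hmn := add_mul_le_coverTime (n := n) (m := m) hq hqn (show ℓ + 1 ≤ S by omega)
      (min_le_left _ _) ((Nat.le_div_iff_mul_le hq).1 (min_le_right (2 * q) (34 * ℓ * m / q)))
    calc ((6880 * S ^ 4 * (m + n * A) : ℕ) : ℝ) = 6880 * (S : ℝ) ^ 4 * (m + n * A : ℕ) := by
          push_cast; ring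
      _ ≤ 6880 * (S : ℝ) ^ 4 * (35 * S * T) := by gcongr
      _ = 240800 * (S : ℝ) ^ 5 * T := by ring
      _ ≤ 240800 * (6 * (c + 8) * Real.log T) ^ 5 * T := by gcongr
      _ = _ := by ring
  · intro s hs
    refine hs.success ?_
    have h₁ := size_le_log hn₁ le_rfl (show (2 : ℝ) ≤ n by exact_mod_cast hn)
    calc ((34 * (q * ℓ) : ℕ) : ℝ) = 68 * (c + 7) * Nat.size n * q := by
          rw [hℓ]; push_cast; ring
      _ ≤ 68 * (c + 7) * (3 * Real.log n) * q := by gcongr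
      _ = _ := by ring
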